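/- Let $X$ be a smooth projective curve over $\mathbb{C}$ of genus $g=h^1(X,\mathcal O_X)$, let $E\to X$ be a vector bundle of rank $r$ and degree $r(g-1)$ (not necessarily semistable) with $h^0(X,E)\ge 1$, and let $s$ be any nonzero section of $E$. Then $H^0(X,E)$ and $H^1(X,\mathrm{End}\,E)$ are finite-dimensional and \[ h^0(X,E)=\mathrm{codim}\bigl(\mathrm{Span}(N(s)),\ \mathbb{P}H^1(X,\mathrm{End}\,E)\bigr), \] where $\mathbb{P}\Lambda$ is the space of lines in $\Lambda$, $\dim\emptyset=-1$, and $N(s)$ is the following locus. For a vector bundle $V$ on $X$ write $H^1(X,V)=\mathrm{Prin}(V)/\mathrm{Rat}(V)$, where $\mathrm{Rat}(V)$ is the space of rational sections and $\mathrm{Prin}(V)=\bigoplus_{x}\mathrm{Rat}(V)/V_x$ is the space of principal parts; let $[p]$ be the class of $p\in\mathrm{Prin}(V)$. Let $V=\mathrm{End}\,E$, and let $\psi:\mathbb{P}V\dashrightarrow\mathbb{P}H^1(X,V)$ send $\langle v\rangle\in\mathbb{P}(V|_x)$ to the class of the principal part supported at $x$ with a simple pole along $v$. If $z$ is a uniformiser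 at $x$ and $\varphi$ is a section of $V$ near $x$ with $\varphi(x)\neq0$, then $t\mapsto[\varphi/(z-t)]$ is a local lift of $\psi$ along the curve $y\mapsto\langle\varphi(y)\rangle$, where $t=z(y)$; its $m$-th derivative at $t=0$ is $\psi_m(\varphi)=m!\,[\varphi/z^{m+1}]$. The osculating space $\mathrm{Osc}^k(\mathbb{P}V,\langle\varphi(x)\rangle)$ is the projectivisation of the span of the $\psi_m(\varphi)$, $0\le m\le k$, and of the $\psi_{m-1}(w)$ for $1\le m\le k$ and all germs $w\in V_x$ (the operators $\partial^m/\partial z^m$ and $D\,\partial^{m-1}/\partial z^{m-1}$, with $D$ tangent to the fibre); the vertical osculating space $\mathrm{Osc}^k(\mathbb{P}V/X,\langle\varphi(x)\rangle)$ is the projectivisation of the span of $\psi_0(\varphi)$ and of the $\psi_{m-1}(w)$, $1\le m\le k$, $w\in V_x$. These are defined whether or not $\psi$ is an embedding. Let $D=\sum_i k^{(i)}x_i$ be the divisor of zeros of $s$, so that $s$ factors through a bundle injection $\bar s:\mathcal O_X(D)\to E$, and let $K(\bar s)\subseteq\mathrm{End}\,E$ be the subbundle of endomorphisms vanishing on the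 image of $\bar s$. Then $N(s)$ is the union of the image by $\psi$ of $\mathbb{P}K(\bar s)$ (where $\psi$ is defined) and, over all $i$ and all $\langle\varphi\rangle\in\mathbb{P}\,\mathrm{End}(E)|_{x_i}$, of $\mathrm{Osc}^{k^{(i)}-1}(\mathbb{P}\,\mathrm{End}\,E,\langle\varphi\rangle)$ and $\mathrm{Osc}^{k^{(i)}}(\mathbb{P}\,\mathrm{End}(E)/X,\langle\varphi\rangle)$. -/

import Mathlib

open CategoryTheory AlgebraicGeometry
open scoped LinearAlgebra.Projectivization

noncomputable section

namespace CurveBundle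

/-- A smooth projective complex curve: an integral scheme, proper and smooth of relative
dimension one over `Spec ℂ` (proper curves over a field are projective). -/
structure Curve where
  /-- the underlying scheme -/
  X : Scheme.{0}
  /-- the structure morphism -/
  str : X ⟶ Spec (CommRingCat.of ℂ)
  [isIntegral : IsIntegral X]
  [isProper : IsProper str]
  [isSmooth : SmoothOfRelativeDimension 1 str]

attribute [instance] Curve.isIntegral Curve.isProper Curve.isSmooth

instance (C : Curve) : IsLocallyNoetherian C.X :=
  LocallyOfFiniteType.isLocallyNoetherian C.str

/-- The closed points of the curve; these are the points `x ∈ X` of the classical language. -/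
abbrev Curve.Pt (C : Curve) : Type := {x : C.X // IsClosed ({x} : Set C.X)}

/-- The local ring `O_{X,x}`. -/
abbrev Curve.localRing (C : Curve) (x : C.X) : Type := C.X.presheaf.stalk x

/-- The function field `K(X)`. -/
abbrev Curve.K (C : Curve) : Type := C.X.functionField

/-- The constants `ℂ → Γ(X, O_X)` given by the structure morphism. -/
def Curve.constants (C : Curve) : ℂ →+* Γ(C.X, ⊤) :=
  (C.str.appTop.hom).comp (Scheme.ΓSpecIso (CommRingCat.of ℂ)).inv.hom

/-- The constants in the local ring at a point. -/
def Curve.localConstants (C : Curve) (x : C.X) : ℂ →+* C.localRing x :=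
  (C.X.presheaf.germ ⊤ x trivial).hom.comp C.constants

instance (C : Curve) : Algebra ℂ C.K :=
  (C.localConstants (genericPoint C.X)).toAlgebra

/-- An element of the function field is a uniformiser (a local coordinate) at `x` if it is the
image of a generator of the maximal ideal of `O_{X,x}`. -/
def Curve.IsUniformizer (C : Curve) (x : C.Pt) (z : C.K) : Prop :=
  ∃ ϖ : C.localRing x.1, IsLocalRing.maximalIdeal (C.localRing x.1) = Ideal.span {ϖ} ∧
    algebraMap (C.localRing x.1) C.K ϖ = z

/-! ### Principal parts and first cohomology

A vector bundle `V` on `X` enters through the space `R = Rat(V)` of its rational sections and the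
subspaces `L x ⊆ R` of the rational sections which are regular at the closed point `x`. -/

section Cohomology

variable {ι R : Type} [AddCommGroup R] [Module ℂ R]

/-- The principal parts `Prin(V) = ⨁ₓ Rat(V) / Vₓ`, the global sections of the sheaf
`Rat(V) / V`. -/
abbrev Prin (L : ι → Submodule ℂ R) : Type := Π₀ x, R ⧸ L x

/-- The principal parts `s̄` of the rational sections `s ∈ Rat(V)`. -/
def rationalPrin (L : ι → Submodule ℂ R) : Submodule ℂ (Prin L) :=
  (LinearMap.range (LinearMap.pi fun x => (L x).mkQ)).comap (DFinsupp.coeFnLinearMap ℂ)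

/-- `H¹(X, V)`, the cokernel of `Rat(V) → Prin(V)`: the first cohomology, computed by the flasque
resolution `0 → V → Rat(V) → Rat(V) / V → 0`. -/
abbrev H1 (L : ι → Submodule ℂ R) : Type := Prin L ⧸ rationalPrin L

open Classical in
/-- The class in `H¹(X, V)` of the principal part at the single point `x` of a rational
section. -/
def classAt (L : ι → Submodule ℂ R) (x : ι) : R →ₗ[ℂ] H1 L :=
  (rationalPrin L).mkQ ∘ₗ DFinsupp.lsingle x ∘ₗ (L x).mkQ

end Cohomology

/-- The rational functions which are regular at `x`. -/
def Curve.regularFunctions (C : Curve) (x : C.Pt) : Submodule ℂ C.K where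
  carrier := {f | ∃ a : C.localRing x.1, algebraMap _ C.K a = f}
  add_mem' := by
    rintro _ _ ⟨a, rfl⟩ ⟨b, rfl⟩
    exact ⟨a + b, map_add _ _ _⟩
  zero_mem' := ⟨0, map_zero _⟩
  smul_mem' := by
    rintro c _ ⟨a, rfl⟩
    refine ⟨C.localConstants x.1 c * a, ?_⟩
    rw [map_mul, Algebra.smul_def]
    congr 1
    exact C.X.presheaf.germ_stalkSpecializes_apply _ _ _

/-- The genus `g = h¹(X, O_X)`. -/
def Curve.genus (C : Curve) : ℕ := Module.finrank ℂ (H1 C.regularFunctions)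

/-! ### Vector bundles -/

variable {C : Curve}

/-- `E` is a vector bundle of rank `r`: locally there are `r` sections whose restrictions to every
smaller open set `V` form a basis of `Γ(V, E)` over `Γ(V, O_X)`. -/
def IsVectorBundle (E : C.X.Modules) (r : ℕ) : Prop :=
  ∀ x : C.X, ∃ U : C.X.Opens, x ∈ U ∧ ∃ e : Fin r → Γ(E, U),
    ∀ (V : C.X.Opens) (h : V ≤ U),
      LinearIndependent Γ(C.X, V) (fun i => E.presheaf.map (homOfLE h).op (e i)) ∧
      Submodule.span Γ(C.X, V) (Set.range fun i => E.presheaf.map (homOfLE h).op (e i)) = ⊤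

instance (E : C.X.Modules) : Module ℂ Γ(E, ⊤) := Module.compHom _ C.constants

/-- The stalk `E_x`, a module over `O_{X,x}`. -/
def Stalk (E : C.X.Modules) (x : C.X) : Type := E.presheaf.stalk x

instance (E : C.X.Modules) (x : C.X) : AddCommGroup (Stalk E x) :=
  inferInstanceAs (AddCommGroup (E.presheaf.stalk x))

instance (E : C.X.Modules) (x : C.X) : Module (C.localRing x) (Stalk E x) :=
  PresheafOfModules.instModuleCarrierStalkCommRingCatCarrierAbPresheafOpensCarrier
    (R := C.X.presheaf) E.val x

/-- The germ at `x` of a global section. -/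
def germ (E : C.X.Modules) (x : C.X) (s : Γ(E, ⊤)) : Stalk E x :=
  E.presheaf.germ ⊤ x trivial s

/-- `Rat(E)`, the rational sections of `E`: the stalk at the generic point. -/
abbrev Rat (E : C.X.Modules) : Type := Stalk E (genericPoint C.X)

instance (E : C.X.Modules) : Module C.K (Rat E) :=
  inferInstanceAs (Module (C.localRing (genericPoint C.X)) (Stalk E (genericPoint C.X)))

instance (E : C.X.Modules) : Module ℂ (Rat E) := Module.compHom _ (algebraMap ℂ C.K)

instance (E : C.X.Modules) : IsScalarTower ℂ C.K (Rat E) :=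
  IsScalarTower.of_algebraMap_smul fun _ _ => rfl

/-- The map `E_x → Rat(E)` from germs at `x` to rational sections. -/
def toRat (E : C.X.Modules) (x : C.X) : Stalk E x →+ Rat E :=
  (E.presheaf.stalkSpecializes ((genericPoint_spec C.X).specializes trivial)).hom

theorem toRat_smul (E : C.X.Modules) (x : C.X) (a : C.localRing x) (e : Stalk E x) :
    toRat E x (a • e) = algebraMap (C.localRing x) C.K a • toRat E x e := by
  have hη : (genericPoint C.X) ⤳ x := (genericPoint_spec C.X).specializes trivial
  obtain ⟨U, hU, a, rfl⟩ := C.X.presheaf.exists_germ_eq a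
  obtain ⟨V, hV, e, rfl⟩ := E.presheaf.exists_germ_eq e
  have hW : x ∈ U ⊓ V := ⟨hU, hV⟩
  have h1 : C.X.presheaf.germ U x hU a = C.X.presheaf.germ (U ⊓ V) x hW
      (C.X.presheaf.map (homOfLE inf_le_left).op a) :=
    (C.X.presheaf.germ_res_apply (homOfLE inf_le_left) x hW a).symm
  have h2 : E.presheaf.germ V x hV e = E.presheaf.germ (U ⊓ V) x hW
      (E.presheaf.map (homOfLE inf_le_right).op e) :=
    (E.presheaf.germ_res_apply (homOfLE inf_le_right) x hW e).symm
  rw [h1, h2]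
  generalize C.X.presheaf.map (homOfLE inf_le_left).op a = a'
  generalize E.presheaf.map (homOfLE inf_le_right).op e = e'
  have hx : ∀ (y : C.X) (hy : y ∈ U ⊓ V), E.presheaf.germ (U ⊓ V) y hy (a' • e') =
      HSMul.hSMul (α := C.localRing y) (β := Stalk E y) (γ := Stalk E y)
        (C.X.presheaf.germ (U ⊓ V) y hy a') (E.presheaf.germ (U ⊓ V) y hy e') :=
    fun y hy => PresheafOfModules.germ_smul (R := C.X.presheaf) E.val y (U ⊓ V) hy a' e'
  have hg : ∀ m, toRat E x (E.presheaf.germ (U ⊓ V) x hW m) =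
      E.presheaf.germ (U ⊓ V) _ (hη.mem_open (U ⊓ V).isOpen hW) m :=
    fun m => TopCat.Presheaf.germ_stalkSpecializes_apply E.presheaf hW hη m
  have ha : algebraMap (C.localRing x) C.K (C.X.presheaf.germ (U ⊓ V) x hW a') =
      C.X.presheaf.germ (U ⊓ V) _ (hη.mem_open (U ⊓ V).isOpen hW) a' :=
    TopCat.Presheaf.germ_stalkSpecializes_apply C.X.presheaf hW hη a'
  erw [← hx x hW]
  rw [ha]
  erw [hg, hg]
  exact hx _ _

/-- `E` (of rank `r`) has degree `d`: `d` is the degree of the divisor of the rational section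
`b₁ ∧ … ∧ b_r` of `det E`, for a basis `b` of `Rat(E)` over `K(X)`. If `f₁, …, f_r` is a local
frame of `E` at `x`, then `f₁ ∧ … ∧ f_r = det_b(f) • b₁ ∧ … ∧ b_r`, so the order of
`b₁ ∧ … ∧ b_r` at `x` is `-ordₓ det_b(f)`. -/
def HasDegree (E : C.X.Modules) (r : ℕ) (d : ℤ) : Prop :=
  ∃ (b : Module.Basis (Fin r) C.K (Rat E))
    (f : ∀ x : C.Pt, Module.Basis (Fin r) (C.localRing x.1) (Stalk E x.1)),
    d = ∑ᶠ x : C.Pt, -C.X.ord (b.det fun i => toRat E x.1 (f x i)) x.1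

/-- `Rat(End E)`. -/
abbrev RatEnd (E : C.X.Modules) : Type := Module.End C.K (Rat E)

/-- The rational sections of `End E` which are regular at `x`, that is, which map `E_x` to itself:
the stalk `(End E)_x = End(E_x)`. -/
def regularEnd (E : C.X.Modules) (x : C.Pt) : Submodule ℂ (RatEnd E) where
  carrier := {φ | ∀ e : Stalk E x.1, ∃ e' : Stalk E x.1, φ (toRat E x.1 e) = toRat E x.1 e'}
  add_mem' := by
    intro φ χ hφ hχ e
    obtain ⟨a, ha⟩ := hφ e
    obtain ⟨b, hb⟩ := hχ e
    exact ⟨a + b, by rw [LinearMap.add_apply, ha, hb, map_add]⟩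
  zero_mem' := fun e => ⟨0, by simp⟩
  smul_mem' := by
    intro c φ hφ e
    obtain ⟨a, ha⟩ := hφ e
    refine ⟨C.localConstants x.1 c • a, ?_⟩
    rw [LinearMap.smul_apply, ha]
    rw [toRat_smul]
    have h : algebraMap ℂ C.K c = algebraMap (C.localRing x.1) C.K (C.localConstants x.1 c) :=
      (C.X.presheaf.germ_stalkSpecializes_apply _ _ _).symm
    rw [← h, algebraMap_smul]

/-- `H¹(X, End E)`. -/
abbrev H1End (E : C.X.Modules) : Type := H1 (regularEnd E)

/-! ### The map `ψ` and its osculating spaces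

Let `z` be a uniformiser at `x` and let `φ` be a section of `End E` near `x`, not vanishing at
`x`; it defines a curve `y ↦ ⟨φ(y)⟩` in the projective bundle `ℙ End(E)`. By definition
`ψ⟨φ(y)⟩ ∈ ℙ H¹(X, End E)` is the class of a principal part with a simple pole at `y` along
`φ(y)`. In terms of the coordinate `t = z(y)` this principal part is `φ / (z - t)`. So
`t ↦ [φ / (z - t)]` is a local lift of `ψ` along the curve; it is linear in `φ`. -/

/-- `1 / (z - t)` as a power series in `t` over the function field. -/
def simplePole (z : C.K) : PowerSeries C.K := (PowerSeries.C z - PowerSeries.X)⁻¹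

theorem coeff_simplePole {z : C.K} (hz : z ≠ 0) (m : ℕ) :
    PowerSeries.coeff m (simplePole z) = (z ^ (m + 1))⁻¹ := by
  have h : simplePole z = PowerSeries.mk fun n => (z ^ (n + 1))⁻¹ := by
    rw [simplePole, PowerSeries.inv_eq_iff_mul_eq_one (by simpa using hz)]
    ext n
    rw [mul_sub, map_sub, PowerSeries.coeff_mul_C]
    cases n with
    | zero => simp [hz]
    | succ n =>
      rw [PowerSeries.coeff_succ_mul_X]
      simp only [PowerSeries.coeff_mk, PowerSeries.coeff_one]
      simp only [Nat.add_eq_zero_iff, one_ne_zero, and_false, if_false]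
      field_simp
      ring
  rw [h, PowerSeries.coeff_mk]

/-- The derivative `∂ᵐ/∂tᵐ` at `t = 0` of the lift `t ↦ [φ / (z - t)]` of `ψ`. -/
def derivPsi (E : C.X.Modules) (x : C.Pt) (z : C.K) (m : ℕ) (φ : RatEnd E) : H1End E :=
  (m.factorial : ℂ) • classAt (regularEnd E) x (PowerSeries.coeff m (simplePole z) • φ)

/-- The `k`-th osculating space to `ℙ End(E)` at `⟨φ(x)⟩`, as a linear subspace of
`H¹(X, End E)`. The lift of `ψ` is linear in the fibre coordinates, so that the differential
operators of order at most `k` are spanned, as far as their effect on `ψ` is concerned, by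
`∂ᵐ/∂tᵐ` for `m ≤ k` and by `D ∂ᵐ⁻¹/∂tᵐ⁻¹` for `1 ≤ m ≤ k`, where `D` is a tangent vector to the
fibre, given by a vector `w` of `End(E)|ₓ` modulo `φ(x)`. -/
def osc (E : C.X.Modules) (x : C.Pt) (z : C.K) (k : ℕ) (φ : RatEnd E) :
    Submodule ℂ (H1End E) :=
  Submodule.span ℂ
    ({c | ∃ m ≤ k, c = derivPsi E x z m φ} ∪
      {c | ∃ m, 1 ≤ m ∧ m ≤ k ∧ ∃ w ∈ regularEnd E x, c = derivPsi E x z (m - 1) w})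

/-- The `k`-th vertical osculating space to `ℙ End(E)` over `X` at `⟨φ(x)⟩`, as a linear subspace
of `H¹(X, End E)`: only the operators `D ∂ᵐ⁻¹/∂tᵐ⁻¹`, `1 ≤ m ≤ k`, with `D` tangent to the fibre
are used, besides the point itself. -/
def oscVert (E : C.X.Modules) (x : C.Pt) (z : C.K) (k : ℕ) (φ : RatEnd E) :
    Submodule ℂ (H1End E) :=
  Submodule.span ℂ
    ({derivPsi E x z 0 φ} ∪
      {c | ∃ m, 1 ≤ m ∧ m ≤ k ∧ ∃ w ∈ regularEnd E x, c = derivPsi E x z (m - 1) w})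

/-- `s` vanishes at `x` to order at least `m`: its germ lies in `𝔪ₓᵐ E_x = zᵐ E_x`. -/
def VanishesToOrder (E : C.X.Modules) (s : Γ(E, ⊤)) (x : C.Pt) (m : ℕ) : Prop :=
  germ E x.1 s ∈ (IsLocalRing.maximalIdeal (C.localRing x.1)) ^ m •
    (⊤ : Submodule (C.localRing x.1) (Stalk E x.1))

/-- The multiplicity of `x` as a zero of `s` is exactly `m`, that is, the saturation of
`s : O_X → E` is `O_X(D) → E` with `D` of multiplicity `m` at `x`. -/
def HasMultiplicity (E : C.X.Modules) (s : Γ(E, ⊤)) (x : C.Pt) (m : ℕ) : Prop :=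
  VanishesToOrder E s x m ∧ ¬ VanishesToOrder E s x (m + 1)

/-- `φ` is regular at `x` with nonzero value in the fibre `End(E)|ₓ`, so that `⟨φ(x)⟩` is a point
of `ℙ End(E)|ₓ`. -/
def DefinesPoint (E : C.X.Modules) (x : C.Pt) (z : C.K) (φ : RatEnd E) : Prop :=
  φ ∈ regularEnd E x ∧ z⁻¹ • φ ∉ regularEnd E x

/-- The image by `ψ` of `ℙ K(s̄)`, where `K(s̄) ⊆ End(E)` is the subbundle of the endomorphisms
which vanish on the line subbundle of `E` generated by `s`. The germs of sections of `K(s̄)` are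
the germs `φ` of sections of `End(E)` with `φ(s) = 0`. -/
def imageKernelBundle (E : C.X.Modules) (s : Γ(E, ⊤)) : Set (ℙ ℂ (H1End E)) :=
  {P | ∃ (x : C.Pt) (z : C.K) (φ : RatEnd E), C.IsUniformizer x z ∧ DefinesPoint E x z φ ∧
    φ (germ E (genericPoint C.X) s) = 0 ∧
    ∃ h : derivPsi E x z 0 φ ≠ 0, P = Projectivization.mk ℂ (derivPsi E x z 0 φ) h}

/-- The union over the zeros `x` of `s`, with multiplicity `k`, and over all
`⟨φ⟩ ∈ ℙ End(E)|ₓ` of the `(k - 1)`-st osculating space and of the `k`-th vertical osculating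
space to `ℙ End(E)` at `⟨φ⟩`. -/
def osculatingLocus (E : C.X.Modules) (s : Γ(E, ⊤)) : Set (ℙ ℂ (H1End E)) :=
  {P | ∃ (x : C.Pt) (k : ℕ) (z : C.K) (φ : RatEnd E), 1 ≤ k ∧ HasMultiplicity E s x k ∧
    C.IsUniformizer x z ∧ DefinesPoint E x z φ ∧
    (P ∈ (osc E x z (k - 1) φ).projectivization ∨ P ∈ (oscVert E x z k φ).projectivization)}

/-- The locus `N(s) ⊆ ℙ H¹(X, End E)`. -/
def locusN (E : C.X.Modules) (s : Γ(E, ⊤)) : Set (ℙ ℂ (H1End E)) :=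
  imageKernelBundle E s ∪ osculatingLocus E s

/-- The dimension of the projective space `ℙ W`, with `dim ∅ = -1`. -/
def projDim (W : Type) [AddCommGroup W] [Module ℂ W] : ℤ := (Module.finrank ℂ W : ℤ) - 1

/-- The codimension of a linear subspace of `ℙ W`. -/
def projCodim {W : Type} [AddCommGroup W] [Module ℂ W]
    (S : Projectivization.Subspace ℂ W) : ℤ :=
  projDim W - projDim (Projectivization.Subspace.submodule S)

end CurveBundle

end

/-!
Let `s` be a nonzero section of `E`. Evaluation of endomorphisms at `s` gives a linear map
`ev : H¹(End E) → H¹(E)`, on principal parts `[φ] ↦ [φ(s)]`. It is surjective, because every rational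
section of `E` is the value at `s` of a rational endomorphism (`evalH1_surjective`). As the degree
`r(g - 1)` makes the Euler characteristic of `E` vanish, `h⁰(E) = h¹(E)` is the codimension of the
kernel of `ev` (`finrank_H0_eq_codim_ker`). It remains to see that this kernel is the linear span
of `N(s)`.

All points of `N(s)` lie in the kernel: a simple pole along an endomorphism which kills `s` is sent
to zero, and a pole of order at most `k` is cancelled by a zero of `s` of multiplicity `k`
(`IsVectorBundle.span_locusN_le`). Conversely (`ker_evalH1`), let a class in the kernel be given by
principal parts `φ_x`. After subtracting a rational endomorphism, `φ_x(s)` is regular at each `x`.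
If `k` is the multiplicity of `s` at `x`, then there is a rational linear form `l` on `E` with
`l(s) = 1` and with a pole of order at most `k` at `x`. So `φ_x` is the sum of `l ⊗ φ_x(s)`, which
is in the span of the vertical osculating spaces at `x`, and of an endomorphism which kills `s`.
The latter are the rational sections of a vector bundle, and the first cohomology of any vector
bundle is spanned by the simple poles: a linear form on it which vanishes on them can be multiplied
by the functions whose poles are simple, and these are more than the dual space has room for
(`IsLatticeFamily.eq_zero_of_simplePoles`).

The finiteness theorems and Riemann–Roch are proved with principal parts. A vector bundle is a
family of lattices in the space of its rational sections; enlarging a lattice at one point changes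
the Euler characteristic by the index, which is the order of a determinant
(`cohomology_of_le_of_eq_off`, `finrank_quotient_range_mulVecLin`), and so every bundle is compared
with a trivial one (`chi_lattice`). For the structure sheaf, an affine chart which is finite over
the affine line has a coordinate `t` whose poles are exactly the points outside the chart;
polynomial division in `t` bounds the orders of the poles needed to represent a class in `H¹(O)`
(`Places.finite_H1_functions`). Since the curve is proper, the functions without poles are constant
(`Curve.mem_range_of_forall_mem_valuationRing`), so that `χ(O) = 1 - g`.
-/

noncomputable section

namespace CurveBundle

/-! ### Classes of principal parts -/

section PrincipalParts

variable {ι R R' V : Type} [AddCommGroup R] [Module ℂ R] [AddCommGroup R'] [Module ℂ R']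
  [AddCommGroup V] [Module ℂ V] {L : ι → Submodule ℂ R} {L' : ι → Submodule ℂ R'}

open Classical in
theorem classAt_apply (x : ι) (v : R) :
    classAt L x v = (rationalPrin L).mkQ (DFinsupp.single x ((L x).mkQ v)) := rfl

/-- Every class is a finite sum of classes of principal parts at single points, and the set of
points may be enlarged at will. -/
theorem H1.exists_eq_sum_of_subset (G : Finset ι) (h : H1 L) :
    ∃ (F : Finset ι) (v : ι → R), G ⊆ F ∧ h = ∑ x ∈ F, classAt L x (v x) := by
  classical
  obtain ⟨p, rfl⟩ := (rationalPrin L).mkQ_surjective h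
  choose v hv using fun x => (L x).mkQ_surjective (p x)
  refine ⟨G ∪ p.support, v, Finset.subset_union_left, ?_⟩
  simp only [classAt_apply, hv, ← map_sum]
  congr 1
  rw [← Finset.sum_subset Finset.subset_union_right]
  · exact (DFinsupp.sum_single (f := p)).symm
  · intro x _ hx
    rw [DFinsupp.notMem_support_iff.1 hx, DFinsupp.single_zero]

theorem H1.exists_eq_sum (h : H1 L) :
    ∃ (F : Finset ι) (v : ι → R), h = ∑ x ∈ F, classAt L x (v x) := by
  obtain ⟨F, v, -, h⟩ := H1.exists_eq_sum_of_subset ∅ h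
  exact ⟨F, v, h⟩

/-- The class of a principal part is zero if and only if it is that of a rational section `e`. -/
theorem sum_classAt_eq_zero_iff (F : Finset ι) (v : ι → R) :
    ∑ x ∈ F, classAt L x (v x) = 0 ↔
      ∃ e : R, (∀ x ∈ F, e - v x ∈ L x) ∧ ∀ x ∉ F, e ∈ L x := by
  classical
  have key : ∀ y, (∑ x ∈ F, DFinsupp.single x ((L x).mkQ (v x)) : Prin L) y =
      if y ∈ F then (L y).mkQ (v y) else 0 := by
    intro y
    rw [DFinsupp.finsetSum_apply]
    split_ifs with hy
    · rw [Finset.sum_eq_single y]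
      · simp
      · intro x _ hxy
        exact DFinsupp.single_eq_of_ne (Ne.symm hxy)
      · exact fun h => (h hy).elim
    · refine Finset.sum_eq_zero fun x hx => DFinsupp.single_eq_of_ne ?_
      rintro rfl
      exact hy hx
  simp only [classAt_apply, ← map_sum]
  rw [Submodule.mkQ_apply, Submodule.Quotient.mk_eq_zero, rationalPrin, Submodule.mem_comap,
    LinearMap.mem_range]
  refine exists_congr fun e => ?_
  rw [funext_iff]
  constructor
  · intro h
    refine ⟨fun x hx => ?_, fun x hx => ?_⟩
    · have h1 : (L x).mkQ e = _ := (h x).trans (key x)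
      rw [if_pos hx] at h1
      exact (Submodule.Quotient.eq _).1 h1
    · have h1 : (L x).mkQ e = _ := (h x).trans (key x)
      rw [if_neg hx] at h1
      exact (Submodule.Quotient.mk_eq_zero _).1 h1
  · rintro ⟨h1, h2⟩ x
    refine Eq.trans ?_ (key x).symm
    split_ifs with hx
    · exact (Submodule.Quotient.eq _).2 (h1 x hx)
    · exact (Submodule.Quotient.mk_eq_zero _).2 (h2 x hx)

theorem classAt_eq_zero_iff (x : ι) (v : R) :
    classAt L x v = 0 ↔ ∃ e : R, e - v ∈ L x ∧ ∀ y ≠ x, e ∈ L y := by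
  simpa using sum_classAt_eq_zero_iff (L := L) {x} (fun _ => v)

theorem classAt_eq_zero {x : ι} {v : R} (hv : v ∈ L x) : classAt L x v = 0 :=
  (classAt_eq_zero_iff x v).2 ⟨0, by simpa using hv, fun _ _ => zero_mem _⟩

theorem classAt_congr {x : ι} {v w : R} (h : v - w ∈ L x) : classAt L x v = classAt L x w := by
  rw [← sub_eq_zero, ← map_sub, classAt_eq_zero h]

/-- The principal parts of a rational section have the class zero. -/
theorem sum_classAt_rational {F : Finset ι} {e : R} (he : ∀ x ∉ F, e ∈ L x) :
    ∑ x ∈ F, classAt L x e = 0 :=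
  (sum_classAt_eq_zero_iff F fun _ => e).2 ⟨e, fun x _ => by simp, he⟩

/-- Linear maps out of `H¹` are determined by their values on principal parts at single points. -/
theorem H1.hom_ext {f g : H1 L →ₗ[ℂ] V}
    (h : ∀ x v, f (classAt L x v) = g (classAt L x v)) : f = g := by
  ext p
  obtain ⟨F, v, hp⟩ := H1.exists_eq_sum ((rationalPrin L).mkQ p)
  change f ((rationalPrin L).mkQ p) = g ((rationalPrin L).mkQ p)
  rw [hp, map_sum, map_sum]
  exact Finset.sum_congr rfl fun x _ => h x _

open Classical in
/-- A linear map out of `H¹`, given by its values on principal parts at single points. -/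
def H1.lift (ℓ : ι → R →ₗ[ℂ] V) (h0 : ∀ x, ∀ v ∈ L x, ℓ x v = 0)
    (h1 : ∀ (F : Finset ι) (e : R), (∀ x ∉ F, e ∈ L x) → ∑ x ∈ F, ℓ x e = 0) : H1 L →ₗ[ℂ] V :=
  (rationalPrin L).liftQ (DFinsupp.lsum ℕ fun x => (L x).liftQ (ℓ x) (h0 x)) (by
    rintro p ⟨e, he⟩
    have he' : ∀ x, (L x).mkQ e = p x := fun x => congrFun he x
    have hp : p = ∑ x ∈ p.support, DFinsupp.single x ((L x).mkQ e) := by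
      conv_lhs => rw [← DFinsupp.sum_single (f := p)]
      exact Finset.sum_congr rfl fun x _ => by rw [he']
    rw [LinearMap.mem_ker, hp, map_sum]
    refine Eq.trans (Finset.sum_congr rfl fun x _ => ?_) (h1 p.support e fun x hx => ?_)
    · erw [DFinsupp.lsum_single]
      rfl
    · rw [← Submodule.Quotient.mk_eq_zero]
      exact (he' x).trans (by simpa using hx))

open Classical in
@[simp]
theorem H1.lift_classAt (ℓ : ι → R →ₗ[ℂ] V) (h0 : ∀ x, ∀ v ∈ L x, ℓ x v = 0)
    (h1 : ∀ (F : Finset ι) (e : R), (∀ x ∉ F, e ∈ L x) → ∑ x ∈ F, ℓ x e = 0) (x : ι) (v : R) :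
    H1.lift ℓ h0 h1 (classAt L x v) = ℓ x v := by
  rw [classAt_apply, H1.lift]
  erw [Submodule.liftQ_apply, DFinsupp.lsum_single]
  rfl

/-- The map induced on `H¹` by a linear map of rational sections which preserves regularity. -/
def H1.map (T : R →ₗ[ℂ] R') (hT : ∀ x, ∀ v ∈ L x, T v ∈ L' x) : H1 L →ₗ[ℂ] H1 L' :=
  H1.lift (fun x => classAt L' x ∘ₗ T) (fun x v hv => classAt_eq_zero (hT x v hv))
    fun _ _ he => sum_classAt_rational fun x hx => hT x _ (he x hx)

@[simp]
theorem H1.map_classAt (T : R →ₗ[ℂ] R') (hT : ∀ x, ∀ v ∈ L x, T v ∈ L' x) (x : ι) (v : R) :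
    H1.map T hT (classAt L x v) = classAt L' x (T v) := H1.lift_classAt _ _ _ _ _

theorem H1.map_surjective (T : R →ₗ[ℂ] R') (hT : ∀ x, ∀ v ∈ L x, T v ∈ L' x)
    (hs : Function.Surjective T) : Function.Surjective (H1.map T hT) := by
  intro h
  obtain ⟨F, v, rfl⟩ := H1.exists_eq_sum h
  choose w hw using fun x => hs (v x)
  exact ⟨∑ x ∈ F, classAt L x (w x), by simp [hw]⟩

/-- The sections which are regular everywhere. -/
def H0 (L : ι → Submodule ℂ R) : Submodule ℂ R := ⨅ x, L x

theorem mem_H0 {v : R} : v ∈ H0 L ↔ ∀ x, v ∈ L x := Submodule.mem_iInf _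

end PrincipalParts

/-! ### Euler characteristics -/

section EulerCharacteristic

/-- Finiteness and the alternating sum of dimensions along an exact sequence
`0 → A₀ → A → Q → B → B' → 0` with `Q` finite dimensional. -/
theorem finite_of_five_term {A₀ A Q B B' : Type} [AddCommGroup A₀] [Module ℂ A₀] [AddCommGroup A]
    [Module ℂ A] [AddCommGroup Q] [Module ℂ Q] [AddCommGroup B] [Module ℂ B] [AddCommGroup B']
    [Module ℂ B'] (f₀ : A₀ →ₗ[ℂ] A) (f₁ : A →ₗ[ℂ] Q) (f₂ : Q →ₗ[ℂ] B) (f₃ : B →ₗ[ℂ] B')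
    (h₀ : Function.Injective f₀) (h₁ : LinearMap.range f₀ = LinearMap.ker f₁)
    (h₂ : LinearMap.range f₁ = LinearMap.ker f₂) (h₃ : LinearMap.range f₂ = LinearMap.ker f₃)
    (h₄ : Function.Surjective f₃) [Module.Finite ℂ Q] :
    (Module.Finite ℂ A ↔ Module.Finite ℂ A₀) ∧ (Module.Finite ℂ B ↔ Module.Finite ℂ B') ∧
    (Module.Finite ℂ A → Module.Finite ℂ B →
      (Module.finrank ℂ A : ℤ) - Module.finrank ℂ B' =
        Module.finrank ℂ A₀ - Module.finrank ℂ B + Module.finrank ℂ Q) := by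
  have hA : Module.Finite ℂ A ↔ Module.Finite ℂ A₀ := by
    refine ⟨fun _ => Module.Finite.of_injective f₀ h₀, fun _ => ?_⟩
    have : Module.Finite ℂ (LinearMap.ker f₁) := by rw [← h₁]; infer_instance
    have := Module.Finite.equiv f₁.quotKerEquivRange.symm
    exact Module.Finite.of_submodule_quotient (LinearMap.ker f₁)
  have hB : Module.Finite ℂ B ↔ Module.Finite ℂ B' := by
    refine ⟨fun _ => Module.Finite.of_surjective f₃ h₄, fun _ => ?_⟩
    have : Module.Finite ℂ (LinearMap.ker f₃) := by rw [← h₃]; infer_instance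
    have := Module.Finite.equiv (f₃.quotKerEquivOfSurjective h₄).symm
    exact Module.Finite.of_submodule_quotient (LinearMap.ker f₃)
  refine ⟨hA, hB, fun _ _ => ?_⟩
  have e₀ := LinearMap.finrank_range_of_inj h₀
  have e₁ := f₁.finrank_range_add_finrank_ker
  have e₂ := f₂.finrank_range_add_finrank_ker
  have e₃ := f₃.finrank_range_add_finrank_ker
  rw [LinearMap.range_eq_top.2 h₄, finrank_top] at e₃
  rw [← h₁, e₀] at e₁
  rw [← h₂] at e₂
  rw [← h₃] at e₃
  omega

variable {ι R : Type} [AddCommGroup R] [Module ℂ R]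

/-- The quotient `M / N` for subspaces `N ≤ M`; without this inclusion it is `M / (N ∩ M)`. -/
abbrev relQuot (N M : Submodule ℂ R) : Type := M ⧸ N.comap M.subtype

/-- The Euler characteristic `h⁰ - h¹`, meaningful if both spaces are finite dimensional. -/
def chi (L : ι → Submodule ℂ R) : ℤ := Module.finrank ℂ (H0 L) - Module.finrank ℂ (H1 L)

variable {L L' : ι → Submodule ℂ R}

/-- Enlarging the lattice at one point `y`: the long exact cohomology sequence
`0 → H⁰(L) → H⁰(L') → L'_y / L_y → H¹(L) → H¹(L') → 0`. -/
theorem cohomology_of_le_of_eq_off {y : ι} (hle : L y ≤ L' y) (heq : ∀ x ≠ y, L x = L' x)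
    [hf : Module.Finite ℂ (relQuot (L y) (L' y))] :
    (Module.Finite ℂ (H0 L') ↔ Module.Finite ℂ (H0 L)) ∧
    (Module.Finite ℂ (H1 L) ↔ Module.Finite ℂ (H1 L')) ∧
    (Module.Finite ℂ (H0 L') → Module.Finite ℂ (H1 L) →
      chi L' = chi L + Module.finrank ℂ (relQuot (L y) (L' y))) := by
  have hle' : ∀ x, L x ≤ L' x := fun x => by
    by_cases hx : x = y
    · subst hx; exact hle
    · exact (heq x hx).le
  have h0 : H0 L ≤ H0 L' := iInf_mono hle'
  have hy : ∀ v ∈ H0 L', v ∈ L' y := fun v hv => mem_H0.1 hv y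
  let f₁ : H0 L' →ₗ[ℂ] relQuot (L y) (L' y) :=
    ((L y).comap (L' y).subtype).mkQ ∘ₗ Submodule.inclusion (iInf_le _ y)
  let f₂ : relQuot (L y) (L' y) →ₗ[ℂ] H1 L :=
    ((L y).comap (L' y).subtype).liftQ (classAt L y ∘ₗ (L' y).subtype) (by
      intro v hv
      exact classAt_eq_zero hv)
  let f₃ : H1 L →ₗ[ℂ] H1 L' := H1.map LinearMap.id hle'
  have key := finite_of_five_term (Submodule.inclusion h0) f₁ f₂ f₃
    (Submodule.inclusion_injective h0) ?_ ?_ ?_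
    (H1.map_surjective _ _ Function.surjective_id)
  · refine ⟨key.1, key.2.1, fun ha hb => ?_⟩
    have := key.2.2 ha hb
    simp only [chi]
    have h3 := key.2.1.1 hb
    omega
  · ext ⟨v, hv⟩
    rw [Submodule.range_inclusion, LinearMap.mem_ker, Submodule.mem_comap]
    have : f₁ ⟨v, hv⟩ = 0 ↔ v ∈ L y := by
      change Submodule.Quotient.mk _ = _ ↔ _
      rw [Submodule.Quotient.mk_eq_zero]
      rfl
    rw [this]
    change v ∈ H0 L ↔ _
    rw [mem_H0]
    refine ⟨fun h => h y, fun h x => ?_⟩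
    by_cases hx : x = y
    · rwa [hx]
    · rw [heq x hx]
      exact mem_H0.1 hv x
  · ext q
    obtain ⟨⟨v, hv⟩, rfl⟩ := Submodule.mkQ_surjective _ q
    rw [LinearMap.mem_ker, LinearMap.mem_range]
    have h2 : f₂ (Submodule.mkQ _ ⟨v, hv⟩) = classAt L y v := rfl
    rw [h2, classAt_eq_zero_iff]
    constructor
    · rintro ⟨⟨e, he⟩, h⟩
      refine ⟨e, ?_, fun x hx => ?_⟩
      · have h' := (Submodule.Quotient.eq _).1 h
        exact h'
      · rw [heq x hx]; exact mem_H0.1 he x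
    · rintro ⟨e, h1, h2⟩
      refine ⟨⟨e, mem_H0.2 fun x => ?_⟩, (Submodule.Quotient.eq _).2 h1⟩
      by_cases hx : x = y
      · subst hx
        simpa using add_mem (hle h1) hv
      · rw [← heq x hx]; exact h2 x hx
  · apply le_antisymm
    · rintro _ ⟨q, rfl⟩
      obtain ⟨⟨v, hv⟩, rfl⟩ := Submodule.mkQ_surjective _ q
      change f₃ (classAt L y v) = 0
      rw [H1.map_classAt]
      exact classAt_eq_zero hv
    · intro h hh
      classical
      obtain ⟨F, v, hy, rfl⟩ := H1.exists_eq_sum_of_subset {y} h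
      rw [Finset.singleton_subset_iff] at hy
      rw [LinearMap.mem_ker, map_sum] at hh
      simp only [f₃, H1.map_classAt, LinearMap.id_apply] at hh
      obtain ⟨e, he, he'⟩ := (sum_classAt_eq_zero_iff F v).1 hh
      have hr := sum_classAt_rational (L := L) (F := F) (e := e) fun x hx => by
        rw [heq x (by rintro rfl; exact hx hy)]
        exact he' x hx
      have hw : ∑ x ∈ F, classAt L x (v x) = classAt L y (v y - e) := by
        rw [← sub_zero (∑ x ∈ F, _), ← hr, ← Finset.sum_sub_distrib,
          Finset.sum_eq_single_of_mem y hy, map_sub]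
        intro x hx hxy
        rw [← map_sub, classAt_eq_zero]
        rw [heq x hxy, ← neg_sub]
        exact neg_mem (he x hx)
      have hmem : v y - e ∈ L' y := by
        rw [← neg_sub]
        exact neg_mem (he y hy)
      exact ⟨Submodule.mkQ _ ⟨v y - e, hmem⟩, hw.symm⟩

end EulerCharacteristic

end CurveBundle

end

noncomputable section

namespace CurveBundle

section EulerCharacteristic

variable {ι R : Type} [AddCommGroup R] [Module ℂ R]

/-- Enlarging the lattice at finitely many points. -/
theorem cohomology_of_le_of_eq_off_finset {L L' : ι → Submodule ℂ R} (S : Finset ι)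
    (hle : ∀ x ∈ S, L x ≤ L' x) (heq : ∀ x ∉ S, L x = L' x)
    (hf : ∀ x ∈ S, Module.Finite ℂ (relQuot (L x) (L' x))) :
    (Module.Finite ℂ (H0 L') ↔ Module.Finite ℂ (H0 L)) ∧
    (Module.Finite ℂ (H1 L) ↔ Module.Finite ℂ (H1 L')) ∧
    (Module.Finite ℂ (H0 L') → Module.Finite ℂ (H1 L) →
      chi L' = chi L + ∑ x ∈ S, (Module.finrank ℂ (relQuot (L x) (L' x)) : ℤ)) := by
  classical
  induction S using Finset.induction_on generalizing L' with
  | empty =>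
    have : L = L' := funext fun x => heq x (Finset.notMem_empty x)
    subst this
    simp
  | insert y S hy ih =>
    let L₁ := Function.update L' y (L y)
    have h1 : ∀ x ≠ y, L₁ x = L' x := fun x hx => Function.update_of_ne hx _ _
    have h1y : L₁ y = L y := Function.update_self _ _ _
    have hS : ∀ x ∈ S, x ≠ y := by rintro x hx rfl; exact hy hx
    obtain ⟨a1, a2, a3⟩ := ih (L' := L₁)
      (fun x hx => by rw [h1 x (hS x hx)]; exact hle x (Finset.mem_insert_of_mem hx))
      (fun x hx => by
        by_cases hxy : x = y
        · rw [hxy, h1y]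
        · rw [h1 x hxy]; exact heq x (by simp [hxy, hx]))
      (fun x hx => by rw [h1 x (hS x hx)]; exact hf x (Finset.mem_insert_of_mem hx))
    have hfy : Module.Finite ℂ (relQuot (L₁ y) (L' y)) := by
      rw [h1y]; exact hf y (Finset.mem_insert_self y S)
    obtain ⟨b1, b2, b3⟩ := cohomology_of_le_of_eq_off (L := L₁) (L' := L') (y := y)
      (by rw [h1y]; exact hle y (Finset.mem_insert_self y S)) h1
    refine ⟨b1.trans a1, a2.trans b2, fun hA hB => ?_⟩
    rw [b3 hA (a2.1 hB), a3 (b1.1 hA |> a1.1 |> a1.2) hB, Finset.sum_insert hy, h1y,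
      Finset.sum_congr rfl fun x hx => by rw [h1 x (hS x hx)]]
    ring

end EulerCharacteristic

/-! ### Lattices over a discrete valuation ring -/

section LocalTheory

/-- `O ⊆ K` is a discrete valuation ring with uniformiser `z`, fraction field `K` and residue
field `ℂ`. The residue map is `ρ`; as `z⁻¹` is taken in `K`, divisibility by the uniformiser is
expressed as `z⁻¹ * a ∈ O`. -/
structure IsPlace {K : Type} [Field K] [Algebra ℂ K] (O : Subalgebra ℂ K) (z : K) : Prop where
  mem : z ∈ O
  inv_notMem : z⁻¹ ∉ O
  exists_eq_mul_zpow : ∀ f : K, f ≠ 0 → ∃ (n : ℤ) (u : K), u ∈ O ∧ u⁻¹ ∈ O ∧ f = u * z ^ n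
  exists_residue : ∃ ρ : O →ₐ[ℂ] ℂ, ∀ a : O, ρ a = 0 ↔ z⁻¹ * a ∈ O

variable {K : Type} [Field K] [Algebra ℂ K] {O : Subalgebra ℂ K} {z : K}

namespace IsPlace

theorem ne_zero (h : IsPlace O z) : z ≠ 0 := by
  rintro rfl
  exact h.inv_notMem (by simp)

theorem nonneg_of_mem (h : IsPlace O z) {u : K} {n : ℤ} (hu : u⁻¹ ∈ O) (hu0 : u ≠ 0)
    (hm : u * z ^ n ∈ O) : 0 ≤ n := by
  by_contra hn
  have h1 : z ^ n ∈ O := by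
    have := mul_mem hu hm
    rwa [inv_mul_cancel_left₀ hu0] at this
  obtain ⟨m, hm⟩ : ∃ m : ℕ, n = -(m + 1 : ℕ) := ⟨(-n - 1).toNat, by omega⟩
  refine h.inv_notMem ?_
  have := mul_mem h1 (pow_mem h.mem m)
  have h2 : z ^ n * z ^ m = z⁻¹ := by
    rw [hm, zpow_neg, zpow_natCast, pow_succ]
    field_simp [h.ne_zero]
  rwa [h2] at this

theorem zpow_mem (h : IsPlace O z) {n : ℤ} (hn : 0 ≤ n) : z ^ n ∈ O := by
  lift n to ℕ using hn
  rw [zpow_natCast]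
  exact pow_mem h.mem n

/-- A function which is not regular has a regular inverse, and the inverse vanishes. -/
theorem inv_mul_inv_mem (h : IsPlace O z) {f : K} (hf : f ∉ O) : z⁻¹ * f⁻¹ ∈ O := by
  have hf0 : f ≠ 0 := by rintro rfl; exact hf (zero_mem _)
  obtain ⟨n, u, hu, hu', rfl⟩ := h.exists_eq_mul_zpow f hf0
  have hn : n < 0 := by
    by_contra hn
    exact hf (mul_mem hu (h.zpow_mem (not_lt.1 hn)))
  have : z⁻¹ * (u * z ^ n)⁻¹ = u⁻¹ * z ^ (-n - 1) := by
    rw [zpow_sub₀ h.ne_zero, zpow_neg, mul_inv, zpow_one]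
    field_simp
  rw [this]
  exact mul_mem hu' (h.zpow_mem (by omega))

theorem exists_pow_mul_mem (h : IsPlace O z) (f : K) : ∃ n : ℕ, z ^ n * f ∈ O := by
  by_cases hf : f = 0
  · exact ⟨0, by simp [hf]⟩
  obtain ⟨n, u, hu, -, rfl⟩ := h.exists_eq_mul_zpow f hf
  refine ⟨n.natAbs, ?_⟩
  have : z ^ n.natAbs * (u * z ^ n) = u * z ^ (n.natAbs + n) := by
    rw [zpow_add₀ h.ne_zero, zpow_natCast]; ring
  rw [this]
  exact mul_mem hu (h.zpow_mem (by omega))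

end IsPlace

/-- Multiplicativity of the index of the image of an injective endomorphism. -/
theorem finrank_quotient_range_comp {V : Type} [AddCommGroup V] [Module ℂ V] (A B : V →ₗ[ℂ] V)
    (hA : Function.Injective A) [Module.Finite ℂ (V ⧸ LinearMap.range A)]
    [Module.Finite ℂ (V ⧸ LinearMap.range B)] :
    Module.Finite ℂ (V ⧸ LinearMap.range (A ∘ₗ B)) ∧
    Module.finrank ℂ (V ⧸ LinearMap.range (A ∘ₗ B)) =
      Module.finrank ℂ (V ⧸ LinearMap.range A) + Module.finrank ℂ (V ⧸ LinearMap.range B) := by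
  have hle : LinearMap.range (A ∘ₗ B) ≤ LinearMap.range A := LinearMap.range_comp_le_range _ _
  let f₀ : (V ⧸ LinearMap.range B) →ₗ[ℂ] (V ⧸ LinearMap.range (A ∘ₗ B)) :=
    Submodule.mapQ _ _ A (by rintro _ ⟨v, rfl⟩; exact ⟨v, rfl⟩)
  let f₁ : (V ⧸ LinearMap.range (A ∘ₗ B)) →ₗ[ℂ] (V ⧸ LinearMap.range A) := Submodule.factor hle
  have key := finite_of_five_term (B := PUnit) (B' := PUnit) f₀ f₁ 0 0 ?_ ?_ ?_ ?_ ?_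
  · have hfin := key.1.2 inferInstance
    refine ⟨hfin, ?_⟩
    have := key.2.2 hfin inferInstance
    simp only [Module.finrank_zero_of_subsingleton] at this
    omega
  · rw [← LinearMap.ker_eq_bot, LinearMap.ker_eq_bot']
    intro q hq
    obtain ⟨v, rfl⟩ := Submodule.mkQ_surjective _ q
    obtain ⟨w, hw⟩ := (Submodule.Quotient.mk_eq_zero _).1 hq
    exact (Submodule.Quotient.mk_eq_zero _).2 ⟨w, hA hw⟩
  · ext q
    obtain ⟨v, rfl⟩ := Submodule.mkQ_surjective _ q
    rw [LinearMap.mem_ker]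
    have h1 : f₁ (Submodule.mkQ _ v) = 0 ↔ v ∈ LinearMap.range A :=
      Submodule.Quotient.mk_eq_zero _
    rw [h1]
    constructor
    · rintro ⟨q, hq⟩
      obtain ⟨w, rfl⟩ := Submodule.mkQ_surjective _ q
      have h2 := (Submodule.Quotient.eq _).1 hq
      have := sub_mem (LinearMap.mem_range_self A w) (hle h2)
      simpa using this
    · rintro ⟨w, rfl⟩
      exact ⟨Submodule.mkQ _ w, rfl⟩
  · rw [LinearMap.ker_zero, LinearMap.range_eq_top]
    exact Submodule.factor_surjective hle
  · ext q; simp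
  · intro; exact ⟨0, Subsingleton.elim _ _⟩

variable {J : Type} [Fintype J] [DecidableEq J]

/-- The cokernel of a matrix over a discrete valuation ring has the dimension given by the order
of the determinant. If the determinant vanishes at the place, then some constant vector `c` is
killed by the reduction of the matrix, and a column operation which uses `c` splits off a factor
with determinant `z`. -/
theorem finrank_quotient_range_mulVecLin (h : IsPlace O z) (n : ℕ) (P : Matrix J J O) (u : O)
    (hu : IsUnit u) (hP : P.det = u * ⟨z, h.mem⟩ ^ n) :
    Module.Finite ℂ ((J → O) ⧸ LinearMap.range (P.mulVecLin.restrictScalars ℂ)) ∧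
    Module.finrank ℂ ((J → O) ⧸ LinearMap.range (P.mulVecLin.restrictScalars ℂ)) = n := by
  induction n generalizing P with
  | zero =>
    have hP' : IsUnit P := by
      rw [Matrix.isUnit_iff_isUnit_det, hP]
      simpa using hu
    have : LinearMap.range (P.mulVecLin.restrictScalars ℂ) = ⊤ := by
      rw [LinearMap.range_eq_top]
      exact Matrix.mulVec_surjective_iff_isUnit.2 hP'
    have : Subsingleton ((J → O) ⧸ LinearMap.range (P.mulVecLin.restrictScalars ℂ)) := by
      rw [this]; infer_instance
    exact ⟨⟨⟨∅, Subsingleton.elim _ _⟩⟩, Module.finrank_zero_of_subsingleton⟩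
  | succ n ih =>
    obtain ⟨ρ, hρ⟩ := h.exists_residue
    set ϖ : O := ⟨z, h.mem⟩ with hϖ
    have hϖ0 : ϖ ≠ 0 := fun h0 => h.ne_zero (congrArg Subtype.val h0)
    have hρϖ : ρ ϖ = 0 := (hρ ϖ).2 (by simp [hϖ, h.ne_zero])
    -- the reduction of `P` modulo the uniformiser is singular
    have hdet : (ρ.toRingHom.mapMatrix P).det = 0 := by
      rw [← RingHom.map_det, hP]
      simp [hρϖ]
    obtain ⟨c, hc0, hc⟩ := Matrix.exists_mulVec_eq_zero_iff.2 hdet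
    obtain ⟨j, hj⟩ := Function.ne_iff.1 hc0
    wlog hcj : c j = 1 generalizing c
    · refine this ((c j)⁻¹ • c) (fun h0 => hj ?_) ?_ ?_ ?_
      · simpa using (smul_eq_zero.1 h0).resolve_left (inv_ne_zero hj) ▸ rfl
      · rw [Matrix.mulVec_smul, hc, smul_zero]
      · simpa using hj
      · simpa using inv_mul_cancel₀ hj
    have hw : ∀ i, ∃ w : O, ϖ * w = ∑ l, P i l * algebraMap ℂ O (c l) := by
      intro i
      have h1 : ρ (∑ l, P i l * algebraMap ℂ O (c l)) = 0 := by
        have := congrFun hc i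
        simpa [Matrix.mulVec, dotProduct] using this
      refine ⟨⟨_, (hρ _).1 h1⟩, Subtype.ext ?_⟩
      simp [hϖ, h.ne_zero]
    choose w hw using hw
    -- `P c = ϖ w`, so that `P = P₁ F`, where `P₁` has the column `w` instead of the `j`-th one
    let d : J → O := Function.update (fun i => - algebraMap ℂ O (c i)) j ϖ
    have hdj : d j = ϖ := Function.update_self _ _ _
    have hdi : ∀ i ≠ j, d i = - algebraMap ℂ O (c i) := fun i hi => Function.update_of_ne hi _ _
    let F : Matrix J J O := (1 : Matrix J J O).updateCol j d
    let P₁ : Matrix J J O := P.updateCol j w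
    have hFdet : F.det = ϖ := by
      rw [← Matrix.cramer_apply, Matrix.cramer_one]
      exact hdj
    have hmul : P = P₁ * F := by
      ext i l
      rw [Matrix.mul_apply]
      by_cases hl : l = j
      · subst hl
        simp only [F, P₁, Matrix.updateCol_self]
        rw [Fintype.sum_eq_add_sum_compl l]
        simp only [Matrix.updateCol_self, hdj]
        rw [mul_comm (w i), hw, Fintype.sum_eq_add_sum_compl l, hcj, map_one, mul_one,
          add_assoc, ← Finset.sum_add_distrib]
        rw [Finset.sum_eq_zero, add_zero]
        intro x hx
        have hx' : x ≠ l := by simpa using hx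
        rw [Matrix.updateCol_ne hx', hdi x hx']
        ring
      · simp only [F, Matrix.updateCol_ne hl]
        simp [P₁, Matrix.one_apply, Matrix.updateCol_ne hl]
    have hP₁ : P₁.det = u * ϖ ^ n := by
      have h1 : P₁.det * ϖ = (u * ϖ ^ n) * ϖ := by
        rw [← hFdet, ← Matrix.det_mul, ← hmul, hP, hFdet]; ring
      exact mul_right_cancel₀ hϖ0 h1
    obtain ⟨i1, i2⟩ := ih P₁ hP₁
    -- the column operation `F` has cokernel of dimension one
    let τ : (J → O) →ₗ[ℂ] ℂ := ρ.toLinearMap ∘ₗ LinearMap.proj j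
    have hτ : Function.Surjective τ := fun c => ⟨fun _ => algebraMap ℂ O c, by simp [τ]⟩
    have hFv : ∀ (v : J → O) (i : J),
        F.mulVec v i = if i = j then ϖ * v j else v i + d i * v j := by
      intro v i
      simp only [Matrix.mulVec, dotProduct]
      rw [Fintype.sum_eq_add_sum_compl j]
      simp only [F, Matrix.updateCol_self]
      have : ∑ x ∈ {j}ᶜ, (1 : Matrix J J O).updateCol j d i x * v x = if i = j then 0 else v i := by
        rw [Finset.sum_congr rfl (g := fun x => if i = x then v x else 0)]
        · rw [Finset.sum_ite_eq]
          by_cases hi : i = j <;> simp [hi]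
        · intro x hx
          rw [Matrix.updateCol_ne (by simpa using hx), Matrix.one_apply]
          split_ifs <;> simp
      rw [this]
      split_ifs with hi
      · rw [hi, hdj, add_zero]
      · ring
    have hker : LinearMap.ker τ = LinearMap.range (F.mulVecLin.restrictScalars ℂ) := by
      ext v
      rw [LinearMap.mem_ker, LinearMap.mem_range]
      change ρ (v j) = 0 ↔ ∃ y, F.mulVec y = v
      constructor
      · intro hv
        let y : O := ⟨_, (hρ _).1 hv⟩
        have hy : ϖ * y = v j := Subtype.ext (by simp [y, hϖ, h.ne_zero])
        refine ⟨fun i => if i = j then y else v i - d i * y, funext fun i => ?_⟩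
        rw [hFv]
        by_cases hi : i = j
        · simp [hi, hy]
        · simp [hi]
      · rintro ⟨y, rfl⟩
        rw [hFv, if_pos rfl, map_mul, hρϖ, zero_mul]
    have e : ((J → O) ⧸ LinearMap.range (F.mulVecLin.restrictScalars ℂ)) ≃ₗ[ℂ] ℂ :=
      (Submodule.quotEquivOfEq _ _ hker.symm).trans (τ.quotKerEquivOfSurjective hτ)
    have f1 : Module.Finite ℂ ((J → O) ⧸ LinearMap.range (F.mulVecLin.restrictScalars ℂ)) :=
      Module.Finite.equiv e.symm
    have f2 := e.finrank_eq
    rw [Module.finrank_self] at f2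
    have hinj : Function.Injective (P₁.mulVecLin.restrictScalars ℂ) := by
      apply Matrix.mulVec_injective_of_det_ne_zero
      rw [hP₁]
      exact mul_ne_zero hu.ne_zero (pow_ne_zero _ hϖ0)
    have hcomp : P.mulVecLin.restrictScalars ℂ =
        P₁.mulVecLin.restrictScalars ℂ ∘ₗ F.mulVecLin.restrictScalars ℂ := by
      ext1 v
      conv_lhs => rw [hmul]
      simp
    rw [hcomp]
    have := finrank_quotient_range_comp _ (F.mulVecLin.restrictScalars ℂ) hinj
    rw [i2, f2] at this
    exact this

end LocalTheory

end CurveBundle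

end

noncomputable section

namespace CurveBundle

/-! ### Orders and lattices -/

section Order

variable {K : Type} [Field K] [Algebra ℂ K] {O : Subalgebra ℂ K} {z : K}

namespace IsPlace

open Classical in
/-- The order of a nonzero function at a place; the order of `0` is `0`. -/
def ord (h : IsPlace O z) (f : K) : ℤ :=
  if hf : f = 0 then 0 else (h.exists_eq_mul_zpow f hf).choose

theorem ord_eq (h : IsPlace O z) {u : K} {n : ℤ} (hu : u ∈ O) (hu' : u⁻¹ ∈ O) (hu0 : u ≠ 0) :
    h.ord (u * z ^ n) = n := by
  have hf : u * z ^ n ≠ 0 := mul_ne_zero hu0 (zpow_ne_zero _ h.ne_zero)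
  rw [ord, dif_neg hf]
  obtain ⟨w, hw, hw', he⟩ := (h.exists_eq_mul_zpow _ hf).choose_spec
  generalize (h.exists_eq_mul_zpow _ hf).choose = m at *
  have hw0 : w ≠ 0 := by rintro rfl; exact hf (by simpa using he)
  have hz := h.ne_zero
  have h1 : (u * w⁻¹) * z ^ (n - m) = 1 := by
    rw [zpow_sub₀ hz]
    field_simp
    rw [he, mul_comm]
  have h2 : (w * u⁻¹) * z ^ (m - n) = 1 := by
    rw [zpow_sub₀ hz]
    field_simp
    rw [he, mul_comm]
  have h3 := h.nonneg_of_mem (n := n - m) (u := u * w⁻¹)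
    (by rw [mul_inv, inv_inv]; exact mul_mem hu' hw)
    (mul_ne_zero hu0 (inv_ne_zero hw0)) (by rw [h1]; exact one_mem _)
  have h4 := h.nonneg_of_mem (n := m - n) (u := w * u⁻¹)
    (by rw [mul_inv, inv_inv]; exact mul_mem hw' hu)
    (mul_ne_zero hw0 (inv_ne_zero hu0)) (by rw [h2]; exact one_mem _)
  omega

theorem exists_eq_mul_zpow_ord (h : IsPlace O z) {f : K} (hf : f ≠ 0) :
    ∃ u : K, u ∈ O ∧ u⁻¹ ∈ O ∧ u ≠ 0 ∧ f = u * z ^ h.ord f := by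
  obtain ⟨n, u, hu, hu', rfl⟩ := h.exists_eq_mul_zpow f hf
  have hu0 : u ≠ 0 := left_ne_zero_of_mul hf
  exact ⟨u, hu, hu', hu0, by rw [h.ord_eq hu hu' hu0]⟩

theorem ord_mul (h : IsPlace O z) {f g : K} (hf : f ≠ 0) (hg : g ≠ 0) :
    h.ord (f * g) = h.ord f + h.ord g := by
  obtain ⟨u, hu, hu', hu0, e⟩ := h.exists_eq_mul_zpow_ord hf
  obtain ⟨w, hw, hw', hw0, e'⟩ := h.exists_eq_mul_zpow_ord hg
  conv_lhs => rw [e, e']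
  rw [mul_mul_mul_comm, ← zpow_add₀ h.ne_zero, h.ord_eq (mul_mem hu hw) _ (mul_ne_zero hu0 hw0)]
  rw [mul_inv]
  exact mul_mem hu' hw'

theorem ord_zpow (h : IsPlace O z) (n : ℤ) : h.ord (z ^ n) = n := by
  have := h.ord_eq (n := n) (one_mem O) (by rw [inv_one]; exact one_mem O) one_ne_zero
  rwa [one_mul] at this

theorem ord_one (h : IsPlace O z) : h.ord 1 = 0 := by simpa using h.ord_zpow 0

theorem ord_inv (h : IsPlace O z) {f : K} (hf : f ≠ 0) : h.ord f⁻¹ = -h.ord f := by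
  have := h.ord_mul hf (inv_ne_zero hf)
  rw [mul_inv_cancel₀ hf, h.ord_one] at this
  omega

theorem mem_iff_ord_nonneg (h : IsPlace O z) {f : K} (hf : f ≠ 0) : f ∈ O ↔ 0 ≤ h.ord f := by
  obtain ⟨u, hu, hu', hu0, e⟩ := h.exists_eq_mul_zpow_ord hf
  constructor
  · intro hm
    rw [e] at hm
    exact h.nonneg_of_mem hu' hu0 hm
  · intro hn
    rw [e]
    exact mul_mem hu (h.zpow_mem hn)

end IsPlace

end Order

section Scale

variable {K R J : Type} [Field K] [AddCommGroup R] [Module K R]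

/-- The basis `c • b`. -/
def scale (b : Module.Basis J K R) {c : K} (hc : c ≠ 0) : Module.Basis J K R :=
  b.unitsSMul fun _ => Units.mk0 c hc

theorem scale_apply (b : Module.Basis J K R) {c : K} (hc : c ≠ 0) (i : J) :
    scale b hc i = c • b i := by
  rw [scale, Module.Basis.unitsSMul_apply]
  rfl

theorem det_scale [Fintype J] [DecidableEq J] (b : Module.Basis J K R) {c : K} (hc : c ≠ 0) :
    b.det (scale b hc) = c ^ Fintype.card J := by
  rw [scale, Module.Basis.det_unitsSMul_self]
  simp

end Scale

section Lattice

variable {K : Type} [Field K] [Algebra ℂ K] {O : Subalgebra ℂ K} {z : K}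
variable {R : Type} [AddCommGroup R] [Module ℂ R] [Module K R] [IsScalarTower ℂ K R]
variable {J : Type}

/-- The free `O`-module spanned by a basis of a vector space over `K`, as a complex vector
space. -/
def lat (O : Subalgebra ℂ K) (b : Module.Basis J K R) : Submodule ℂ R where
  carrier := {v | ∀ i, b.repr v i ∈ O}
  add_mem' := fun hv hw i => by
    rw [map_add, Finsupp.add_apply]
    exact add_mem (hv i) (hw i)
  zero_mem' := fun i => by simp
  smul_mem' := fun c v hv i => by
    rw [← algebraMap_smul K c v, map_smul, Finsupp.smul_apply, smul_eq_mul]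
    exact mul_mem (O.algebraMap_mem c) (hv i)

theorem smul_mem_lat {b : Module.Basis J K R} {a : K} {v : R} (ha : a ∈ O) (hv : v ∈ lat O b) :
    a • v ∈ lat O b := fun i => by
  rw [map_smul, Finsupp.smul_apply, smul_eq_mul]
  exact mul_mem ha (hv i)

theorem self_mem_lat (b : Module.Basis J K R) (i : J) : b i ∈ lat O b := fun j => by
  classical
  rw [b.repr_self, Finsupp.single_apply]
  split_ifs
  · exact one_mem _
  · exact zero_mem _

variable [Fintype J]

/-- `lat O b` is the smallest `O`-module containing the basis. -/
theorem lat_le {b : Module.Basis J K R} {M : Submodule ℂ R}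
    (hM : ∀ a ∈ O, ∀ v ∈ M, a • v ∈ M) (hb : ∀ i, b i ∈ M) : lat O b ≤ M := fun v hv => by
  rw [← b.sum_repr v]
  exact sum_mem fun i _ => hM _ (hv i) _ (hb i)

variable [DecidableEq J]

/-- The index of one lattice in another is the order of the determinant of the transition
matrix. -/
theorem finrank_relQuot_lat (h : IsPlace O z) (b b' : Module.Basis J K R)
    (hle : lat O b ≤ lat O b') :
    Module.Finite ℂ (relQuot (lat O b) (lat O b')) ∧
    (Module.finrank ℂ (relQuot (lat O b) (lat O b')) : ℤ) = h.ord (b'.det b) := by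
  have hmem : ∀ i j, b'.toMatrix b i j ∈ O := fun i j => hle (self_mem_lat b j) i
  let P : Matrix J J O := fun i j => ⟨b'.toMatrix b i j, hmem i j⟩
  have hPval : (P.det : K) = b'.det b := by
    rw [Module.Basis.det_apply]
    exact RingHom.map_det (O.val.toRingHom) P
  have hdet0 : b'.det b ≠ 0 := (b'.isUnit_det b).ne_zero
  obtain ⟨u, hu, hu', hu0, e⟩ := h.exists_eq_mul_zpow_ord hdet0
  have hn : 0 ≤ h.ord (b'.det b) := by
    rw [← h.mem_iff_ord_nonneg hdet0, ← hPval]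
    exact SetLike.coe_mem _
  obtain ⟨n, hn⟩ := Int.eq_ofNat_of_zero_le hn
  rw [hn] at e ⊢
  have hu1 : IsUnit (⟨u, hu⟩ : O) := by
    rw [isUnit_iff_exists_inv]
    exact ⟨⟨u⁻¹, hu'⟩, Subtype.ext (mul_inv_cancel₀ hu0)⟩
  obtain ⟨i1, i2⟩ := finrank_quotient_range_mulVecLin h n P ⟨u, hu⟩ hu1
    (Subtype.ext (by rw [hPval, e, zpow_natCast]; rfl))
  -- coordinates with respect to `b'` identify `lat O b'` with `O^J` and `lat O b` with the image
  -- of the transition matrix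
  let φ : (J → O) ≃ₗ[ℂ] lat O b' :=
    { toFun := fun c => ⟨∑ i, (c i : K) • b' i, fun i => by
        rw [b'.repr_sum_self]; exact (c i).2⟩
      map_add' := fun c d => Subtype.ext (by simp [add_smul, Finset.sum_add_distrib])
      map_smul' := fun a c => Subtype.ext (by simp [Finset.smul_sum])
      invFun := fun v i => ⟨b'.repr v i, v.2 i⟩
      left_inv := fun c => funext fun i => Subtype.ext (by
        simp only
        rw [b'.repr_sum_self])
      right_inv := fun v => Subtype.ext (b'.sum_repr v) }
  have hφ : ∀ c : J → O, (φ (P.mulVec c) : R) = ∑ j, (c j : K) • b j := by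
    intro c
    have h1 : ∀ j, b j = ∑ i, b'.toMatrix b i j • b' i := fun j =>
      (b'.sum_toMatrix_smul_self b j).symm
    have h2 : ∀ i, ((P.mulVec c i : O) : K) = ∑ j, b'.toMatrix b i j * c j := by
      intro i
      simp [Matrix.mulVec, dotProduct, P]
    calc (φ (P.mulVec c) : R) = ∑ i, ((P.mulVec c i : O) : K) • b' i := rfl
      _ = ∑ i, ∑ j, (b'.toMatrix b i j * (c j : K)) • b' i := by simp only [h2, Finset.sum_smul]
      _ = ∑ j, (c j : K) • b j := by
        rw [Finset.sum_comm]
        refine Finset.sum_congr rfl fun j _ => ?_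
        conv_rhs => rw [h1 j, Finset.smul_sum]
        exact Finset.sum_congr rfl fun i _ => by rw [smul_smul, mul_comm]
  have hmap : (LinearMap.range (P.mulVecLin.restrictScalars ℂ)).map (φ : (J → O) →ₗ[ℂ] lat O b') =
      (lat O b).comap (lat O b').subtype := by
    ext v
    rw [Submodule.mem_map, Submodule.mem_comap]
    constructor
    · rintro ⟨_, ⟨c, rfl⟩, rfl⟩
      change ((φ (P.mulVec c) : lat O b') : R) ∈ lat O b
      rw [hφ]
      exact sum_mem fun j _ => smul_mem_lat (c j).2 (self_mem_lat b j)
    · intro hv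
      refine ⟨P.mulVec fun j => ⟨b.repr v j, hv j⟩, ⟨_, rfl⟩, Subtype.ext ?_⟩
      exact (hφ _).trans (b.sum_repr v)
  let e' := Submodule.Quotient.equiv _ _ φ hmap
  exact ⟨Module.Finite.equiv e', by rw [← e'.finrank_eq, i2]⟩

end Lattice

end CurveBundle

end

noncomputable section

namespace CurveBundle

/-! ### Families of lattices over a family of places -/

/-- A family of places of a function field `K` over `ℂ`, with a uniformiser at each of them, such
that every function is regular at almost all places. -/
structure Places (K ι : Type) [Field K] [Algebra ℂ K] where
  /-- the valuation rings -/
  O : ι → Subalgebra ℂ K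
  /-- the uniformisers -/
  z : ι → K
  isPlace : ∀ x, IsPlace (O x) (z x)
  finite_notMem : ∀ f : K, {x | f ∉ O x}.Finite

section Families

variable {K ι : Type} [Field K] [Algebra ℂ K] (P : Places K ι)
variable {R : Type} [AddCommGroup R] [Module ℂ R] [Module K R] [IsScalarTower ℂ K R]
variable {J : Type}

/-- The functions regular at the places. -/
def Places.functions (x : ι) : Submodule ℂ K := Subalgebra.toSubmodule (P.O x)

/-- A family of `O x`-submodules of a vector space over `K`, each of them spanning it, such that
every vector belongs to almost all of them. -/
structure IsLatticeFamily (L : ι → Submodule ℂ R) : Prop where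
  smul_mem : ∀ x, ∀ a ∈ P.O x, ∀ v ∈ L x, a • v ∈ L x
  finite_notMem : ∀ v, {x | v ∉ L x}.Finite
  exists_pow_smul_mem : ∀ x v, ∃ n : ℕ, P.z x ^ n • v ∈ L x

variable {P} in
theorem scale_lat_eq (b : Module.Basis J K R) (x : ι) {n : ℕ} (hn : n = 0) :
    lat (P.O x) (scale b (pow_ne_zero n (P.isPlace x).ne_zero)) = lat (P.O x) b := by
  subst hn
  congr 1
  ext i
  rw [scale_apply, pow_zero, one_smul]

variable [Fintype J]

variable {P} in
theorem scale_lat_le (b : Module.Basis J K R) (x : ι) (n : ℕ) :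
    lat (P.O x) (scale b (pow_ne_zero n (P.isPlace x).ne_zero)) ≤ lat (P.O x) b :=
  lat_le (fun _ ha _ hv => smul_mem_lat ha hv) fun i => by
    rw [scale_apply]
    exact smul_mem_lat (pow_mem (P.isPlace x).mem _) (self_mem_lat b i)

theorem isLatticeFamily_lat (b : Module.Basis J K R) :
    IsLatticeFamily P fun x => lat (P.O x) b where
  smul_mem x a ha v hv := smul_mem_lat ha hv
  finite_notMem v := by
    refine (Set.finite_iUnion fun i => P.finite_notMem (b.repr v i)).subset fun x hx => ?_
    by_contra h
    rw [Set.mem_iUnion, not_exists] at h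
    exact hx fun i => not_not.1 (h i)
  exists_pow_smul_mem x v := by
    classical
    choose n hn using fun i => (P.isPlace x).exists_pow_mul_mem (b.repr v i)
    refine ⟨∑ i, n i, fun i => ?_⟩
    rw [map_smul, Finsupp.smul_apply, smul_eq_mul,
      ← Finset.sum_erase_add _ _ (Finset.mem_univ i), pow_add, mul_assoc]
    exact mul_mem (pow_mem (P.isPlace x).mem _) (hn i)

variable [DecidableEq J]

/-- The projections `p` and the injections `q` of a decomposition of `W` as a power of `W'` give
its dimension. -/
theorem finrank_eq_card_mul_of_coord {W W' : Type} [AddCommGroup W] [Module ℂ W] [AddCommGroup W']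
    [Module ℂ W'] (p : J → W →ₗ[ℂ] W') (q : J → W' →ₗ[ℂ] W)
    (h1 : ∀ w, ∑ i, q i (p i w) = w) (h2 : ∀ i j w, p j (q i w) = if i = j then w else 0)
    (hf : Module.Finite ℂ W') :
    Module.Finite ℂ W ∧ Module.finrank ℂ W = Fintype.card J * Module.finrank ℂ W' := by
  let e : W ≃ₗ[ℂ] (J → W') :=
    { LinearMap.pi p with
      invFun := fun c => ∑ i, q i (c i)
      left_inv := h1
      right_inv := fun c => by
        funext j
        change p j (∑ i, q i (c i)) = c j
        simp [h2] }
  exact ⟨Module.Finite.equiv e.symm, by rw [e.finrank_eq, Module.finrank_pi_fintype]; simp⟩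

/-- The cohomology of the trivial bundle is the sum of the cohomologies of copies of `O`. -/
theorem cohomology_lat (b : Module.Basis J K R) (h0 : Module.Finite ℂ (H0 P.functions))
    (h1 : Module.Finite ℂ (H1 P.functions)) :
    Module.Finite ℂ (H0 fun x => lat (P.O x) b) ∧ Module.Finite ℂ (H1 fun x => lat (P.O x) b) ∧
    chi (fun x => lat (P.O x) b) = Fintype.card J * chi P.functions := by
  let coord : ∀ i : J, R →ₗ[ℂ] K := fun i => (b.coord i).restrictScalars ℂ
  let incl : ∀ i : J, K →ₗ[ℂ] R := fun i => (LinearMap.toSpanSingleton K R (b i)).restrictScalars ℂ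
  have hcoord : ∀ i x, ∀ v ∈ lat (P.O x) b, coord i v ∈ P.functions x := fun i x v hv => hv i
  have hincl : ∀ i x, ∀ a ∈ P.functions x, incl i a ∈ lat (P.O x) b :=
    fun i x a ha => smul_mem_lat ha (self_mem_lat b i)
  have e1 : ∀ v, ∑ i, incl i (coord i v) = v := b.sum_repr
  have e2 : ∀ i j a, coord j (incl i a) = if i = j then a else 0 := by
    intro i j a
    change b.repr (a • b i) j = _
    rw [map_smul, b.repr_self, Finsupp.smul_apply, Finsupp.single_apply]
    split_ifs <;> simp
  obtain ⟨i0, j0⟩ := finrank_eq_card_mul_of_coord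
    (fun i => (coord i).restrict (p := H0 fun x => lat (P.O x) b) (q := H0 P.functions)
      fun v hv => mem_H0.2 fun x => hcoord i x v (mem_H0.1 hv x))
    (fun i => (incl i).restrict (p := H0 P.functions) (q := H0 fun x => lat (P.O x) b)
      fun v hv => mem_H0.2 fun x => hincl i x v (mem_H0.1 hv x))
    (fun w => Subtype.ext (by simpa using e1 w))
    (fun i j w => Subtype.ext (by
      have := e2 i j w
      split_ifs with hij <;> simpa [hij] using this)) h0
  obtain ⟨i1, j1⟩ := finrank_eq_card_mul_of_coord
    (fun i => H1.map (L := fun x => lat (P.O x) b) (L' := P.functions) (coord i) (hcoord i))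
    (fun i => H1.map (incl i) (hincl i))
    (fun w => by
      have : ∑ i, H1.map (incl i) (hincl i) ∘ₗ H1.map (coord i) (hcoord i) =
          (LinearMap.id : H1 (fun x => lat (P.O x) b) →ₗ[ℂ] _) := H1.hom_ext fun x v => by
        simp only [LinearMap.sum_apply, LinearMap.comp_apply, H1.map_classAt, ← map_sum, e1]
        rfl
      simpa using LinearMap.congr_fun this w)
    (fun i j w => by
      have : H1.map (coord j) (hcoord j) ∘ₗ H1.map (incl i) (hincl i) =
          if i = j then (LinearMap.id : H1 P.functions →ₗ[ℂ] _) else 0 := H1.hom_ext fun x v => by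
        simp only [LinearMap.comp_apply, H1.map_classAt, e2]
        split_ifs <;> simp
      have := LinearMap.congr_fun this w
      split_ifs with hij <;> simpa [hij] using this) h1
  refine ⟨i0, i1, ?_⟩
  rw [chi, chi, j0, j1]
  push_cast
  ring

variable {P}

/-- A family of lattices contains a family of free ones which is trivial at almost all places. -/
theorem IsLatticeFamily.exists_scale_le {L : ι → Submodule ℂ R} (hL : IsLatticeFamily P L)
    (b : Module.Basis J K R) :
    ∃ n : ι → ℕ, (∀ x, (∀ i, b i ∈ L x) → n x = 0) ∧ {x | n x ≠ 0}.Finite ∧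
      ∀ x, lat (P.O x) (scale b (pow_ne_zero (n x) (P.isPlace x).ne_zero)) ≤ L x := by
  classical
  have key : ∀ x, ∃ n : ℕ, ((∀ i, b i ∈ L x) → n = 0) ∧ ∀ i, P.z x ^ n • b i ∈ L x := by
    intro x
    by_cases h : ∀ i, b i ∈ L x
    · exact ⟨0, fun _ => rfl, by simpa using h⟩
    · choose m hm using fun i => hL.exists_pow_smul_mem x (b i)
      refine ⟨∑ i, m i, fun h' => (h h').elim, fun i => ?_⟩
      rw [← Finset.sum_erase_add _ _ (Finset.mem_univ i), pow_add, mul_smul]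
      exact hL.smul_mem x _ (pow_mem (P.isPlace x).mem _) _ (hm i)
  choose n hn hn' using key
  refine ⟨n, hn, ?_, fun x => lat_le (hL.smul_mem x) fun i => ?_⟩
  · refine (Set.finite_iUnion fun i => hL.finite_notMem (b i)).subset fun x hx => ?_
    by_contra h
    rw [Set.mem_iUnion, not_exists] at h
    exact hx (hn x fun i => not_not.1 (h i))
  · rw [scale_apply]
    exact hn' x i

/-- The comparison of the trivial bundle with a subbundle of it of full rank. -/
theorem cohomology_scale (b : Module.Basis J K R) (n : ι → ℕ) (S : Finset ι)
    (hS : ∀ x ∉ S, n x = 0) (h0 : Module.Finite ℂ (H0 P.functions))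
    (h1 : Module.Finite ℂ (H1 P.functions)) :
    let N := fun x => lat (P.O x) (scale b (pow_ne_zero (n x) (P.isPlace x).ne_zero))
    Module.Finite ℂ (H0 N) ∧ Module.Finite ℂ (H1 N) ∧
    Fintype.card J * chi P.functions = chi N + ∑ x ∈ S, (Fintype.card J * n x : ℤ) := by
  intro N
  have hfin := fun x => finrank_relQuot_lat (P.isPlace x) _ b (scale_lat_le (P := P) b x (n x))
  obtain ⟨a1, a2, a3⟩ := cohomology_of_le_of_eq_off_finset (L := N)
    (L' := fun x => lat (P.O x) b) S (fun x _ => scale_lat_le b x (n x))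
    (fun x hx => scale_lat_eq b x (hS x hx)) (fun x _ => (hfin x).1)
  obtain ⟨e0, e1, e2⟩ := cohomology_lat P b h0 h1
  refine ⟨a1.1 e0, a2.2 e1, ?_⟩
  rw [← e2, a3 e0 (a2.2 e1)]
  congr 1
  refine Finset.sum_congr rfl fun x _ => ?_
  rw [(hfin x).2, det_scale, ← pow_mul, ← zpow_natCast, (P.isPlace x).ord_zpow]
  push_cast
  ring

/-- `H¹` of a family of lattices is finite dimensional. -/
theorem IsLatticeFamily.finite_H1 {L : ι → Submodule ℂ R} (hL : IsLatticeFamily P L)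
    (b : Module.Basis J K R) (h0 : Module.Finite ℂ (H0 P.functions))
    (h1 : Module.Finite ℂ (H1 P.functions)) : Module.Finite ℂ (H1 L) := by
  obtain ⟨n, -, hfin, hle⟩ := hL.exists_scale_le b
  obtain ⟨-, hN, -⟩ := cohomology_scale b n hfin.toFinset (fun x hx => by simpa using hx) h0 h1
  exact Module.Finite.of_surjective (H1.map LinearMap.id fun x v hv => hle x hv)
    (H1.map_surjective _ _ Function.surjective_id)

theorem ord_det_eq_zero_of_lat_eq {O : Subalgebra ℂ K} {z : K} (h : IsPlace O z)
    {b b' : Module.Basis J K R} (hb : lat O b = lat O b') : h.ord (b'.det b) = 0 := by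
  rw [← (finrank_relQuot_lat h b b' hb.le).2, hb]
  have : Subsingleton (relQuot (lat O b') (lat O b')) := by
    rw [relQuot, Submodule.comap_subtype_self]
    infer_instance
  rw [Module.finrank_zero_of_subsingleton, Nat.cast_zero]

/-- **Riemann–Roch**, in the form `χ(L) = deg L + r χ(O)`. Both `L` and the trivial bundle are
compared with a common subbundle `N`, a twist of the trivial bundle. -/
theorem chi_lattice (b : Module.Basis J K R) (f : ι → Module.Basis J K R)
    (hf : {x | lat (P.O x) (f x) ≠ lat (P.O x) b}.Finite) (h0 : Module.Finite ℂ (H0 P.functions))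
    (h1 : Module.Finite ℂ (H1 P.functions)) :
    let L := fun x => lat (P.O x) (f x)
    Module.Finite ℂ (H0 L) ∧ Module.Finite ℂ (H1 L) ∧
    chi L = Fintype.card J * chi P.functions + ∑ᶠ x, -(P.isPlace x).ord (b.det (f x)) := by
  intro L
  have hL : IsLatticeFamily P L :=
    { smul_mem := fun x a ha v hv => smul_mem_lat ha hv
      finite_notMem := fun v => by
        refine (hf.union ((isLatticeFamily_lat P b).finite_notMem v)).subset fun x hx => ?_
        by_contra h
        rw [Set.mem_union, not_or] at h
        refine h.2 fun hv => hx ?_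
        rw [← not_not.1 h.1] at hv
        exact hv
      exists_pow_smul_mem := fun x v => (isLatticeFamily_lat P (f x)).exists_pow_smul_mem x v }
  -- the twist is nontrivial only at the places where `L` differs from the trivial bundle
  obtain ⟨n, hn, -, hle⟩ := hL.exists_scale_le b
  have hS : ∀ x ∉ hf.toFinset, lat (P.O x) (f x) = lat (P.O x) b := fun x hx => by
    simpa using hx
  have hn0 : ∀ x ∉ hf.toFinset, n x = 0 := fun x hx => hn x fun i => by
    simp only [L]
    rw [hS x hx]
    exact self_mem_lat b i
  obtain ⟨i0, i1, i2⟩ := cohomology_scale b n hf.toFinset hn0 h0 h1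
  set N := fun x => lat (P.O x) (scale b (pow_ne_zero (n x) (P.isPlace x).ne_zero)) with hN
  have hfin := fun x => finrank_relQuot_lat (P.isPlace x) _ (f x) (hle x)
  obtain ⟨a1, a2, a3⟩ := cohomology_of_le_of_eq_off_finset (L := N) (L' := L) hf.toFinset
    (fun x _ => hle x) (fun x hx => by
      simp only [N, L]
      rw [hS x hx, scale_lat_eq b x (hn0 x hx)])
    (fun x _ => (hfin x).1)
  refine ⟨a1.2 i0, a2.1 i1, ?_⟩
  rw [a3 (a1.2 i0) i1, i2, finsum_eq_sum_of_support_subset (s := hf.toFinset), add_assoc,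
    ← Finset.sum_add_distrib]
  · congr 1
    refine Finset.sum_congr rfl fun x _ => ?_
    have hdet : b.det (scale b (pow_ne_zero (n x) (P.isPlace x).ne_zero)) =
        b.det (f x) * (f x).det (scale b (pow_ne_zero (n x) (P.isPlace x).ne_zero)) := by
      rw [Module.Basis.det_apply, Module.Basis.det_apply, Module.Basis.det_apply, ← Matrix.det_mul,
        Module.Basis.toMatrix_mul_toMatrix]
    have e1 := (P.isPlace x).ord_mul (b.isUnit_det (f x)).ne_zero
      ((f x).isUnit_det (scale b (pow_ne_zero (n x) (P.isPlace x).ne_zero))).ne_zero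
    rw [← hdet, det_scale, ← pow_mul, ← zpow_natCast, (P.isPlace x).ord_zpow] at e1
    rw [(hfin x).2]
    push_cast at e1
    linarith
  · intro x hx
    by_contra h
    exact hx (by simp only [ord_det_eq_zero_of_lat_eq (P.isPlace x) (hS x h), neg_zero])

end Families

end CurveBundle

end

noncomputable section

namespace CurveBundle

/-! ### Simple poles span the first cohomology -/

section SimplePoles

variable {K ι : Type} [Field K] [Algebra ℂ K] {P : Places K ι}
variable {R : Type} [AddCommGroup R] [Module ℂ R] [Module K R] [IsScalarTower ℂ K R]
variable {J : Type} [Fintype J] [DecidableEq J]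

/-- There are arbitrarily many independent functions with at most simple poles. This is the
inequality `h⁰(O(T)) ≥ χ(O(T)) = χ(O) + #T` for a large finite set `T` of places. -/
theorem exists_simplePole_functions [Infinite ι] (h0 : Module.Finite ℂ (H0 P.functions))
    (h1 : Module.Finite ℂ (H1 P.functions)) (n : ℕ) :
    ∃ V : Submodule ℂ K, (∀ g ∈ V, ∀ x, P.z x * g ∈ P.O x) ∧ Module.Finite ℂ V ∧
      n ≤ Module.finrank ℂ V := by
  classical
  let b : Module.Basis Unit K K := Module.Basis.singleton Unit K
  have hb : ∀ g : K, ∀ i, b.repr g i = g := fun g i => by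
    simp [b]
  obtain ⟨T, hT⟩ := Infinite.exists_subset_card_eq ι
    (n + Module.finrank ℂ (H1 P.functions))
  have hz := fun x => inv_ne_zero (P.isPlace x).ne_zero
  let f : ι → Module.Basis Unit K K := fun x => if x ∈ T then scale b (hz x) else b
  obtain ⟨i0, -, i2⟩ := chi_lattice (P := P) b f
    (T.finite_toSet.subset fun x hx => by
      by_contra h
      exact hx (by simp only [f, if_neg (show x ∉ T from h)])) h0 h1
  refine ⟨_, fun g hg x => ?_, i0, ?_⟩
  · have := mem_H0.1 hg x
    by_cases hx : x ∈ T
    · have h2 := this ()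
      simp only [f, if_pos hx, scale, Module.Basis.repr_unitsSMul, hb] at h2
      simpa [Units.smul_def] using h2
    · have h2 := this ()
      simp only [f, if_neg hx, hb] at h2
      exact mul_mem (P.isPlace x).mem h2
  · have h3 : ∑ᶠ x, -(P.isPlace x).ord (b.det (f x)) = T.card := by
      rw [finsum_eq_sum_of_support_subset (s := T)]
      · rw [Finset.sum_congr rfl (g := fun _ => (1 : ℤ)), Finset.sum_const]
        · simp
        · intro x hx
          simp only [f, if_pos hx]
          rw [det_scale, Fintype.card_unit, pow_one, (P.isPlace x).ord_inv (P.isPlace x).ne_zero]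
          have := (P.isPlace x).ord_zpow 1
          rw [zpow_one] at this
          rw [this]
          rfl
      · intro x hx
        by_contra h
        refine hx ?_
        simp only [f, if_neg (show x ∉ T from h)]
        rw [b.det_self, (P.isPlace x).ord_one, neg_zero]
    rw [h3, hT, Fintype.card_unit, chi, chi] at i2
    push_cast at i2
    omega

/-- A linear form on `H¹` which vanishes on all simple poles is zero. Otherwise its multiples by
the functions with simple poles would be linear forms on `H¹`, and there are too many of them. -/
theorem IsLatticeFamily.eq_zero_of_simplePoles [Infinite ι] {N : ι → Submodule ℂ R}
    (hN : IsLatticeFamily P N) (b : Module.Basis J K R) (h0 : Module.Finite ℂ (H0 P.functions))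
    (h1 : Module.Finite ℂ (H1 P.functions)) (l : H1 N →ₗ[ℂ] ℂ)
    (hl : ∀ x, ∀ v ∈ N x, l (classAt N x ((P.z x)⁻¹ • v)) = 0) : l = 0 := by
  have := hN.finite_H1 b h0 h1
  obtain ⟨V, hV, hVf, hVn⟩ := exists_simplePole_functions h0 h1
    (Module.finrank ℂ (H1 N →ₗ[ℂ] ℂ) + 1)
  have hlg : ∀ g ∈ V, ∀ x, ∀ v ∈ N x, l (classAt N x (g • v)) = 0 := by
    intro g hg x v hv
    have := hl x _ (hN.smul_mem x _ (hV g hg x) v hv)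
    rwa [smul_smul, inv_mul_cancel_left₀ (P.isPlace x).ne_zero] at this
  let mulBy : K → R →ₗ[ℂ] R := fun g => (LinearMap.lsmul K R g).restrictScalars ℂ
  -- multiplication by `g ∈ V` turns `l` into another linear form on `H¹`, as `l` vanishes on the
  -- simple poles and `g` has no others
  let Φ₀ : V → (H1 N →ₗ[ℂ] ℂ) := fun g => H1.lift (fun x => l ∘ₗ classAt N x ∘ₗ mulBy g)
    (fun x v hv => hlg g g.2 x v hv)
    (fun F e he => by
      classical
      have hfin := hN.finite_notMem ((g : K) • e)
      have h2 := sum_classAt_rational (L := N) (F := F ∪ hfin.toFinset) (e := (g : K) • e)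
        fun x hx => by
          rw [Finset.mem_union, not_or] at hx
          simpa using hx.2
      have h3 := congrArg l h2
      rw [map_sum, map_zero] at h3
      rw [← h3]
      exact Finset.sum_subset Finset.subset_union_left fun x _ hx => hlg g g.2 x e (he x hx))
  have hΦ : ∀ g x v, Φ₀ g (classAt N x v) = l (classAt N x ((g : K) • v)) := fun g x v =>
    H1.lift_classAt _ _ _ _ _
  let Φ : V →ₗ[ℂ] (H1 N →ₗ[ℂ] ℂ) :=
    { toFun := Φ₀
      map_add' := fun g g' => H1.hom_ext fun x v => by
        rw [LinearMap.add_apply, hΦ, hΦ, hΦ, Submodule.coe_add, add_smul, map_add, map_add]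
      map_smul' := fun c g => H1.hom_ext fun x v => by
        rw [RingHom.id_apply, LinearMap.smul_apply, hΦ, hΦ, Submodule.coe_smul, smul_assoc,
          map_smul, map_smul] }
  by_contra hne
  have hinj : Function.Injective Φ := by
    rw [← LinearMap.ker_eq_bot, LinearMap.ker_eq_bot']
    intro g hg
    by_contra hg0
    have hg0' : (g : K) ≠ 0 := fun h => hg0 (Subtype.ext h)
    refine hne (H1.hom_ext fun x v => ?_)
    have := hΦ g x ((g : K)⁻¹ • v)
    rw [show Φ₀ g = 0 from hg, smul_smul, mul_inv_cancel₀ hg0', one_smul] at this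
    rw [← this]
    simp
  have := LinearMap.finrank_le_finrank_of_injective hinj
  omega

end SimplePoles

/-! ### The kernel of the evaluation at a section -/

section Evaluation

variable {K ι : Type} [Field K] [Algebra ℂ K] {P : Places K ι}
variable {R : Type} [AddCommGroup R] [Module ℂ R] [Module K R] [IsScalarTower ℂ K R]
variable {J : Type} [Fintype J]

/-- `M` is the family of the endomorphisms which preserve the lattices of the family `L`. -/
def IsEndFamily (L : ι → Submodule ℂ R) (M : ι → Submodule ℂ (Module.End K R)) : Prop :=
  ∀ x φ, φ ∈ M x ↔ ∀ v ∈ L x, φ v ∈ L x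

variable {f : ι → Module.Basis J K R} {M : ι → Submodule ℂ (Module.End K R)}

theorem IsEndFamily.mem_iff (hM : IsEndFamily (fun x => lat (P.O x) (f x)) M) {x : ι}
    {φ : Module.End K R} : φ ∈ M x ↔ ∀ i, φ (f x i) ∈ lat (P.O x) (f x) := by
  rw [hM x φ]
  refine ⟨fun h i => h _ (self_mem_lat _ i), fun h v hv => ?_⟩
  rw [← (f x).sum_repr v, map_sum]
  refine sum_mem fun i _ => ?_
  rw [map_smul]
  exact smul_mem_lat (hv i) (h i)

/-- The endomorphisms which preserve the lattices of a vector bundle form a vector bundle. -/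
theorem IsEndFamily.isLatticeFamily (hM : IsEndFamily (fun x => lat (P.O x) (f x)) M)
    (b : Module.Basis J K R) (hf : {x | lat (P.O x) (f x) ≠ lat (P.O x) b}.Finite) :
    IsLatticeFamily P M where
  smul_mem x a ha φ hφ := (hM x _).2 fun v hv => by
    rw [LinearMap.smul_apply]
    exact smul_mem_lat ha ((hM x φ).1 hφ v hv)
  finite_notMem φ := by
    refine (hf.union (Set.finite_iUnion fun i =>
      (isLatticeFamily_lat P b).finite_notMem (φ (b i)))).subset fun x hx => ?_
    by_contra h
    rw [Set.mem_union, not_or, Set.mem_iUnion, not_exists] at h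
    refine hx ((hM x φ).2 fun v hv => ?_)
    have hx : lat (P.O x) (f x) = lat (P.O x) b := not_not.1 h.1
    change φ v ∈ lat (P.O x) (f x)
    replace hv : v ∈ lat (P.O x) (f x) := hv
    rw [hx] at hv ⊢
    rw [← b.sum_repr v, map_sum]
    refine sum_mem fun i _ => ?_
    rw [map_smul]
    exact smul_mem_lat (hv i) (not_not.1 (h.2 i))
  exists_pow_smul_mem x φ := by
    classical
    choose n hn using fun i => (isLatticeFamily_lat P (f x)).exists_pow_smul_mem x (φ (f x i))
    refine ⟨∑ i, n i, hM.mem_iff.2 fun i => ?_⟩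
    rw [LinearMap.smul_apply, ← Finset.sum_erase_add _ _ (Finset.mem_univ i), pow_add, mul_smul]
    exact smul_mem_lat (pow_mem (P.isPlace x).mem _) (hn i)

/-- Evaluation of endomorphisms at `s`. -/
def evalAt (s : R) : Module.End K R →ₗ[ℂ] R :=
  (LinearMap.applyₗ (R := K) s).restrictScalars ℂ

variable {L : ι → Submodule ℂ R}

/-- The map `H¹(End E) → H¹(E)` given by the evaluation at a section `s` of `E`. -/
def evalH1 (hM : IsEndFamily L M) {s : R} (hs : s ∈ H0 L) : H1 M →ₗ[ℂ] H1 L :=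
  H1.map (evalAt s) fun x φ hφ => (hM x φ).1 hφ s (mem_H0.1 hs x)

theorem evalH1_classAt (hM : IsEndFamily L M) {s : R} (hs : s ∈ H0 L) (x : ι)
    (φ : Module.End K R) : evalH1 hM hs (classAt M x φ) = classAt L x (φ s) :=
  H1.map_classAt _ _ _ _

theorem evalH1_surjective (hM : IsEndFamily L M) {s : R} (hs : s ∈ H0 L) (hs0 : s ≠ 0) :
    Function.Surjective (evalH1 hM hs) := by
  refine H1.map_surjective _ _ fun v => ?_
  obtain ⟨φ, hφ⟩ := Module.Projective.exists_dual_eq_one K hs0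
  exact ⟨φ.smulRight v, by simp [evalAt, hφ]⟩

/-- The classes of the simple poles along endomorphisms which vanish at `s`. -/
def simplePoleClasses (P : Places K ι) (M : ι → Submodule ℂ (Module.End K R)) (s : R) :
    Set (H1 M) :=
  {c | ∃ x, ∃ φ ∈ M x, φ s = 0 ∧ c = classAt M x ((P.z x)⁻¹ • φ)}

/-- The classes of the principal parts with poles bounded by the zeros of `s`: poles of order
`m` with `1 ≤ m ≤ k` at the zeros of `s` of multiplicity `k`. -/
def boundedPoleClasses (P : Places K ι) (L : ι → Submodule ℂ R)
    (M : ι → Submodule ℂ (Module.End K R)) (s : R) : Set (H1 M) :=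
  {c | ∃ (x : ι) (k m : ℕ), 1 ≤ m ∧ m ≤ k ∧ (P.z x ^ k)⁻¹ • s ∈ L x ∧
    (P.z x ^ (k + 1))⁻¹ • s ∉ L x ∧ ∃ w ∈ M x, c = classAt M x ((P.z x ^ m)⁻¹ • w)}

/-- All principal parts along endomorphisms which vanish at `s` are combinations of simple poles,
because simple poles span the first cohomology of the bundle of these endomorphisms. -/
theorem classAt_mem_span_simplePoleClasses [Infinite ι] (hM : IsLatticeFamily P M)
    [Module.Finite K R] (h0 : Module.Finite ℂ (H0 P.functions))
    (h1 : Module.Finite ℂ (H1 P.functions)) (s : R) (x : ι) {φ : Module.End K R} (hφ : φ s = 0) :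
    classAt M x φ ∈ Submodule.span ℂ (simplePoleClasses P M s) := by
  by_contra hmem
  obtain ⟨l, hl, hl'⟩ := Submodule.exists_dual_map_eq_bot_of_notMem hmem inferInstance
  let A : Submodule K (Module.End K R) := LinearMap.ker (LinearMap.applyₗ (R := K) s)
  let N : ι → Submodule ℂ A := fun y => (M y).comap (A.subtype.restrictScalars ℂ)
  have hN : IsLatticeFamily P N :=
    { smul_mem := fun y a ha v hv => hM.smul_mem y a ha v hv
      finite_notMem := fun v => hM.finite_notMem v
      exists_pow_smul_mem := fun y v => hM.exists_pow_smul_mem y v }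
  let T : H1 N →ₗ[ℂ] H1 M := H1.map (A.subtype.restrictScalars ℂ) fun y v hv => hv
  have hT : l ∘ₗ T = 0 := by
    refine hN.eq_zero_of_simplePoles (Module.finBasis K A) h0 h1 _ fun y v hv => ?_
    have h2 : T (classAt N y ((P.z y)⁻¹ • v)) = classAt M y ((P.z y)⁻¹ • (v : Module.End K R)) :=
      H1.map_classAt _ _ _ _
    rw [LinearMap.comp_apply, h2]
    have h3 := Submodule.mem_map_of_mem (f := l)
      (Submodule.subset_span (R := ℂ) (s := simplePoleClasses P M s) ⟨y, v, hv, v.2, rfl⟩)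
    rw [hl'] at h3
    exact h3
  have h4 := LinearMap.congr_fun hT (classAt N x ⟨φ, hφ⟩)
  rw [LinearMap.comp_apply, H1.map_classAt] at h4
  exact hl h4

/-- The order `k` of vanishing of a nonzero section `s`, and a linear form with the value `1` at
`s` and with a pole of order at most `k`. -/
theorem exists_multiplicity {O : Subalgebra ℂ K} {z : K} (h : IsPlace O z)
    (b : Module.Basis J K R) {s : R} (hs : s ∈ lat O b) (hs0 : s ≠ 0) :
    ∃ k : ℕ, (z ^ k)⁻¹ • s ∈ lat O b ∧ (z ^ (k + 1))⁻¹ • s ∉ lat O b ∧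
      ∃ l : R →ₗ[K] K, l s = 1 ∧ ∀ v ∈ lat O b, z ^ k * l v ∈ O := by
  classical
  have hex : ∃ i, b.repr s i ≠ 0 := by
    by_contra hc
    push Not at hc
    exact hs0 (b.repr.map_eq_zero_iff.1 (Finsupp.ext hc))
  obtain ⟨j, hj, hmin⟩ := Finset.exists_min_image (Finset.univ.filter fun i => b.repr s i ≠ 0)
    (fun i => h.ord (b.repr s i)) (by
      obtain ⟨i, hi⟩ := hex
      exact ⟨i, by simpa using hi⟩)
  replace hj : b.repr s j ≠ 0 := by simpa using hj
  have hj0 : 0 ≤ h.ord (b.repr s j) := (h.mem_iff_ord_nonneg hj).1 (hs j)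
  obtain ⟨k, hk⟩ := Int.eq_ofNat_of_zero_le hj0
  have hzk : ∀ (n : ℕ) (i : J), b.repr ((z ^ n)⁻¹ • s) i = z ^ (-n : ℤ) * b.repr s i := by
    intro n i
    rw [map_smul, Finsupp.smul_apply, smul_eq_mul, zpow_neg, zpow_natCast]
  have hz0 : ∀ n : ℤ, z ^ n ≠ 0 := fun n => zpow_ne_zero n h.ne_zero
  refine ⟨k, fun i => ?_, fun hc => ?_, (b.repr s j)⁻¹ • b.coord j, ?_, fun v hv => ?_⟩
  · rw [hzk]
    by_cases hi : b.repr s i = 0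
    · rw [hi, mul_zero]; exact zero_mem _
    · rw [h.mem_iff_ord_nonneg (mul_ne_zero (hz0 _) hi), h.ord_mul (hz0 _) hi, h.ord_zpow]
      have := hmin i (by simpa using hi)
      omega
  · have h1 := hc j
    rw [hzk, h.mem_iff_ord_nonneg (mul_ne_zero (hz0 _) hj), h.ord_mul (hz0 _) hj, h.ord_zpow] at h1
    push_cast at h1
    omega
  · simp [hj]
  · rw [LinearMap.smul_apply, smul_eq_mul, ← mul_assoc]
    refine mul_mem ?_ (hv j)
    rw [← zpow_natCast, h.mem_iff_ord_nonneg (mul_ne_zero (hz0 _) (inv_ne_zero hj)),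
      h.ord_mul (hz0 _) (inv_ne_zero hj), h.ord_zpow, h.ord_inv hj]
    omega

/-- The kernel of the evaluation `H¹(End E) → H¹(E)` at a section `s` is spanned by the simple
poles along endomorphisms which vanish at `s` and by the poles bounded by the zeros of `s`. -/
theorem ker_evalH1 [Infinite ι] (hL : ∀ x, L x = lat (P.O x) (f x)) (hM : IsEndFamily L M)
    (b : Module.Basis J K R) (hf : {x | lat (P.O x) (f x) ≠ lat (P.O x) b}.Finite)
    (h0 : Module.Finite ℂ (H0 P.functions)) (h1 : Module.Finite ℂ (H1 P.functions))
    {s : R} (hs : s ∈ H0 L) (hs0 : s ≠ 0) :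
    LinearMap.ker (evalH1 hM hs) =
      Submodule.span ℂ (simplePoleClasses P M s ∪ boundedPoleClasses P L M s) := by
  obtain rfl : L = fun x => lat (P.O x) (f x) := funext hL
  have hLM := hM.isLatticeFamily b hf
  have : Module.Finite K R := Module.Finite.of_basis b
  apply le_antisymm
  · intro h hh
    classical
    obtain ⟨F, φ, rfl⟩ := H1.exists_eq_sum h
    rw [LinearMap.mem_ker, map_sum] at hh
    simp only [evalH1_classAt] at hh
    obtain ⟨e, he, he'⟩ := (sum_classAt_eq_zero_iff F _).1 hh
    obtain ⟨φ₀, hφ₀⟩ : ∃ φ₀ : Module.End K R, φ₀ s = e := by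
      obtain ⟨l, hl⟩ := Module.Projective.exists_dual_eq_one K hs0
      exact ⟨l.smulRight e, by simp [hl]⟩
    -- subtracting the rational section `φ₀`, all principal parts may be assumed to map `s` to a
    -- regular section
    let G := F ∪ (hLM.finite_notMem φ₀).toFinset
    let θ : ι → Module.End K R := fun x => (if x ∈ F then φ x else 0) - φ₀
    have hsum : ∑ x ∈ F, classAt M x (φ x) = ∑ x ∈ G, classAt M x (θ x) := by
      have h2 := sum_classAt_rational (L := M) (F := G) (e := φ₀) fun x hx => by
        rw [Finset.mem_union, not_or] at hx
        simpa using hx.2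
      simp only [θ, map_sub, Finset.sum_sub_distrib]
      rw [h2, sub_zero, ← Finset.sum_subset (Finset.subset_union_left (s₁ := F))]
      · exact Finset.sum_congr rfl fun x hx => by rw [if_pos hx]
      · intro x _ hx
        rw [if_neg hx, map_zero]
    rw [hsum]
    refine sum_mem fun x _ => ?_
    have hθ : θ x s ∈ lat (P.O x) (f x) := by
      simp only [θ]
      split_ifs with hx
      · rw [LinearMap.sub_apply, hφ₀, ← neg_sub]
        exact neg_mem (he x hx)
      · rw [LinearMap.sub_apply, hφ₀, LinearMap.zero_apply, zero_sub]
        exact neg_mem (he' x hx)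
    obtain ⟨k, hk, hk', l, hl, hlm⟩ :=
      exists_multiplicity (P.isPlace x) (f x) (mem_H0.1 hs x) hs0
    -- `θ x` is the sum of an endomorphism which kills `s` and of one with a pole of order `≤ k`
    let θ₂ : Module.End K R := l.smulRight (θ x s)
    have hz := pow_ne_zero k (P.isPlace x).ne_zero
    have hw : P.z x ^ k • θ₂ ∈ M x := (hM x _).2 fun v hv => by
      rw [LinearMap.smul_apply, LinearMap.smulRight_apply, smul_smul]
      exact smul_mem_lat (hlm v hv) hθ
    have hsplit : θ x = (θ x - θ₂) + (P.z x ^ k)⁻¹ • (P.z x ^ k • θ₂) := by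
      rw [smul_smul, inv_mul_cancel₀ hz, one_smul, sub_add_cancel]
    rw [hsplit, map_add]
    refine add_mem (Submodule.span_mono Set.subset_union_left
      (classAt_mem_span_simplePoleClasses hLM h0 h1 s x ?_)) ?_
    · rw [LinearMap.sub_apply, LinearMap.smulRight_apply, hl, one_smul, sub_self]
    · rcases Nat.eq_zero_or_pos k with rfl | hkpos
      · rw [classAt_eq_zero]
        · exact zero_mem _
        · simpa using hw
      · exact Submodule.subset_span (Or.inr ⟨x, k, k, hkpos, le_rfl, hk, hk', _, hw, rfl⟩)
  · rw [Submodule.span_le]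
    rintro c (⟨x, φ, -, hφ, rfl⟩ | ⟨x, k, m, -, hmk, hk, -, w, hw, rfl⟩)
    · change evalH1 hM hs _ = 0
      rw [evalH1_classAt, LinearMap.smul_apply, hφ, smul_zero, map_zero]
    · change evalH1 hM hs _ = 0
      rw [evalH1_classAt]
      refine classAt_eq_zero ?_
      have h2 : ((P.z x ^ m)⁻¹ • w) s = P.z x ^ (k - m) • w ((P.z x ^ k)⁻¹ • s) := by
        rw [LinearMap.smul_apply, map_smul, smul_smul]
        congr 1
        have := (P.isPlace x).ne_zero
        rw [pow_sub₀ _ this hmk]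
        field_simp
      rw [h2]
      exact smul_mem_lat (pow_mem (P.isPlace x).mem _) ((hM x w).1 hw _ hk)

/-- If the Euler characteristic of `E` vanishes, then `h⁰(E)` is the codimension of the kernel of
the evaluation at a nonzero section. -/
theorem finrank_H0_eq_codim_ker [DecidableEq J] (hL : ∀ x, L x = lat (P.O x) (f x))
    (hM : IsEndFamily L M)
    (b : Module.Basis J K R) (hf : {x | lat (P.O x) (f x) ≠ lat (P.O x) b}.Finite)
    (h0 : Module.Finite ℂ (H0 P.functions)) (h1 : Module.Finite ℂ (H1 P.functions))
    (hdeg : ∑ᶠ x, -(P.isPlace x).ord (b.det (f x)) = -(Fintype.card J * chi P.functions))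
    {s : R} (hs : s ∈ H0 L) (hs0 : s ≠ 0) :
    Module.Finite ℂ (H0 L) ∧ Module.Finite ℂ (H1 M) ∧
      (Module.finrank ℂ (H0 L) : ℤ) =
        Module.finrank ℂ (H1 M) - Module.finrank ℂ (LinearMap.ker (evalH1 hM hs)) := by
  obtain rfl : L = fun x => lat (P.O x) (f x) := funext hL
  obtain ⟨i0, i1, i2⟩ := chi_lattice b f hf h0 h1
  have : Module.Finite K R := Module.Finite.of_basis b
  have hfM : Module.Finite ℂ (H1 M) :=
    (hM.isLatticeFamily b hf).finite_H1 (Module.finBasis K (Module.End K R)) h0 h1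
  refine ⟨i0, hfM, ?_⟩
  rw [hdeg, add_neg_cancel, chi] at i2
  have h2 := (evalH1 hM hs).finrank_range_add_finrank_ker
  rw [LinearMap.range_eq_top.2 (evalH1_surjective hM hs hs0), finrank_top] at h2
  omega

end Evaluation

end CurveBundle

end

noncomputable section

namespace CurveBundle

/-! ### Approximation and the finiteness of `H¹(O)` -/

namespace IsPlace

variable {K : Type} [Field K] [Algebra ℂ K] {O : Subalgebra ℂ K} {z : K}

/-- A function which does not vanish has a regular inverse. -/
theorem inv_mem_of_notMem (h : IsPlace O z) {a : K} (ha : z⁻¹ * a ∉ O) : a⁻¹ ∈ O := by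
  by_contra hc
  have := h.inv_mul_inv_mem hc
  rw [inv_inv] at this
  exact ha this

theorem mem_of_inv_mul_mem (h : IsPlace O z) {a : K} (ha : z⁻¹ * a ∈ O) : a ∈ O := by
  have := mul_mem h.mem ha
  rwa [mul_inv_cancel_left₀ h.ne_zero] at this

theorem exists_sub_algebraMap (h : IsPlace O z) {a : K} (ha : a ∈ O) :
    ∃ c : ℂ, z⁻¹ * (a - algebraMap ℂ K c) ∈ O := by
  obtain ⟨ρ, hρ⟩ := h.exists_residue
  refine ⟨ρ ⟨a, ha⟩, ?_⟩
  have h1 := (hρ (⟨a, ha⟩ - algebraMap ℂ O (ρ ⟨a, ha⟩))).1 (by simp)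
  simpa using h1

theorem algebraMap_eq_zero (h : IsPlace O z) {c : ℂ} (hc : z⁻¹ * algebraMap ℂ K c ∈ O) :
    c = 0 := by
  by_contra h0
  refine h.inv_notMem ?_
  have := mul_mem hc (O.algebraMap_mem c⁻¹)
  rwa [mul_assoc, ← map_mul, mul_inv_cancel₀ h0, map_one, mul_one] at this

/-- Principal parts are linear combinations of powers of the inverse of a uniformiser. -/
theorem mem_span_inv_pow_sup (h : IsPlace O z) (n : ℕ) {e : K} (he : z ^ n * e ∈ O) :
    e ∈ Submodule.span ℂ ((fun i : ℕ => (z ^ i)⁻¹) '' Set.Iic n) ⊔ Subalgebra.toSubmodule O := by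
  induction n generalizing e with
  | zero => exact Submodule.mem_sup_right (by simpa using he)
  | succ n ih =>
    obtain ⟨c, hc⟩ := h.exists_sub_algebraMap he
    have hz := pow_ne_zero n h.ne_zero
    have h1 := ih (e := e - c • (z ^ (n + 1))⁻¹) (by
      convert hc using 1
      have := h.ne_zero
      rw [Algebra.smul_def]
      field_simp
      ring)
    have h2 : c • (z ^ (n + 1))⁻¹ ∈
        Submodule.span ℂ ((fun i : ℕ => (z ^ i)⁻¹) '' Set.Iic (n + 1)) :=
      Submodule.smul_mem _ _ (Submodule.subset_span ⟨n + 1, Set.mem_Iic.2 le_rfl, rfl⟩)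
    have h3 := Submodule.span_mono (R := ℂ)
      (Set.image_mono (f := fun i : ℕ => (z ^ i)⁻¹) (Set.Iic_subset_Iic.2 n.le_succ))
    have h4 := add_mem (sup_le_sup_right h3 _ h1) (Submodule.mem_sup_left h2)
    rwa [sub_add_cancel] at h4

/-- A rational function `r(t) / q(t)` with `deg r ≤ deg q` is regular at the poles of `t`. -/
theorem aeval_div_mem (h : IsPlace O z) {t : K} (ht : t ∉ O) (r q : Polynomial ℂ)
    (hq : q ≠ 0) (hrq : r.natDegree ≤ q.natDegree) :
    (Polynomial.aeval t q)⁻¹ * Polynomial.aeval t r ∈ O := by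
  have ht0 : t ≠ 0 := by rintro rfl; exact ht (zero_mem _)
  have hti := h.inv_mul_inv_mem ht
  have hmem : ∀ p : Polynomial ℂ, Polynomial.aeval t⁻¹ p ∈ O := fun p => by
    have := (Polynomial.aeval (⟨t⁻¹, h.mem_of_inv_mul_mem hti⟩ : O) p).2
    rwa [← Subalgebra.coe_val, ← Polynomial.aeval_algHom_apply] at this
  -- in terms of `t⁻¹`, which vanishes at the place, the polynomials become their reversals
  have hrev : ∀ p : Polynomial ℂ,
      Polynomial.aeval t p = t ^ p.natDegree * Polynomial.aeval t⁻¹ p.reverse := by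
    intro p
    let := invertibleOfNonzero ht0
    have := Polynomial.eval₂_reverse_mul_pow (algebraMap ℂ K) t p
    rw [invOf_eq_inv] at this
    rw [Polynomial.aeval_def, ← this, mul_comm]
    rfl
  have hQ : z⁻¹ * Polynomial.aeval t⁻¹ q.reverse ∉ O := fun hc => by
    have h1 := Polynomial.divX_mul_X_add q.reverse
    rw [Polynomial.coeff_zero_reverse] at h1
    have h2 := mul_mem (hmem q.reverse.divX) hti
    have h3 := sub_mem hc h2
    rw [← h1, map_add, map_mul, Polynomial.aeval_X, Polynomial.aeval_C, h1] at h3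
    refine hq (Polynomial.leadingCoeff_eq_zero.1 (h.algebraMap_eq_zero ?_))
    convert h3 using 1
    ring
  have hQ' := h.inv_mem_of_notMem hQ
  have h1 : (Polynomial.aeval t q)⁻¹ * Polynomial.aeval t r =
      (t⁻¹) ^ (q.natDegree - r.natDegree) *
        ((Polynomial.aeval t⁻¹ q.reverse)⁻¹ * Polynomial.aeval t⁻¹ r.reverse) := by
    have ht1 := pow_ne_zero r.natDegree ht0
    have ht2 := pow_ne_zero q.natDegree ht0
    rw [hrev q, hrev r, mul_inv, inv_pow, pow_sub₀ _ ht0 hrq]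
    field_simp
  rw [h1]
  exact mul_mem (pow_mem (h.mem_of_inv_mul_mem hti) _) (mul_mem hQ' (hmem _))

end IsPlace

section Approximation

variable {K ι : Type} [Field K] [Algebra ℂ K] {P : Places K ι}

/-- If the functions which are regular on a set `T` of places separate its points, then principal
parts at a point of `T` are approximated by functions which are regular at the others. -/
theorem Places.exists_approx {T : Set ι}
    (hT : ∀ x ∈ T, ∀ y ∈ T, x ≠ y → ∃ a : K, (∀ w ∈ T, a ∈ P.O w) ∧
      (P.z y)⁻¹ * a ∈ P.O y ∧ (P.z x)⁻¹ * a ∉ P.O x) {x : ι} (hx : x ∈ T) (g : K) :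
    ∃ h : K, h - g ∈ P.O x ∧ ∀ y ∈ T, y ≠ x → h ∈ P.O y := by
  classical
  -- normalize the separating functions to have the value `1` at `x`
  have hT' : ∀ y, ∃ a : K, y ∈ T → y ≠ x → (∀ w ∈ T, a ∈ P.O w) ∧
      (P.z y)⁻¹ * a ∈ P.O y ∧ (P.z x)⁻¹ * (a - 1) ∈ P.O x := by
    intro y
    by_cases hy : y ∈ T ∧ y ≠ x
    · obtain ⟨a, ha, hay, hax⟩ := hT x hx y hy.1 hy.2.symm
      obtain ⟨c, hc⟩ := (P.isPlace x).exists_sub_algebraMap (ha x hx)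
      have hc0 : c ≠ 0 := by
        rintro rfl
        rw [map_zero, sub_zero] at hc
        exact hax hc
      refine ⟨algebraMap ℂ K c⁻¹ * a, fun _ _ => ⟨fun w hw =>
        mul_mem ((P.O w).algebraMap_mem _) (ha w hw), ?_, ?_⟩⟩
      · rw [mul_left_comm]
        exact mul_mem ((P.O y).algebraMap_mem _) hay
      · have := mul_mem ((P.O x).algebraMap_mem c⁻¹) hc
        have h1 : algebraMap ℂ K c⁻¹ * algebraMap ℂ K c = 1 := by
          rw [← map_mul, inv_mul_cancel₀ hc0, map_one]
        rwa [mul_left_comm, mul_sub, h1] at this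
    · exact ⟨0, fun h h' => absurd ⟨h, h'⟩ hy⟩
  choose b hb using hT'
  choose n hn using fun y => (P.isPlace y).exists_pow_mul_mem g
  have hF := (P.finite_notMem g).inter_of_left {y | y ∈ T ∧ y ≠ x}
  let a : K := ∏ y ∈ hF.toFinset, b y ^ n y
  have hbF : ∀ y ∈ hF.toFinset, y ∈ T ∧ y ≠ x := fun y hy => ((Set.Finite.mem_toFinset hF).1 hy).2
  have haT : ∀ w ∈ T, a ∈ P.O w := fun w hw => prod_mem fun y hy =>
    pow_mem ((hb y (hbF y hy).1 (hbF y hy).2).1 w hw) _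
  have hax : (P.z x)⁻¹ * (a - 1) ∈ P.O x := by
    let M : Submonoid K :=
      { carrier := {a | a ∈ P.O x ∧ (P.z x)⁻¹ * (a - 1) ∈ P.O x}
        one_mem' := ⟨one_mem _, by simp⟩
        mul_mem' := fun {a b} ha hb => ⟨mul_mem ha.1 hb.1, by
          have := add_mem (mul_mem ha.1 hb.2) ha.2
          convert this using 1
          ring⟩ }
    have : a ∈ M := prod_mem fun y hy =>
      M.pow_mem ⟨(hb y (hbF y hy).1 (hbF y hy).2).1 x hx, (hb y (hbF y hy).1 (hbF y hy).2).2.2⟩ _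
    exact this.2
  have hag : ∀ y ∈ T, y ≠ x → a * g ∈ P.O y := by
    intro y hy hyx
    by_cases hg : g ∈ P.O y
    · exact mul_mem (haT y hy) hg
    · have hyF : y ∈ hF.toFinset := (Set.Finite.mem_toFinset hF).2 ⟨hg, hy, hyx⟩
      have h1 : a * g = (∏ w ∈ hF.toFinset.erase y, b w ^ n w) * ((P.z y)⁻¹ * b y) ^ n y *
          (P.z y ^ n y * g) := by
        have := pow_ne_zero (n y) (P.isPlace y).ne_zero
        simp only [a]
        rw [← Finset.prod_erase_mul _ _ hyF, mul_pow, inv_pow]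
        field_simp
      rw [h1]
      refine mul_mem (mul_mem (prod_mem fun w hw => pow_mem ?_ _)
        (pow_mem (hb y hy hyx).2.1 _)) (hn y)
      have hw' := hbF w (Finset.mem_of_mem_erase hw)
      exact (hb w hw'.1 hw'.2).1 y hy
  refine ⟨(1 - (1 - a) ^ n x) * g, ?_, fun y hy hyx => ?_⟩
  · have h1 : (1 - (1 - a) ^ n x) * g - g =
        -((-((P.z x)⁻¹ * (a - 1))) ^ n x * (P.z x ^ n x * g)) := by
      have := (P.isPlace x).ne_zero
      rw [← mul_assoc, ← mul_pow, show -((P.z x)⁻¹ * (a - 1)) * P.z x = 1 - a by field_simp; ring]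
      ring
    rw [h1]
    exact neg_mem (mul_mem (pow_mem (neg_mem hax) _) (hn x))
  · have h1 : (1 - (1 - a) ^ n x) * g = (∑ i ∈ Finset.range (n x), (1 - a) ^ i) * (a * g) := by
      have := mul_neg_geom_sum (1 - a) (n x)
      rw [sub_sub_cancel] at this
      rw [← this]
      ring
    rw [h1]
    exact mul_mem (sum_mem fun i _ => pow_mem (sub_mem (one_mem _) (haT y hy)) _) (hag y hy hyx)

/-- The functions which are regular on a finite set of places separate its points, if the
valuation rings are not contained in each other. -/
theorem Places.exists_separating (hP : ∀ x y, x ≠ y → ¬ P.O x ≤ P.O y) {S : Set ι} (hS : S.Finite)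
    {x y : ι} (hxy : x ≠ y) (hxS : x ∈ S) (hyS : y ∈ S) :
    ∃ a : K, (∀ w ∈ S, a ∈ P.O w) ∧ (P.z y)⁻¹ * a ∈ P.O y ∧ (P.z x)⁻¹ * a ∉ P.O x := by
  obtain ⟨f, hfx, hfy⟩ := SetLike.not_le_iff_exists.1 (hP x y hxy)
  obtain ⟨g, hgy, hgx⟩ := SetLike.not_le_iff_exists.1 (hP y x hxy.symm)
  have hf0 : f ≠ 0 := by rintro rfl; exact hfy (zero_mem _)
  -- `e` has a zero at `y` and a pole at `x`; then `e / (e + c)` is suitable for almost all `c`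
  let e : K := g * f⁻¹
  have hey : (P.z y)⁻¹ * e ∈ P.O y := by
    rw [mul_left_comm]
    exact mul_mem hgy ((P.isPlace y).inv_mul_inv_mem hfy)
  have hex : e ∉ P.O x := fun h => hgx (by
    have := mul_mem h hfx
    rwa [inv_mul_cancel_right₀ hf0] at this)
  have hbad : ({0} ∪ ⋃ w ∈ S, {c : ℂ | (P.z w)⁻¹ * (e + algebraMap ℂ K c) ∈ P.O w}).Finite := by
    refine (Set.finite_singleton _).union (hS.biUnion fun w _ => Set.Subsingleton.finite ?_)
    intro c hc d hd
    have := sub_mem (S := Subalgebra ℂ K) hc hd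
    rw [← mul_sub, add_sub_add_left_eq_sub, ← map_sub] at this
    exact sub_eq_zero.1 ((P.isPlace w).algebraMap_eq_zero this)
  obtain ⟨c, hc⟩ := hbad.exists_notMem
  rw [Set.mem_union, not_or, Set.mem_iUnion₂] at hc
  push Not at hc
  obtain ⟨hc0, hcS⟩ := hc
  have hec0 : e + algebraMap ℂ K c ≠ 0 := fun h0 => hcS x hxS (by
    rw [Set.mem_ofPred_eq, h0, mul_zero]; exact zero_mem _)
  have hinv : ∀ w ∈ S, (e + algebraMap ℂ K c)⁻¹ ∈ P.O w := fun w hw =>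
    (P.isPlace w).inv_mem_of_notMem (hcS w hw)
  have hea : e * (e + algebraMap ℂ K c)⁻¹ =
      1 - algebraMap ℂ K c * (e + algebraMap ℂ K c)⁻¹ := by
    field_simp
    ring
  refine ⟨e * (e + algebraMap ℂ K c)⁻¹, fun w hw => ?_, ?_, fun hx => ?_⟩
  · rw [hea]
    exact sub_mem (one_mem _) (mul_mem ((P.O w).algebraMap_mem _) (hinv w hw))
  · rw [← mul_assoc]
    exact mul_mem hey (hinv y hyS)
  · have h1 : (P.z x)⁻¹ * (e + algebraMap ℂ K c)⁻¹ ∈ P.O x :=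
      (P.isPlace x).inv_mul_inv_mem fun h => hex (by
        have := sub_mem h ((P.O x).algebraMap_mem c)
        rwa [add_sub_cancel_right] at this)
    refine (P.isPlace x).inv_notMem ?_
    have := add_mem hx (mul_mem ((P.O x).algebraMap_mem c) h1)
    rw [hea] at this
    convert this using 1
    ring

/-- The finiteness of `H¹(O)`: outside the finite set of the poles of `t`, the principal parts
come from functions, and modulo the functions regular there, the orders of the poles are bounded.
The hypotheses `ha` and `hfrac` say that the `a i` generate a module over `ℂ[t]`, regular outside
`S`, which has the function field as its localization. -/
theorem Places.finite_H1_functions (hP : ∀ x y, x ≠ y → ¬ P.O x ≤ P.O y) (S : Finset ι)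
    (hsep : ∀ x ∉ S, ∀ y ∉ S, x ≠ y → ∃ a : K, (∀ w ∉ S, a ∈ P.O w) ∧
      (P.z y)⁻¹ * a ∈ P.O y ∧ (P.z x)⁻¹ * a ∉ P.O x)
    (t : K) (htS : ∀ x ∈ S, t ∉ P.O x) (ht : ∀ x ∉ S, t ∈ P.O x)
    {J : Type} [Fintype J] (a : J → K) (ha : ∀ i, ∀ x ∉ S, a i ∈ P.O x)
    (hfrac : ∀ f : K, ∃ q : Polynomial ℂ, Polynomial.aeval t q ≠ 0 ∧ ∃ p : J → Polynomial ℂ,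
      Polynomial.aeval t q * f = ∑ i, Polynomial.aeval t (p i) * a i) :
    Module.Finite ℂ (H1 P.functions) := by
  classical
  have happrox : ∀ x ∉ S, ∀ g : K, ∃ h : K, h - g ∈ P.O x ∧ ∀ y ∉ S, y ≠ x → h ∈ P.O y :=
    fun x hx g => P.exists_approx (T := {x | x ∉ S}) hsep hx g
  have happroxS : ∀ x ∈ S, ∀ g : K, ∃ h : K, h - g ∈ P.O x ∧ ∀ y ∈ S, y ≠ x → h ∈ P.O y :=
    fun x hx g => P.exists_approx (T := S) (fun x hx y hy hxy =>
      P.exists_separating hP S.finite_toSet hxy hx hy) hx g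
  choose N hN using fun x i => (P.isPlace x).exists_pow_mul_mem (a i)
  let M : ℕ := ∑ x ∈ S, ∑ i, N x i
  have hM : ∀ x ∈ S, ∀ i, P.z x ^ M * a i ∈ P.O x := fun x hx i => by
    have h1 : N x i ≤ M := (Finset.single_le_sum (f := N x) (fun _ _ => Nat.zero_le _)
      (Finset.mem_univ i)).trans (Finset.single_le_sum (f := fun x => ∑ i, N x i)
        (fun _ _ => Nat.zero_le _) hx)
    rw [← Nat.sub_add_cancel h1, pow_add, mul_assoc]
    exact mul_mem (pow_mem (P.isPlace x).mem _) (hN x i)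
  let W : Submodule ℂ (H1 P.functions) := Submodule.span ℂ
    (⋃ x ∈ S, (fun i : ℕ => classAt P.functions x ((P.z x ^ i)⁻¹)) '' Set.Iic M)
  have hWfin : W.FG := Submodule.fg_span
    (S.finite_toSet.biUnion fun x _ => (Set.finite_Iic M).image _)
  have hcl : ∀ x ∈ S, ∀ e, P.z x ^ M * e ∈ P.O x → classAt P.functions x e ∈ W := by
    intro x hx e he
    obtain ⟨e₁, h₁, e₂, h₂, rfl⟩ :=
      Submodule.mem_sup.1 ((P.isPlace x).mem_span_inv_pow_sup M he)
    rw [map_add, classAt_eq_zero (show e₂ ∈ P.functions x from h₂), add_zero]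
    have := Submodule.mem_map_of_mem (f := classAt P.functions x) h₁
    rw [Submodule.map_span, ← Set.image_comp] at this
    exact Submodule.span_mono (Set.subset_biUnion_of_mem (u := fun x =>
      (fun i : ℕ => classAt P.functions x ((P.z x ^ i)⁻¹)) '' Set.Iic M) hx) this
  -- a function only contributes its poles of bounded order
  have hfun : ∀ h : K, ∑ x ∈ S, classAt P.functions x h ∈ W := by
    intro h
    obtain ⟨q, hq, p, hp⟩ := hfrac h
    have hq0 : q ≠ 0 := by rintro rfl; exact hq (map_zero _)
    -- polynomial division: the part `A` is regular outside `S`, and the poles of `B` at the points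
    -- of `S` are bounded by those of the `a i`
    let A : K := ∑ i, Polynomial.aeval t (p i / q) * a i
    let B : K := ∑ i, (Polynomial.aeval t q)⁻¹ * Polynomial.aeval t (p i % q) * a i
    have hAB : h = A + B := by
      rw [← mul_right_inj' hq, hp, mul_add, Finset.mul_sum, Finset.mul_sum,
        ← Finset.sum_add_distrib]
      refine Finset.sum_congr rfl fun i _ => ?_
      conv_lhs => rw [← EuclideanDomain.div_add_mod (p i) q]
      rw [map_add, map_mul]
      field_simp
    have hA : ∀ x ∉ S, A ∈ P.functions x := fun x hx =>
      sum_mem fun i _ => mul_mem (S := Subalgebra ℂ K) (by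
      have := (Polynomial.aeval (⟨t, ht x hx⟩ : P.O x) (p i / q)).2
      rwa [← Subalgebra.coe_val, ← Polynomial.aeval_algHom_apply] at this) (ha i x hx)
    rw [hAB]
    simp only [map_add, Finset.sum_add_distrib]
    rw [sum_classAt_rational hA, zero_add]
    refine sum_mem fun x hx => hcl x hx _ ?_
    rw [Finset.mul_sum]
    refine sum_mem fun i _ => ?_
    rw [mul_left_comm]
    exact mul_mem ((P.isPlace x).aeval_div_mem (htS x hx) _ _ hq0
      (Polynomial.natDegree_le_natDegree (EuclideanDomain.mod_lt (p i) hq0).le)) (hM x hx i)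
  have hS : ∀ x ∈ S, ∀ v, classAt P.functions x v ∈ W := by
    intro x hx v
    obtain ⟨h, hxh, hyh⟩ := happroxS x hx v
    have h1 := hfun h
    rw [← Finset.add_sum_erase _ _ hx, Finset.sum_eq_zero, add_zero] at h1
    · rwa [classAt_congr (show h - v ∈ P.functions x from hxh)] at h1
    · exact fun y hy => classAt_eq_zero
        (hyh y (Finset.mem_of_mem_erase hy) (Finset.ne_of_mem_erase hy))
  have htop : W = ⊤ := by
    rw [eq_top_iff]
    rintro c -
    obtain ⟨F, v, rfl⟩ := H1.exists_eq_sum c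
    refine sum_mem fun x _ => ?_
    by_cases hx : x ∈ S
    · exact hS x hx _
    · obtain ⟨h, hxh, hyh⟩ := happrox x hx (v x)
      have h1 := sum_classAt_rational (L := P.functions) (F := insert x S) (e := h)
        fun y hy => by
          rw [Finset.mem_insert, not_or] at hy
          exact hyh y hy.2 hy.1
      rw [Finset.sum_insert hx, classAt_congr (show h - v x ∈ P.functions x from hxh)] at h1
      rw [eq_neg_of_add_eq_zero_left h1]
      exact neg_mem (sum_mem fun y hy => hS y hy _)
  exact ⟨htop ▸ hWfin⟩

/-- There are infinitely many places if there is a nonconstant function `t`: each place excludes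
at most one constant `c` from those for which `(t + c)⁻¹` has no pole. -/
theorem Places.infinite (h0 : ∀ f : K, (∀ x, f ∈ P.O x) → f ∈ (algebraMap ℂ K).range)
    {t : K} (ht : t ∉ (algebraMap ℂ K).range) : Infinite ι := by
  by_contra hfin
  rw [not_infinite_iff_finite] at hfin
  have hbad : (⋃ x, {c : ℂ | (P.z x)⁻¹ * (t + algebraMap ℂ K c) ∈ P.O x}).Finite := by
    refine Set.finite_iUnion fun w => Set.Subsingleton.finite ?_
    intro c hc d hd
    have := sub_mem (S := Subalgebra ℂ K) hc hd
    rw [← mul_sub, add_sub_add_left_eq_sub, ← map_sub] at this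
    exact sub_eq_zero.1 ((P.isPlace w).algebraMap_eq_zero this)
  obtain ⟨c, hc⟩ := hbad.exists_notMem
  rw [Set.mem_iUnion] at hc
  push Not at hc
  obtain ⟨d, hd⟩ := h0 (t + algebraMap ℂ K c)⁻¹ fun x =>
    (P.isPlace x).inv_mem_of_notMem (hc x)
  refine ht ⟨d⁻¹ - c, ?_⟩
  rw [map_sub, map_inv₀, hd, inv_inv, add_sub_cancel_right]

end Approximation

end CurveBundle

end

noncomputable section

namespace CurveBundle

/-! ### Smooth algebras of relative dimension one -/

section SmoothAlgebra

variable {B : Type} [CommRing B] [Algebra ℂ B]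
  [Algebra.IsStandardSmoothOfRelativeDimension 1 ℂ B]

/-- The maximal ideals of the local rings are principal: they are generated by those of the
local rings of the affine line. -/
theorem isPrincipal_maximalIdeal (p : Ideal B) [p.IsPrime] (S : Type) [CommRing S] [IsLocalRing S]
    [Algebra B S] [IsLocalization.AtPrime S p] : (IsLocalRing.maximalIdeal S).IsPrincipal := by
  obtain ⟨g, hg⟩ := Algebra.IsStandardSmoothOfRelativeDimension.exists_etale_mvPolynomial 1 ℂ B
  algebraize [g.toRingHom]
  have h1 : Algebra.IsUnramifiedAt (MvPolynomial (Fin 1) ℂ) p := inferInstance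
  let q := p.under (MvPolynomial (Fin 1) ℂ)
  let : Algebra (Localization.AtPrime q) (Localization.AtPrime p) :=
    Localization.AtPrime.algebraOfLiesOver q p
  have h2 := ((Algebra.isUnramifiedAt_iff_map_eq (MvPolynomial (Fin 1) ℂ) q p).1 h1).2
  have h3 : q.IsPrincipal := by
    have : IsPrincipalIdealRing (MvPolynomial (Fin 1) ℂ) := IsPrincipalIdealRing.of_surjective
      (MvPolynomial.uniqueAlgEquiv ℂ (Fin 1)).symm.toRingHom
      (MvPolynomial.uniqueAlgEquiv ℂ (Fin 1)).symm.surjective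
    exact IsPrincipalIdealRing.principal q
  let e : Localization.AtPrime p ≃ₐ[B] S := IsLocalization.algEquiv p.primeCompl _ _
  have h4 : IsLocalRing.maximalIdeal S = (IsLocalRing.maximalIdeal (Localization.AtPrime p)).map
      (e.toRingEquiv : Localization.AtPrime p →+* S) := by
    have := Ideal.map_isMaximal_of_equiv e.toRingEquiv
      (p := IsLocalRing.maximalIdeal (Localization.AtPrime p))
    exact (IsLocalRing.eq_maximalIdeal this).symm
  obtain ⟨a, ha⟩ := h3
  rw [h4, ← h2, Ideal.map_map, ha, Ideal.submodule_span_eq, Ideal.map_span, Set.image_singleton]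
  exact ⟨_, rfl⟩

variable [IsDomain B]

variable (B) in
/-- The dimension is one: `B` is étale over the affine line. -/
theorem trdeg_eq_one : Algebra.trdeg ℂ B = 1 := by
  obtain ⟨g, hg⟩ := Algebra.IsStandardSmoothOfRelativeDimension.exists_etale_mvPolynomial 1 ℂ B
  algebraize [g.toRingHom]
  have : IsScalarTower ℂ (MvPolynomial (Fin 1) ℂ) B :=
    IsScalarTower.of_algebraMap_eq' g.comp_algebraMap.symm
  -- `B` is étale over the polynomial ring, hence its field of fractions is finite over that of
  -- the polynomial ring
  let F := FractionRing (MvPolynomial (Fin 1) ℂ)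
  let K := FractionRing B
  let : Algebra F K := FractionRing.liftAlgebra _ _
  have : Algebra.FormallyUnramified B K := .of_isLocalization (nonZeroDivisors B)
  have : Algebra.FormallyUnramified (MvPolynomial (Fin 1) ℂ) K := .comp _ B _
  have : Algebra.FormallyUnramified F K := .of_restrictScalars (MvPolynomial (Fin 1) ℂ) _ _
  have : Algebra.EssFiniteType B K := .of_isLocalization _ (nonZeroDivisors B)
  have : Algebra.EssFiniteType (MvPolynomial (Fin 1) ℂ) K := .comp _ B _
  have : Algebra.EssFiniteType F K := .of_comp (MvPolynomial (Fin 1) ℂ) _ _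
  have : Module.Finite F K := Algebra.FormallyUnramified.finite_of_free _ _
  have : Algebra.IsAlgebraic (MvPolynomial (Fin 1) ℂ) K :=
    (IsFractionRing.comap_isAlgebraic_iff (K := F)).2 inferInstance
  have : Algebra.IsAlgebraic (MvPolynomial (Fin 1) ℂ) B :=
    .of_injective (IsScalarTower.toAlgHom (MvPolynomial (Fin 1) ℂ) B K)
      (IsFractionRing.injective B K)
  have h := lift_trdeg_add_eq ℂ (MvPolynomial (Fin 1) ℂ) B
  rw [MvPolynomial.trdeg_of_isDomain, trdeg_eq_zero (R := MvPolynomial (Fin 1) ℂ)] at h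
  simpa using h.symm

variable (B) in
/-- Noether normalization in dimension one. -/
theorem exists_polynomial_finite :
    ∃ φ : Polynomial ℂ →ₐ[ℂ] B, Function.Injective φ ∧ φ.toRingHom.Finite := by
  have : Algebra.IsStandardSmooth ℂ B :=
    Algebra.IsStandardSmoothOfRelativeDimension.isStandardSmooth 1
  obtain ⟨s, g, hg, hfin⟩ := exists_finite_inj_algHom_of_fg ℂ B
  have hs : s = 1 := by
    algebraize [g.toRingHom]
    have : IsScalarTower ℂ (MvPolynomial (Fin s) ℂ) B :=
      IsScalarTower.of_algebraMap_eq' g.comp_algebraMap.symm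
    have : FaithfulSMul (MvPolynomial (Fin s) ℂ) B :=
      (faithfulSMul_iff_algebraMap_injective _ _).2 hg
    have : Module.Finite (MvPolynomial (Fin s) ℂ) B := hfin
    have h := lift_trdeg_add_eq ℂ (MvPolynomial (Fin s) ℂ) B
    rw [MvPolynomial.trdeg_of_isDomain, trdeg_eq_zero (R := MvPolynomial (Fin s) ℂ),
      trdeg_eq_one] at h
    simpa using h
  subst hs
  let e : MvPolynomial (Fin 1) ℂ ≃ₐ[ℂ] Polynomial ℂ := MvPolynomial.uniqueAlgEquiv ℂ (Fin 1)
  refine ⟨g.comp e.symm.toAlgHom, hg.comp e.symm.injective, ?_⟩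
  exact RingHom.Finite.comp hfin (RingHom.Finite.of_surjective _ e.symm.surjective)

variable (B) in
theorem dimensionLEOne_and_not_isField : Ring.DimensionLEOne B ∧ ¬ IsField B := by
  obtain ⟨φ, hφ, hfin⟩ := exists_polynomial_finite B
  let : Algebra (Polynomial ℂ) B := φ.toRingHom.toAlgebra
  have : Module.Finite (Polynomial ℂ) B := hfin
  have : FaithfulSMul (Polynomial ℂ) B := (faithfulSMul_iff_algebraMap_injective _ _).2 hφ
  refine ⟨⟨fun {p} hp hp' => ?_⟩, fun h => ?_⟩
  · obtain ⟨b, hb, hb0⟩ := Submodule.exists_mem_ne_zero_of_ne_bot hp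
    have h1 := Ideal.comap_ne_bot_of_integral_mem hb0 hb
      (Algebra.IsIntegral.isIntegral (R := Polynomial ℂ) b)
    exact Ideal.isMaximal_of_isIntegral_of_isMaximal_comap p
      (Ring.DimensionLEOne.maximalOfPrime h1 inferInstance)
  · exact Polynomial.not_isField ℂ (isField_of_isIntegral_of_isField hφ h)

end SmoothAlgebra

end CurveBundle

end

noncomputable section

namespace CurveBundle

/-! ### The local rings of a curve -/

namespace Curve

variable (C : Curve)

/-- The constants in the functions on an open set. -/
def constantsOn (V : C.X.Opens) : ℂ →+* Γ(C.X, V) :=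
  (C.X.presheaf.map (homOfLE le_top).op).hom.comp C.constants

/-- Every point has an affine neighbourhood whose ring of functions is standard smooth of relative
dimension one over the constants. -/
theorem exists_isAffineOpen (x : C.X) : ∃ V : C.X.Opens, IsAffineOpen V ∧ x ∈ V ∧
    (C.constantsOn V).IsStandardSmoothOfRelativeDimension 1 := by
  obtain ⟨U, hU, V, hV, hx, e, h⟩ :=
    SmoothOfRelativeDimension.exists_isStandardSmoothOfRelativeDimension (n := 1) (f := C.str) x
  have hUtop : U = ⊤ := by
    rw [eq_top_iff]
    rintro y -
    have : y = C.str x := Subsingleton.elim (α := PrimeSpectrum ℂ) _ _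
    rw [this]
    exact e hx
  subst hUtop
  refine ⟨V, hV, hx, ?_⟩
  have h1 := (RingHom.isStandardSmoothOfRelativeDimension_respectsIso (n := 1)).2
    (C.str.appLE ⊤ V e).hom (Scheme.ΓSpecIso (CommRingCat.of ℂ)).symm.commRingCatIsoToRingEquiv h
  exact h1

variable {C}

/-- A point is generic or closed. -/
theorem eq_genericPoint_or_isClosed (x : C.X) :
    x = genericPoint C.X ∨ IsClosed ({x} : Set C.X) := by
  obtain ⟨V, hV, hx, hsm⟩ := C.exists_isAffineOpen x
  have : Nonempty V := ⟨⟨x, hx⟩⟩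
  let : Algebra ℂ Γ(C.X, V) := (C.constantsOn V).toAlgebra
  have : Algebra.IsStandardSmoothOfRelativeDimension 1 ℂ Γ(C.X, V) := hsm
  have := (dimensionLEOne_and_not_isField Γ(C.X, V)).1
  let p := hV.primeIdealOf ⟨x, hx⟩
  have hp : hV.fromSpec p = x := hV.fromSpec_primeIdealOf ⟨x, hx⟩
  by_cases h : p.asIdeal = ⊥
  · left
    have hgen : genericPoint C.X ∈ V :=
      ((genericPoint_spec C.X).specializes trivial).mem_open V.isOpen hx
    have h1 : p = hV.primeIdealOf ⟨genericPoint C.X, hgen⟩ := by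
      rw [hV.primeIdealOf_genericPoint]
      refine PrimeSpectrum.ext (h.trans ?_)
      rw [genericPoint_eq_bot_of_affine]
      rfl
    rw [← hp, h1, hV.fromSpec_primeIdealOf]
  · right
    have h1 : IsClosed {p} := (PrimeSpectrum.isClosed_singleton_iff_isMaximal p).2
      (Ring.DimensionLEOne.maximalOfPrime h p.isPrime)
    have : JacobsonSpace C.X := LocallyOfFiniteType.jacobsonSpace C.str
    have h2 := h1.isLocallyClosed.image hV.fromSpec.isOpenEmbedding.isInducing
      hV.fromSpec.isOpenEmbedding.isOpen_range.isLocallyClosed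
    have h3 : hV.fromSpec '' {p} = {x} := Set.image_singleton.trans (congrArg _ hp)
    exact isClosed_singleton_of_isLocallyClosed_singleton ((congrArg IsLocallyClosed h3).mp h2)

/-- The local rings are principal ideal domains. -/
instance (x : C.X) : IsPrincipalIdealRing (C.localRing x) := by
  obtain ⟨V, hV, hx, hsm⟩ := C.exists_isAffineOpen x
  have : Nonempty V := ⟨⟨x, hx⟩⟩
  let : Algebra ℂ Γ(C.X, V) := (C.constantsOn V).toAlgebra
  have : Algebra.IsStandardSmoothOfRelativeDimension 1 ℂ Γ(C.X, V) := hsm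
  let : Algebra Γ(C.X, V) (C.localRing x) := (C.X.presheaf.germ V x hx).hom.toAlgebra
  have : IsLocalization.AtPrime (C.localRing x) (hV.primeIdealOf ⟨x, hx⟩).asIdeal :=
    hV.isLocalization_stalk ⟨x, hx⟩
  have h1 := isPrincipal_maximalIdeal (hV.primeIdealOf ⟨x, hx⟩).asIdeal (C.localRing x)
  exact ((tfae_of_isNoetherianRing_of_isLocalRing_of_isDomain (C.localRing x)).out 0 4).2 h1

theorem not_isField_localRing (x : C.Pt) : ¬ IsField (C.localRing x.1) := by
  obtain ⟨V, hV, hx, hsm⟩ := C.exists_isAffineOpen x.1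
  have : Nonempty V := ⟨⟨x.1, hx⟩⟩
  let : Algebra ℂ Γ(C.X, V) := (C.constantsOn V).toAlgebra
  have : Algebra.IsStandardSmoothOfRelativeDimension 1 ℂ Γ(C.X, V) := hsm
  have h1 := (dimensionLEOne_and_not_isField Γ(C.X, V)).2
  let : Algebra Γ(C.X, V) (C.localRing x.1) := (C.X.presheaf.germ V x.1 hx).hom.toAlgebra
  have : IsLocalization.AtPrime (C.localRing x.1) (hV.primeIdealOf ⟨x.1, hx⟩).asIdeal :=
    hV.isLocalization_stalk ⟨x.1, hx⟩
  have hmax := hV.primeIdealOf_isMaximal_of_isClosed ⟨x.1, hx⟩ x.2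
  exact IsLocalization.AtPrime.not_isField Γ(C.X, V)
    (Ring.ne_bot_of_isMaximal_of_not_isField hmax h1) (C.localRing x.1)

instance (x : C.Pt) : IsDiscreteValuationRing (C.localRing x.1) where
  not_a_field' := fun h => not_isField_localRing x (IsLocalRing.isField_iff_maximalIdeal_eq.2 h)

instance : CompactSpace C.X := QuasiCompact.compactSpace_of_compactSpace C.str

/-- The complement of a nonempty open set is finite. -/
theorem finite_notMem_opens {U : C.X.Opens} (hU : genericPoint C.X ∈ U) :
    {x : C.Pt | x.1 ∉ U}.Finite := by
  have : IsNoetherian C.X := {}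
  obtain ⟨S, hSf, hSc, hSi, hSU⟩ :=
    TopologicalSpace.NoetherianSpace.exists_finite_set_isClosed_irreducible U.isOpen.isClosed_compl
  have key : ∀ t ∈ S, {x : C.Pt | x.1 ∈ t}.Finite := by
    intro t ht
    obtain ⟨y, hy⟩ := QuasiSober.sober (hSi t ht) (hSc t ht)
    have hyt : y ∈ t := hy.mem
    have hyU : y ∈ (U : Set C.X)ᶜ := hSU ▸ Set.mem_sUnion_of_mem hyt ht
    rcases eq_genericPoint_or_isClosed y with rfl | hyc
    · exact absurd hU hyU
    · have : t = {y} := by rw [← hy.def, hyc.closure_eq]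
      subst this
      exact Set.Subsingleton.finite fun a ha b hb => Subtype.ext (ha.trans hb.symm)
  refine (hSf.biUnion key).subset fun x hx => ?_
  have : x.1 ∈ (U : Set C.X)ᶜ := hx
  rw [hSU] at this
  obtain ⟨t, ht, hxt⟩ := this
  exact Set.mem_biUnion ht hxt

theorem germ_constantsOn {V : C.X.Opens} {x : C.X} (hx : x ∈ V) (c : ℂ) :
    C.X.presheaf.germ V x hx (C.constantsOn V c) = C.localConstants x c :=
  C.X.presheaf.germ_res_apply _ _ _ _

theorem algebraMap_localConstants (x : C.X) (c : ℂ) :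
    algebraMap (C.localRing x) C.K (C.localConstants x c) = algebraMap ℂ C.K c :=
  C.X.presheaf.germ_stalkSpecializes_apply _ _ _

/-- The residue field at a closed point is `ℂ`. -/
theorem exists_sub_localConstants_mem (x : C.Pt) (a : C.localRing x.1) :
    ∃ c : ℂ, a - C.localConstants x.1 c ∈ IsLocalRing.maximalIdeal (C.localRing x.1) := by
  obtain ⟨V, hV, hx, hsm⟩ := C.exists_isAffineOpen x.1
  have : Nonempty V := ⟨⟨x.1, hx⟩⟩
  let : Algebra ℂ Γ(C.X, V) := (C.constantsOn V).toAlgebra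
  have : Algebra.IsStandardSmoothOfRelativeDimension 1 ℂ Γ(C.X, V) := hsm
  have : Algebra.IsStandardSmooth ℂ Γ(C.X, V) :=
    Algebra.IsStandardSmoothOfRelativeDimension.isStandardSmooth 1
  let : Algebra Γ(C.X, V) (C.localRing x.1) := (C.X.presheaf.germ V x.1 hx).hom.toAlgebra
  let p := (hV.primeIdealOf ⟨x.1, hx⟩).asIdeal
  have : IsLocalization.AtPrime (C.localRing x.1) p := hV.isLocalization_stalk ⟨x.1, hx⟩
  have hmax : p.IsMaximal := hV.primeIdealOf_isMaximal_of_isClosed ⟨x.1, hx⟩ x.2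
  let := Ideal.Quotient.field p
  have hfin : Module.Finite ℂ (Γ(C.X, V) ⧸ p) := finite_of_finite_type_of_isJacobsonRing _ _
  have hsurj := (IsAlgClosed.algebraMap_bijective_of_isIntegral (k := ℂ) (K := Γ(C.X, V) ⧸ p)).2
  let e := IsLocalization.AtPrime.equivQuotMaximalIdeal p (C.localRing x.1)
  obtain ⟨c, hc⟩ := hsurj (e.symm (Ideal.Quotient.mk _ a))
  refine ⟨c, Ideal.Quotient.eq.1 ?_⟩
  rw [← e.apply_symm_apply (Ideal.Quotient.mk _ a), ← hc, ← germ_constantsOn hx]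
  exact IsLocalization.AtPrime.equivQuotMaximalIdeal_apply_mk p (C.localRing x.1) _

/-! ### The places of a curve -/

/-- The valuation ring `O_{X,x}` in the function field. -/
def valuationRing (C : Curve) (x : C.Pt) : Subalgebra ℂ C.K where
  __ := (algebraMap (C.localRing x.1) C.K).range
  algebraMap_mem' c := ⟨C.localConstants x.1 c, algebraMap_localConstants x.1 c⟩

theorem mem_valuationRing {x : C.Pt} {f : C.K} :
    f ∈ C.valuationRing x ↔ ∃ a : C.localRing x.1, algebraMap _ C.K a = f := Iff.rfl

/-- A closed point is a place of the function field. -/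
theorem isPlace_valuationRing {x : C.Pt} {z : C.K} (hz : C.IsUniformizer x z) :
    IsPlace (C.valuationRing x) z := by
  obtain ⟨ϖ, hϖ, rfl⟩ := hz
  have hirr : Irreducible ϖ := (IsDiscreteValuationRing.irreducible_iff_uniformizer ϖ).2 hϖ
  have hinj : Function.Injective (algebraMap (C.localRing x.1) C.K) :=
    IsFractionRing.injective (C.localRing x.1) C.K
  have hϖ0 : algebraMap (C.localRing x.1) C.K ϖ ≠ 0 :=
    (map_ne_zero_iff _ hinj).2 hirr.ne_zero
  have hdvd : ∀ a : C.localRing x.1, ϖ ∣ a ↔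
      (algebraMap (C.localRing x.1) C.K ϖ)⁻¹ * algebraMap _ C.K a ∈ C.valuationRing x := by
    intro a
    rw [mem_valuationRing]
    constructor
    · rintro ⟨b, rfl⟩
      exact ⟨b, by rw [map_mul, inv_mul_cancel_left₀ hϖ0]⟩
    · rintro ⟨b, hb⟩
      refine ⟨b, hinj ?_⟩
      rw [map_mul, hb, mul_inv_cancel_left₀ hϖ0]
  refine ⟨⟨ϖ, rfl⟩, ?_, ?_, ?_⟩
  · rintro ⟨b, hb⟩
    refine hirr.not_isUnit (IsUnit.of_mul_eq_one b (hinj ?_))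
    rw [map_mul, map_one, hb, mul_inv_cancel₀ hϖ0]
  · intro f hf
    obtain ⟨a, b, hb, rfl⟩ := IsFractionRing.div_surjective (A := C.localRing x.1) f
    have hb0 : b ≠ 0 := nonZeroDivisors.ne_zero hb
    have ha0 : a ≠ 0 := by rintro rfl; simp at hf
    obtain ⟨n, u, rfl⟩ := IsDiscreteValuationRing.eq_unit_mul_pow_irreducible ha0 hirr
    obtain ⟨m, v, rfl⟩ := IsDiscreteValuationRing.eq_unit_mul_pow_irreducible hb0 hirr
    have hunit : ∀ w : (C.localRing x.1)ˣ, algebraMap (C.localRing x.1) C.K w ≠ 0 := fun w =>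
      (map_ne_zero_iff _ hinj).2 w.ne_zero
    have hinv : ∀ w : (C.localRing x.1)ˣ,
        algebraMap (C.localRing x.1) C.K (w⁻¹ : (C.localRing x.1)ˣ) =
          (algebraMap (C.localRing x.1) C.K w)⁻¹ := fun w => eq_inv_of_mul_eq_one_left (by
      rw [← map_mul, Units.inv_mul, map_one])
    refine ⟨n - m, algebraMap (C.localRing x.1) C.K (u * v⁻¹ : (C.localRing x.1)ˣ), ⟨_, rfl⟩,
      ⟨((u * v⁻¹)⁻¹ : (C.localRing x.1)ˣ), hinv _⟩, ?_⟩
    have hv := hunit v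
    rw [Units.val_mul, map_mul, map_mul, map_mul, map_pow, map_pow, hinv, zpow_sub₀ hϖ0,
      zpow_natCast, zpow_natCast]
    field_simp
  · -- the residue map sends `a` to the constant which is congruent to it
    choose ρ hρ using exists_sub_localConstants_mem x
    have hinjc : ∀ c : ℂ, C.localConstants x.1 c ∈ IsLocalRing.maximalIdeal (C.localRing x.1) →
        c = 0 := fun c hc => by
      by_contra h
      exact (IsLocalRing.mem_maximalIdeal _).1 hc ((Ne.isUnit h).map (C.localConstants x.1))
    have huniq : ∀ a c, a - C.localConstants x.1 c ∈ IsLocalRing.maximalIdeal (C.localRing x.1) →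
        ρ a = c := fun a c h => by
      have := Ideal.sub_mem _ h (hρ a)
      rw [sub_sub_sub_cancel_left, ← map_sub] at this
      exact sub_eq_zero.1 (hinjc _ this)
    let ρ' : C.localRing x.1 →+* ℂ :=
      { toFun := ρ
        map_one' := huniq _ _ (by simp)
        map_zero' := huniq _ _ (by simp)
        map_add' := fun a b => huniq _ _ (by
          rw [map_add, add_sub_add_comm]
          exact Ideal.add_mem _ (hρ a) (hρ b))
        map_mul' := fun a b => huniq _ _ (by
          have h1 := Ideal.add_mem _ (Ideal.mul_mem_left _ a (hρ b))
            (Ideal.mul_mem_left _ (C.localConstants x.1 (ρ b)) (hρ a))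
          convert h1 using 1
          rw [map_mul]
          ring) }
    have hker : ∀ a, ρ a = 0 ↔ ϖ ∣ a := by
      intro a
      rw [← Ideal.mem_span_singleton, ← hϖ]
      constructor
      · intro h
        have := hρ a
        rwa [h, map_zero, sub_zero] at this
      · intro h
        exact huniq _ _ (by rwa [map_zero, sub_zero])
    let e : C.localRing x.1 ≃+* (algebraMap (C.localRing x.1) C.K).range :=
      RingEquiv.ofLeftInverse (Function.leftInverse_invFun hinj)
    have he : ∀ a, ((e a : (algebraMap (C.localRing x.1) C.K).range) : C.K) =
        algebraMap _ C.K a := fun a => rfl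
    let σ : C.valuationRing x →ₐ[ℂ] ℂ :=
      { (ρ'.comp e.symm.toRingHom : (algebraMap (C.localRing x.1) C.K).range →+* ℂ) with
        commutes' := fun c => by
          have : e.symm ⟨algebraMap ℂ C.K c,
              ⟨C.localConstants x.1 c, algebraMap_localConstants x.1 c⟩⟩ =
              C.localConstants x.1 c := by
            rw [RingEquiv.symm_apply_eq]
            exact Subtype.ext (algebraMap_localConstants x.1 c).symm
          change ρ (e.symm _) = c
          refine (congrArg ρ this).trans (huniq _ _ (by simp)) }
    refine ⟨σ, fun a => ?_⟩
    obtain ⟨b, rfl⟩ : ∃ b, e b = a := e.surjective a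
    change ρ (e.symm (e b)) = 0 ↔ _
    rw [e.symm_apply_apply, hker, hdvd]
    rfl

end Curve

end CurveBundle

end

noncomputable section

namespace CurveBundle

/-! ### Gluing rational sections -/

section Gluing

variable {C : Curve}

theorem genericPoint_specializes (x : C.X) : genericPoint C.X ⤳ x :=
  (genericPoint_spec C.X).specializes trivial

theorem genericPoint_mem {U : C.X.Opens} {x : C.X} (hx : x ∈ U) : genericPoint C.X ∈ U :=
  (genericPoint_specializes x).mem_open U.isOpen hx

variable {D : Type 1} [Category.{0} D] {FD : D → D → Type} {CD : D → Type}
  [∀ X Y, FunLike (FD X Y) (CD X) (CD Y)] [ConcreteCategory.{0} D FD] [Limits.HasColimits D]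
  [Limits.HasLimits D] [(forget D).ReflectsIsomorphisms] [Limits.PreservesLimits (forget D)]
  [Limits.PreservesFilteredColimits (forget D)]
  {F : TopCat.Presheaf D C.X}

/-- For a sheaf whose germs embed into the stalk at the generic point, sections are determined by
their germs there. -/
theorem eq_of_germ_genericPoint_eq (hS : F.IsSheaf)
    (hF : ∀ x : C.X, Function.Injective (F.stalkSpecializes (genericPoint_specializes x)))
    {U : C.X.Opens} (hU : genericPoint C.X ∈ U)
    {s t : ToType (F.obj (.op U))} (h : F.germ U _ hU s = F.germ U _ hU t) : s = t := by
  refine TopCat.Presheaf.section_ext ⟨F, hS⟩ U s t fun x hx => hF x ?_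
  have key := fun m =>
    TopCat.Presheaf.germ_stalkSpecializes_apply F hx (genericPoint_specializes x) m
  exact (key s).trans (h.trans (key t).symm)

/-- For such a sheaf, an element of the stalk at the generic point which comes from a germ at every
point comes from a global section. -/
theorem exists_germ_genericPoint_eq (hS : F.IsSheaf)
    (hF : ∀ x : C.X, Function.Injective (F.stalkSpecializes (genericPoint_specializes x)))
    (v : ToType (F.stalk (genericPoint C.X)))
    (hv : ∀ x : C.X, ∃ e, F.stalkSpecializes (genericPoint_specializes x) e = v) :
    ∃ s : ToType (F.obj (.op ⊤)), F.germ ⊤ (genericPoint C.X) trivial s = v := by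
  have h1 : ∀ x : C.X, ∃ (U : C.X.Opens) (hx : x ∈ U) (s : ToType (F.obj (.op U))),
      F.germ U _ (genericPoint_mem hx) s = v := by
    intro x
    obtain ⟨e, he⟩ := hv x
    obtain ⟨U, hx, s, rfl⟩ := F.exists_germ_eq e
    have h2 := TopCat.Presheaf.germ_stalkSpecializes_apply F hx (genericPoint_specializes x) s
    exact ⟨U, hx, s, h2.symm.trans he⟩
  choose U hx s hs using h1
  obtain ⟨t, ht, -⟩ := TopCat.Sheaf.existsUnique_gluing' ⟨F, hS⟩ U ⊤ (fun x => homOfLE le_top)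
    (fun x _ => TopologicalSpace.Opens.mem_iSup.2 ⟨x, hx x⟩) s fun x y => by
      have hη : genericPoint C.X ∈ U x ⊓ U y := ⟨genericPoint_mem (hx x), genericPoint_mem (hx y)⟩
      refine eq_of_germ_genericPoint_eq hS hF hη ?_
      have e1 := TopCat.Presheaf.germ_res_apply F (TopologicalSpace.Opens.infLELeft (U x) (U y))
        (genericPoint C.X) hη (s x)
      have e2 := TopCat.Presheaf.germ_res_apply F (TopologicalSpace.Opens.infLERight (U x) (U y))
        (genericPoint C.X) hη (s y)
      exact (e1.trans (hs x)).trans (e2.trans (hs y)).symm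
  refine ⟨t, ?_⟩
  let x := genericPoint C.X
  have e1 := TopCat.Presheaf.germ_res_apply F (homOfLE le_top : U x ⟶ ⊤) (genericPoint C.X)
    (genericPoint_mem (hx x)) t
  rw [← e1]
  exact (congrArg _ (ht x)).trans (hs x)

end Gluing

namespace Curve

variable {C : Curve}

theorem algebraMap_localRing_injective (x : C.X) :
    Function.Injective (algebraMap (C.localRing x) C.K) :=
  IsFractionRing.injective (C.localRing x) C.K

theorem algebraMap_germ {U : C.X.Opens} {x : C.X} (hx : x ∈ U) (a : Γ(C.X, U)) :
    algebraMap (C.localRing x) C.K (C.X.presheaf.germ U x hx a) =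
      C.X.presheaf.germ U _ (genericPoint_mem hx) a :=
  TopCat.Presheaf.germ_stalkSpecializes_apply C.X.presheaf hx (genericPoint_specializes x) a

theorem exists_isUniformizer (x : C.Pt) : ∃ z, C.IsUniformizer x z := by
  obtain ⟨ϖ, hϖ⟩ := IsDiscreteValuationRing.exists_irreducible (C.localRing x.1)
  exact ⟨_, ϖ, (IsDiscreteValuationRing.irreducible_iff_uniformizer ϖ).1 hϖ, rfl⟩

theorem finite_notMem_valuationRing (f : C.K) : {x | f ∉ C.valuationRing x}.Finite := by
  obtain ⟨U, hU, a, rfl⟩ := C.X.presheaf.exists_germ_eq f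
  refine (finite_notMem_opens hU).subset fun x hx hxU => hx ?_
  exact ⟨C.X.presheaf.germ U x.1 hxU a, algebraMap_germ hxU a⟩

variable (C) in
/-- The places of the function field given by the closed points. -/
def places : Places C.K C.Pt where
  O := C.valuationRing
  z x := (exists_isUniformizer x).choose
  isPlace x := isPlace_valuationRing (exists_isUniformizer x).choose_spec
  finite_notMem := finite_notMem_valuationRing

/-- If all functions on the affine open set `U` are regular at `x`, then `x ∈ U`. They define a map
from the spectrum of `O_{X,x}` to `U`, which agrees with the inclusion of that spectrum into `X` at
the generic point, and hence everywhere, since `X` is separated. -/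
theorem mem_of_forall_mem_valuationRing {U : C.X.Opens} (hU : IsAffineOpen U)
    (hη : genericPoint C.X ∈ U) {x : C.Pt}
    (h : ∀ a : Γ(C.X, U), C.X.presheaf.germ U _ hη a ∈ C.valuationRing x) : x.1 ∈ U := by
  choose φ hφ using fun a => mem_valuationRing.1 (h a)
  have hinj := algebraMap_localRing_injective x.1
  let φ' : Γ(C.X, U) →+* C.localRing x.1 :=
    { toFun := φ
      map_one' := hinj (by rw [hφ, map_one, map_one])
      map_zero' := hinj (by rw [hφ, map_zero, map_zero])
      map_add' := fun a b => hinj (by rw [hφ, map_add, map_add, hφ, hφ])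
      map_mul' := fun a b => hinj (by rw [hφ, map_mul, map_mul, hφ, hφ]) }
  let φ'' : Γ(C.X, U) ⟶ C.X.presheaf.stalk x.1 :=
    CommRingCat.ofHom (S := ↑(C.X.presheaf.stalk x.1)) φ'
  let f : Spec (C.X.presheaf.stalk x.1) ⟶ C.X := Spec.map φ'' ≫ hU.fromSpec
  let j := Spec.map (C.X.presheaf.stalkSpecializes (genericPoint_specializes x.1))
  have hj : IsDominant j := ⟨(PrimeSpectrum.denseRange_comap_iff_ker_le_nilRadical _).2 (by
    exact ((RingHom.injective_iff_ker_eq_bot _).1 hinj).trans_le bot_le)⟩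
  have hsep : C.X.IsSeparated := ⟨by
    rw [← Limits.terminal.comp_from C.str]
    infer_instance⟩
  have h1 : j ≫ f = j ≫ C.X.fromSpecStalk x.1 := by
    have e : φ'' ≫ C.X.presheaf.stalkSpecializes (genericPoint_specializes x.1) =
        C.X.presheaf.germ U _ hη := by
      ext a
      exact hφ a
    rw [Scheme.SpecMap_stalkSpecializes_fromSpecStalk, ← hU.fromSpecStalk_eq_fromSpecStalk hη,
      IsAffineOpen.fromSpecStalk, ← e, Spec.map_comp, Category.assoc]
  have h2 := ext_of_isDominant j h1
  have h3 : C.X.fromSpecStalk x.1 (IsLocalRing.closedPoint _) = x.1 :=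
    Scheme.fromSpecStalk_closedPoint
  rw [← h2] at h3
  rw [← h3]
  have h4 := hU.opensRange_fromSpec
  have : f (IsLocalRing.closedPoint _) ∈ hU.fromSpec.opensRange := ⟨_, rfl⟩
  rwa [h4] at this

/-- The valuation rings of different points are not contained in each other. -/
theorem not_valuationRing_le {x y : C.Pt} (hxy : x ≠ y) :
    ¬ C.valuationRing x ≤ C.valuationRing y := by
  intro hle
  have hx : x.1 ∈ (⟨{y.1}ᶜ, y.2.isOpen_compl⟩ : C.X.Opens) := fun h => hxy (Subtype.ext h)
  obtain ⟨_, ⟨U, hU, rfl⟩, hxU, hUy⟩ :=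
    C.X.isBasis_affineOpens.exists_subset_of_mem_open hx (TopologicalSpace.Opens.isOpen _)
  refine hUy (mem_of_forall_mem_valuationRing hU (genericPoint_mem hxU) (x := y)
    fun a => hle ?_) rfl
  exact ⟨C.X.presheaf.germ U x.1 hxU a, algebraMap_germ hxU a⟩

/-- The functions without poles are constant: they are global sections of `O_X`, which are finite
over `ℂ` because the curve is proper. -/
theorem mem_range_of_forall_mem_valuationRing {f : C.K} (hf : ∀ x, f ∈ C.valuationRing x) :
    f ∈ (algebraMap ℂ C.K).range := by
  obtain ⟨a, ha⟩ := exists_germ_genericPoint_eq C.X.sheaf.2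
    (fun x => algebraMap_localRing_injective x) f fun x => by
      rcases eq_genericPoint_or_isClosed x with rfl | hx
      · exact ⟨f, congrArg (fun h : C.X.presheaf.stalk (genericPoint C.X) ⟶ _ => h f)
          (C.X.presheaf.stalkSpecializes_refl _)⟩
      · exact hf ⟨x, hx⟩
  have h1 : C.constants.Finite := RingHom.Finite.comp
    (finite_appTop_of_universallyClosed ℂ C.str) (RingHom.Finite.of_surjective _
      (Scheme.ΓSpecIso (CommRingCat.of ℂ)).symm.commRingCatIsoToRingEquiv.surjective)
  have h2 : IsIntegral ℂ f := by
    obtain ⟨p, hp, hpa⟩ := h1.to_isIntegral a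
    refine ⟨p, hp, ?_⟩
    let g : Γ(C.X, ⊤) →+* C.K := (C.X.presheaf.germ ⊤ (genericPoint C.X) trivial).hom
    have h3 : g a = f := ha
    have h4 := Polynomial.hom_eval₂ p C.constants g a
    rw [hpa, map_zero, h3] at h4
    exact h4.symm
  exact minpoly.mem_range_of_degree_eq_one ℂ f
    (IsAlgClosed.degree_eq_one_of_irreducible ℂ (minpoly.irreducible h2))

theorem coheight_eq_one (x : C.Pt) : Order.coheight x.1 = 1 := by
  have h1 := ringKrullDim_stalk_eq_coheight x.1
  rw [show ringKrullDim (C.X.presheaf.stalk x.1) = 1 from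
    IsDiscreteValuationRing.ringKrullDim_eq_one (C.localRing x.1)] at h1
  exact_mod_cast h1.symm

/-- The order of vanishing of rational functions on a scheme is that of the place. -/
theorem ord_eq {x : C.Pt} {z : C.K} (hz : C.IsUniformizer x z) {f : C.K} (hf : f ≠ 0) :
    C.X.ord f x.1 = (isPlace_valuationRing hz).ord f := by
  have hx := coheight_eq_one x
  obtain ⟨u, ⟨a, rfl⟩, ⟨b, hb⟩, hu0, e⟩ := (isPlace_valuationRing hz).exists_eq_mul_zpow_ord hf
  have hinj := algebraMap_localRing_injective x.1
  have hz' := hz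
  obtain ⟨ϖ, hϖ, rfl⟩ := hz'
  have hirr : Irreducible ϖ := (IsDiscreteValuationRing.irreducible_iff_uniformizer ϖ).2 hϖ
  rw [Scheme.ord_eq_iff hx hf]
  generalize (isPlace_valuationRing hz).ord f = n at e
  have hua : IsUnit a := IsUnit.of_mul_eq_one b (hinj (by
    rw [map_mul, map_one, hb, mul_inv_cancel₀ hu0]))
  have h1 : C.X.ordHom x.1 hx (algebraMap (C.localRing x.1) C.K a) = 1 :=
    Ring.ordFrac_of_isUnit hua
  have h2 : C.X.ordHom x.1 hx (algebraMap (C.localRing x.1) C.K ϖ) = Multiplicative.ofAdd (1 : ℤ) :=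
    (Ring.ordFrac_eq_ord (C.localRing x.1) hirr.ne_zero).trans
      (Ring.ordMonoidWithZeroHom_eq_coe _ (mem_nonZeroDivisors_of_ne_zero hirr.ne_zero)
        (n := 1) (Ring.ord_of_irreducible hirr))
  rw [e, map_mul, h1, one_mul, map_zpow₀, h2, ← WithZero.coe_zpow, ← ofAdd_zsmul]
  simp

end Curve

end CurveBundle

end

noncomputable section

namespace CurveBundle

namespace Curve

variable {C : Curve}

/-! ### Finiteness of the genus -/

theorem inv_mul_algebraMap_mem_iff {x : C.Pt} {z : C.K} (hz : C.IsUniformizer x z)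
    (a : C.localRing x.1) : z⁻¹ * algebraMap (C.localRing x.1) C.K a ∈ C.valuationRing x ↔
      a ∈ IsLocalRing.maximalIdeal (C.localRing x.1) := by
  have hz0 := (isPlace_valuationRing hz).ne_zero
  obtain ⟨ϖ, hϖ, rfl⟩ := hz
  rw [hϖ, Ideal.mem_span_singleton, mem_valuationRing]
  constructor
  · rintro ⟨b, hb⟩
    refine ⟨b, algebraMap_localRing_injective x.1 ?_⟩
    rw [map_mul, hb, mul_inv_cancel_left₀ hz0]
  · rintro ⟨b, rfl⟩
    exact ⟨b, by rw [map_mul, inv_mul_cancel_left₀ hz0]⟩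

theorem isUniformizer_places (x : C.Pt) : C.IsUniformizer x (C.places.z x) :=
  (exists_isUniformizer x).choose_spec

theorem germ_mem_valuationRing {U : C.X.Opens} {x : C.Pt} (hx : x.1 ∈ U)
    (hη : genericPoint C.X ∈ U) (a : Γ(C.X, U)) :
    C.X.presheaf.germ U _ hη a ∈ C.valuationRing x :=
  ⟨C.X.presheaf.germ U x.1 hx a, algebraMap_germ hx a⟩

/-- The functions on an affine open set separate its points. -/
theorem exists_separating_of_isAffineOpen {U : C.X.Opens} (hU : IsAffineOpen U)
    (hη : genericPoint C.X ∈ U) {x y : C.Pt} (hx : x.1 ∈ U) (hy : y.1 ∈ U) (hxy : x ≠ y) :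
    ∃ a : Γ(C.X, U), (C.places.z y)⁻¹ * C.X.presheaf.germ U _ hη a ∈ C.valuationRing y ∧
      (C.places.z x)⁻¹ * C.X.presheaf.germ U _ hη a ∉ C.valuationRing x := by
  have hmem : ∀ (w : C.Pt) (hw : w.1 ∈ U) (a : Γ(C.X, U)),
      (C.places.z w)⁻¹ * C.X.presheaf.germ U _ hη a ∈ C.valuationRing w ↔
        a ∈ (hU.primeIdealOf ⟨w.1, hw⟩).asIdeal := by
    intro w hw a
    let : Algebra Γ(C.X, U) (C.localRing w.1) := (C.X.presheaf.germ U w.1 hw).hom.toAlgebra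
    have : IsLocalization.AtPrime (C.localRing w.1) (hU.primeIdealOf ⟨w.1, hw⟩).asIdeal :=
      hU.isLocalization_stalk ⟨w.1, hw⟩
    rw [← algebraMap_germ hw, inv_mul_algebraMap_mem_iff (isUniformizer_places w)]
    exact IsLocalization.AtPrime.to_map_mem_maximal_iff (C.localRing w.1)
      (hU.primeIdealOf ⟨w.1, hw⟩).asIdeal a
  have hmx := hU.primeIdealOf_isMaximal_of_isClosed ⟨x.1, hx⟩ x.2
  have hmy := hU.primeIdealOf_isMaximal_of_isClosed ⟨y.1, hy⟩ y.2
  have hne : ¬ (hU.primeIdealOf ⟨y.1, hy⟩).asIdeal ≤ (hU.primeIdealOf ⟨x.1, hx⟩).asIdeal := by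
    intro hle
    have h1 := PrimeSpectrum.ext (hmy.eq_of_le hmx.ne_top hle)
    have h2 := hU.fromSpec_primeIdealOf ⟨y.1, hy⟩
    rw [h1, hU.fromSpec_primeIdealOf] at h2
    exact hxy (Subtype.ext h2)
  obtain ⟨a, hay, hax⟩ := SetLike.not_le_iff_exists.1 hne
  exact ⟨a, (hmem y hy a).2 hay, fun h => hax ((hmem x hx a).1 h)⟩

variable (C) in
/-- There is an affine open set whose functions are finite over a polynomial ring. -/
theorem exists_polynomial_finite_opens : ∃ (U : C.X.Opens) (_ : IsAffineOpen U)
    (_ : genericPoint C.X ∈ U) (φ : Polynomial ℂ →+* Γ(C.X, U)),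
    φ.comp Polynomial.C = C.constantsOn U ∧ Function.Injective φ ∧ φ.Finite := by
  obtain ⟨U, hU, hη, hsm⟩ := C.exists_isAffineOpen (genericPoint C.X)
  have : Nonempty U := ⟨⟨_, hη⟩⟩
  let : Algebra ℂ Γ(C.X, U) := (C.constantsOn U).toAlgebra
  have : Algebra.IsStandardSmoothOfRelativeDimension 1 ℂ Γ(C.X, U) := hsm
  obtain ⟨φ, hφ, hfin⟩ := exists_polynomial_finite Γ(C.X, U)
  exact ⟨U, hU, hη, φ.toRingHom, φ.comp_algebraMap, hφ, hfin⟩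

theorem germ_comp_eq_aeval {U : C.X.Opens} (hη : genericPoint C.X ∈ U)
    {φ : Polynomial ℂ →+* Γ(C.X, U)} (hφ : φ.comp Polynomial.C = C.constantsOn U)
    (p : Polynomial ℂ) :
    C.X.presheaf.germ U _ hη (φ p) =
      (Polynomial.aeval (C.X.presheaf.germ U _ hη (φ Polynomial.X) : C.K) p : C.K) := by
  have : ((C.X.presheaf.germ U _ hη).hom.comp φ : Polynomial ℂ →+* C.K) =
      (Polynomial.aeval (R := ℂ) (C.X.presheaf.germ U _ hη (φ Polynomial.X) : C.K)).toRingHom := by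
    refine Polynomial.ringHom_ext (fun c => ?_) ?_
    · have h1 := congrArg (fun f => f c) hφ
      change φ (Polynomial.C c) = _ at h1
      change C.X.presheaf.germ U _ hη (φ (Polynomial.C c)) = _
      rw [h1]
      simp only [AlgHom.toRingHom_eq_coe, RingHom.coe_coe, Polynomial.aeval_C]
      exact germ_constantsOn hη c
    · simp
  exact congrArg (fun f => f p) this

/-- If `Γ(U, O)` is finite over `ℂ[t]`, then `t` has poles at all points outside `U`: if `t` is
regular at `x`, then so are all functions on `U`, being integral over `ℂ[t]`. -/
theorem germ_X_notMem_valuationRing {U : C.X.Opens} (hU : IsAffineOpen U)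
    (hη : genericPoint C.X ∈ U) {φ : Polynomial ℂ →+* Γ(C.X, U)}
    (hφ : φ.comp Polynomial.C = C.constantsOn U) (hfin : φ.Finite) {x : C.Pt} (hx : x.1 ∉ U) :
    C.X.presheaf.germ U _ hη (φ Polynomial.X) ∉ C.valuationRing x := by
  rintro ⟨τ, hτ⟩
  refine hx (mem_of_forall_mem_valuationRing hU hη fun a => ?_)
  let ψ : Polynomial ℂ →+* C.localRing x.1 := Polynomial.eval₂RingHom (C.localConstants x.1) τ
  let g : Γ(C.X, U) →+* C.K := (C.X.presheaf.germ U _ hη).hom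
  have hψ : (algebraMap (C.localRing x.1) C.K).comp ψ = g.comp φ := by
    ext p
    · simp only [ψ, RingHom.comp_apply, Polynomial.coe_eval₂RingHom, Polynomial.eval₂_C]
      have h1 := congrArg (fun f => g (f p)) hφ
      exact (algebraMap_localConstants x.1 p).trans ((germ_constantsOn hη p).symm.trans h1.symm)
    · simp only [ψ, RingHom.comp_apply, Polynomial.coe_eval₂RingHom, Polynomial.eval₂_X]
      exact hτ
  obtain ⟨p, hp, hpa⟩ := hfin.to_isIntegral a
  have h1 : IsIntegral (C.localRing x.1) (g a) := by
    refine ⟨p.map ψ, hp.map ψ, ?_⟩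
    rw [Polynomial.eval₂_map, hψ, ← Polynomial.hom_eval₂, hpa, map_zero]
  exact IsIntegrallyClosed.isIntegral_iff.1 h1

variable (C) in
/-- The genus is finite. A chart `U` which is finite over the affine line provides the data of the
finiteness criterion for `H¹(O)`. -/
theorem finite_H1_places : Module.Finite ℂ (H1 C.places.functions) := by
  obtain ⟨U, hU, hη, φ, hφ, hinj, hfin⟩ := C.exists_polynomial_finite_opens
  have hS := finite_notMem_opens hη
  have hmem : ∀ {x}, x ∉ hS.toFinset → x.1 ∈ U := fun {x} hx => by
    simpa using hx
  let g : Γ(C.X, U) →+* C.K := (C.X.presheaf.germ U _ hη).hom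
  let : Algebra (Polynomial ℂ) Γ(C.X, U) := φ.toAlgebra
  have : Module.Finite (Polynomial ℂ) Γ(C.X, U) := hfin
  have : Nonempty U := ⟨⟨_, hη⟩⟩
  have : IsFractionRing Γ(C.X, U) C.K := functionField_isFractionRing_of_isAffineOpen C.X U hU
  obtain ⟨n, s, hs⟩ := Module.Finite.exists_fin (R := Polynomial ℂ) (M := Γ(C.X, U))
  refine Places.finite_H1_functions (P := C.places) (fun x y hxy => not_valuationRing_le hxy)
    hS.toFinset (fun x hx y hy hxy => ?_) (g (φ Polynomial.X)) (fun x hx => ?_) (fun x hx => ?_)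
    (fun i => g (s i)) (fun i x hx => germ_mem_valuationRing (hmem hx) hη _) fun f => ?_
  · obtain ⟨a, hay, hax⟩ := exists_separating_of_isAffineOpen hU hη (hmem hx) (hmem hy) hxy
    exact ⟨g a, fun w hw => germ_mem_valuationRing (hmem hw) hη a, hay, hax⟩
  · exact germ_X_notMem_valuationRing hU hη hφ hfin (by simpa using hx)
  · exact germ_mem_valuationRing (hmem hx) hη _
  · obtain ⟨a, b, hb, rfl⟩ := IsFractionRing.div_surjective (A := Γ(C.X, U)) f
    have halg : IsAlgebraic (Polynomial ℂ) b :=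
      (Algebra.IsIntegral.isIntegral (R := Polynomial ℂ) b).isAlgebraic
    obtain ⟨q, hq, c, hc⟩ := halg.exists_nonzero_dvd hb
    have hg : Function.Injective g := IsFractionRing.injective Γ(C.X, U) C.K
    have hb0 : g b ≠ 0 := (map_ne_zero_iff g hg).2 (nonZeroDivisors.ne_zero hb)
    obtain ⟨p, hp⟩ := (Submodule.mem_span_range_iff_exists_fun (Polynomial ℂ)).1
      (hs ▸ Submodule.mem_top : a * c ∈ Submodule.span (Polynomial ℂ) (Set.range s))
    have hgφ : ∀ p : Polynomial ℂ, Polynomial.aeval (g (φ Polynomial.X)) p = g (φ p) := fun p =>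
      (germ_comp_eq_aeval hη hφ p).symm
    refine ⟨q, ?_, p, ?_⟩
    · rw [hgφ]
      exact (map_ne_zero_iff g hg).2 ((map_ne_zero_iff φ hinj).2 hq)
    · have h1 : ∀ i, Polynomial.aeval (g (φ Polynomial.X)) (p i) * g (s i) = g (p i • s i) :=
        fun i => by rw [hgφ, ← map_mul]; rfl
      simp only [h1]
      rw [← map_sum, hp, hgφ]
      change _ * (g a / g b) = _
      have h2 : φ q = b * c := hc
      rw [h2, map_mul, map_mul]
      field_simp

variable (C) in
theorem finrank_H0_places :
    Module.Finite ℂ (H0 C.places.functions) ∧ Module.finrank ℂ (H0 C.places.functions) = 1 := by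
  have h1 : H0 C.places.functions = LinearMap.range (Algebra.linearMap ℂ C.K) := by
    ext f
    rw [mem_H0]
    constructor
    · intro h
      exact mem_range_of_forall_mem_valuationRing h
    · rintro ⟨c, rfl⟩ x
      exact (C.places.O x).algebraMap_mem c
  have e := LinearEquiv.ofInjective (Algebra.linearMap ℂ C.K) (algebraMap ℂ C.K).injective
  rw [h1]
  exact ⟨Module.Finite.equiv e, by rw [← e.finrank_eq, Module.finrank_self]⟩

theorem chi_places : chi C.places.functions = 1 - C.genus := by
  rw [chi, (finrank_H0_places C).2]
  rfl

instance : Infinite C.Pt := by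
  obtain ⟨U, hU, hη, φ, hφ, hinj, hfin⟩ := C.exists_polynomial_finite_opens
  have : Nonempty U := ⟨⟨_, hη⟩⟩
  have : IsFractionRing Γ(C.X, U) C.K := functionField_isFractionRing_of_isAffineOpen C.X U hU
  let g : Γ(C.X, U) →+* C.K := (C.X.presheaf.germ U _ hη).hom
  have hg : Function.Injective g := IsFractionRing.injective Γ(C.X, U) C.K
  refine C.places.infinite (fun f hf => mem_range_of_forall_mem_valuationRing hf)
    (t := g (φ Polynomial.X)) ?_
  rintro ⟨c, hc⟩
  have h1 : g (φ (Polynomial.C c)) = algebraMap ℂ C.K c := by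
    have h2 := germ_comp_eq_aeval hη hφ (Polynomial.C c)
    rwa [Polynomial.aeval_C] at h2
  exact Polynomial.X_ne_C c (hinj (hg (hc.symm.trans h1.symm)))

end Curve

end CurveBundle

end

noncomputable section

namespace CurveBundle

/-! ### Germs of sections of a vector bundle -/

section Germs

variable {C : Curve} (E : C.X.Modules)

/-- The germ at `x` of a section over an open set. -/
def germAt {U : C.X.Opens} {x : C.X} (hx : x ∈ U) : Γ(E, U) →+ Stalk E x :=
  (E.presheaf.germ U x hx).hom

/-- Restriction of sections. -/
def resTo {U V : C.X.Opens} (h : V ≤ U) : Γ(E, U) →+ Γ(E, V) :=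
  (E.presheaf.map (homOfLE h).op).hom

theorem germAt_smul {U : C.X.Opens} {x : C.X} (hx : x ∈ U) (a : Γ(C.X, U)) (m : Γ(E, U)) :
    germAt E hx (a • m) = (show C.localRing x from C.X.presheaf.germ U x hx a) • germAt E hx m :=
  PresheafOfModules.germ_smul (R := C.X.presheaf) E.val x U hx a m

theorem germAt_resTo {U V : C.X.Opens} (h : V ≤ U) {x : C.X} (hx : x ∈ V) (m : Γ(E, U)) :
    germAt E hx (resTo E h m) = germAt E (h hx) m :=
  E.presheaf.germ_res_apply (homOfLE h) x hx m

theorem resTo_smul {U V : C.X.Opens} (h : V ≤ U) (a : Γ(C.X, U)) (m : Γ(E, U)) :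
    resTo E h (a • m) = (show Γ(C.X, V) from C.X.presheaf.map (homOfLE h).op a) • resTo E h m :=
  E.map_smul (homOfLE h) a m

theorem resTo_resTo {U V W : C.X.Opens} (h : V ≤ U) (h' : W ≤ V) (m : Γ(E, U)) :
    resTo E h' (resTo E h m) = resTo E (h'.trans h) m :=
  (ConcreteCategory.congr_hom (E.presheaf.map_comp (homOfLE h).op (homOfLE h').op) m).symm

theorem toRat_germAt {U : C.X.Opens} {x : C.X} (hx : x ∈ U) (m : Γ(E, U)) :
    toRat E x (germAt E hx m) = germAt E (genericPoint_mem hx) m :=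
  TopCat.Presheaf.germ_stalkSpecializes_apply E.presheaf hx (genericPoint_specializes x) m

theorem exists_germAt_eq {x : C.X} (e : Stalk E x) {U : C.X.Opens} (hU : x ∈ U) :
    ∃ (V : C.X.Opens) (_ : V ≤ U) (hx : x ∈ V) (m : Γ(E, V)), germAt E hx m = e := by
  obtain ⟨V, hV, hx, m, hm⟩ := E.presheaf.exists_le_germ_eq e hU
  exact ⟨V, hV, hx, m, hm⟩

theorem exists_resTo_eq_zero {x : C.X} {U : C.X.Opens} (hx : x ∈ U) {m : Γ(E, U)}
    (h : germAt E hx m = 0) : ∃ (V : C.X.Opens) (hV : V ≤ U) (_ : x ∈ V), resTo E hV m = 0 := by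
  have h1 : E.presheaf.germ U x hx m = E.presheaf.germ U x hx 0 :=
    h.trans (map_zero (germAt E hx)).symm
  obtain ⟨V, hV, i, j, hij⟩ := E.presheaf.germ_eq x hx hx m 0 h1
  exact ⟨V, i.le, hV, hij.trans (map_zero (resTo E j.le))⟩

variable {E} {r : ℕ}

/-- `e` is a local frame of `E` over `U`: it is a basis of the sections over every smaller open
set. -/
def IsFrame (U : C.X.Opens) (e : Fin r → Γ(E, U)) : Prop :=
  ∀ (V : C.X.Opens) (h : V ≤ U),
    LinearIndependent Γ(C.X, V) (fun i => resTo E h (e i)) ∧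
    Submodule.span Γ(C.X, V) (Set.range fun i => resTo E h (e i)) = ⊤

/-- The germs of a local frame form a basis of the stalk. -/
theorem IsFrame.linearIndependent_and_span {U : C.X.Opens} {e : Fin r → Γ(E, U)}
    (he : IsFrame U e) {x : C.X} (hx : x ∈ U) :
    LinearIndependent (C.localRing x) (fun i => germAt E hx (e i)) ∧
    Submodule.span (C.localRing x) (Set.range fun i => germAt E hx (e i)) = ⊤ := by
  have hsum : ∀ (V : C.X.Opens) (hV : V ≤ U) (hxV : x ∈ V) (a : Fin r → Γ(C.X, V)),
      germAt E hxV (∑ i, a i • resTo E hV (e i)) =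
        ∑ i, (show C.localRing x from C.X.presheaf.germ V x hxV (a i)) • germAt E hx (e i) := by
    intro V hV hxV a
    rw [map_sum]
    refine Finset.sum_congr rfl fun i _ => ?_
    rw [germAt_smul, germAt_resTo]
  constructor
  · rw [Fintype.linearIndependent_iff]
    intro g hg
    have h1 : ∀ i, ∃ V ≤ U, ∃ (hxV : x ∈ V) (a : Γ(C.X, V)), C.X.presheaf.germ V x hxV a = g i :=
      fun i => C.X.presheaf.exists_le_germ_eq (g i) hx
    choose V hV hxV a ha using h1
    let W : C.X.Opens := U ⊓ Finset.univ.inf V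
    have hWV : ∀ i, W ≤ V i := fun i => inf_le_right.trans (Finset.inf_le (Finset.mem_univ i))
    have hxW : x ∈ W := by
      refine ⟨hx, ?_⟩
      change x ∈ Finset.univ.inf V
      rw [← SetLike.mem_coe, TopologicalSpace.Opens.coe_finset_inf]
      simpa using hxV
    let a' : Fin r → Γ(C.X, W) := fun i => C.X.presheaf.map (homOfLE (hWV i)).op (a i)
    have ha' : ∀ i, C.X.presheaf.germ W x hxW (a' i) = g i := fun i =>
      (C.X.presheaf.germ_res_apply (homOfLE (hWV i)) x hxW (a i)).trans (ha i)
    have h2 := hsum W inf_le_left hxW a'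
    have h3 : ∑ i, (show C.localRing x from C.X.presheaf.germ W x hxW (a' i)) •
        germAt E hx (e i) = ∑ i, g i • germAt E hx (e i) :=
      Finset.sum_congr rfl fun i _ => congrArg (· • germAt E hx (e i)) (ha' i)
    rw [h3, hg] at h2
    obtain ⟨W', hW', hxW', h4⟩ := exists_resTo_eq_zero E hxW h2
    have h5 : ∑ i, (C.X.presheaf.map (homOfLE hW').op (a' i)) •
        resTo E (hW'.trans inf_le_left) (e i) = 0 := by
      rw [← h4, map_sum]
      refine Finset.sum_congr rfl fun i _ => ?_
      rw [resTo_smul, resTo_resTo]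
    intro i
    have h6 := Fintype.linearIndependent_iff.1 (he W' (hW'.trans inf_le_left)).1 _ h5 i
    rw [← ha' i, ← C.X.presheaf.germ_res_apply (homOfLE hW') x hxW' (a' i), h6]
    exact map_zero (C.X.presheaf.germ W' x hxW').hom
  · rw [eq_top_iff]
    rintro v -
    obtain ⟨V, hV, hxV, m, rfl⟩ := exists_germAt_eq E v hx
    have h1 : m ∈ Submodule.span Γ(C.X, V) (Set.range fun i => resTo E hV (e i)) := by
      rw [(he V hV).2]
      trivial
    obtain ⟨a, rfl⟩ := (Submodule.mem_span_range_iff_exists_fun _).1 h1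
    rw [hsum]
    exact sum_mem fun i _ => Submodule.smul_mem _ _ (Submodule.subset_span ⟨i, rfl⟩)

theorem IsVectorBundle.exists_isFrame (hE : IsVectorBundle E r) (x : C.X) :
    ∃ (U : C.X.Opens) (_ : x ∈ U) (e : Fin r → Γ(E, U)), IsFrame U e := by
  obtain ⟨U, hx, e, he⟩ := hE x
  exact ⟨U, hx, e, he⟩

theorem IsVectorBundle.toRat_injective (hE : IsVectorBundle E r) (x : C.X) :
    Function.Injective (toRat E x) := by
  obtain ⟨U, hx, e, he⟩ := hE.exists_isFrame x
  rw [injective_iff_map_eq_zero]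
  intro v hv
  obtain ⟨g, rfl⟩ := (Submodule.mem_span_range_iff_exists_fun _).1
    ((he.linearIndependent_and_span hx).2 ▸ Submodule.mem_top : v ∈ Submodule.span _ _)
  rw [map_sum] at hv
  simp only [toRat_smul, toRat_germAt] at hv
  have h1 := Fintype.linearIndependent_iff.1
    (he.linearIndependent_and_span (genericPoint_mem hx)).1 _ hv
  refine Finset.sum_eq_zero fun i _ => ?_
  rw [(map_eq_zero_iff _ (Curve.algebraMap_localRing_injective x)).1 (h1 i), zero_smul]

/-! ### The lattices of a vector bundle -/

/-- The rational sections of `E` which are regular at `x`. -/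
def regularSections (E : C.X.Modules) (x : C.Pt) : Submodule ℂ (Rat E) where
  __ := (toRat E x.1).range
  smul_mem' := by
    rintro c _ ⟨e, rfl⟩
    refine ⟨C.localConstants x.1 c • e, ?_⟩
    rw [toRat_smul, Curve.algebraMap_localConstants, algebraMap_smul]

theorem mem_regularSections {x : C.Pt} {v : Rat E} :
    v ∈ regularSections E x ↔ ∃ e, toRat E x.1 e = v := Iff.rfl

/-- The germs of rational sections regular at `x` are the lattice spanned by a basis of the
stalk. -/
theorem regularSections_eq_lat {x : C.Pt} {f : Fin r → Stalk E x.1}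
    (hf : Submodule.span (C.localRing x.1) (Set.range f) = ⊤) (b : Module.Basis (Fin r) C.K (Rat E))
    (hb : ∀ i, b i = toRat E x.1 (f i)) : regularSections E x = lat (C.places.O x) b := by
  apply le_antisymm
  · rintro _ ⟨e, rfl⟩ i
    obtain ⟨g, rfl⟩ := (Submodule.mem_span_range_iff_exists_fun _).1
      (hf ▸ Submodule.mem_top : e ∈ Submodule.span _ (Set.range f))
    have h1 : toRat E x.1 (∑ i, g i • f i) = ∑ i, algebraMap (C.localRing x.1) C.K (g i) • b i := by
      rw [map_sum]
      exact Finset.sum_congr rfl fun i _ => by rw [toRat_smul, hb]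
    refine ⟨g i, ?_⟩
    change _ = b.repr (toRat E x.1 (∑ i, g i • f i)) i
    rw [h1, b.repr_sum_self]
  · intro v hv
    choose a ha using hv
    refine ⟨∑ i, a i • f i, ?_⟩
    rw [map_sum, ← b.sum_repr v]
    exact Finset.sum_congr rfl fun i _ => by rw [toRat_smul, hb, ← ha]

/-- The image of a basis of a stalk is a basis of the rational sections. -/
theorem IsVectorBundle.exists_basis_rat (hE : IsVectorBundle E r) (x : C.Pt)
    (f : Module.Basis (Fin r) (C.localRing x.1) (Stalk E x.1)) :
    ∃ b : Module.Basis (Fin r) C.K (Rat E), ∀ i, b i = toRat E x.1 (f i) := by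
  obtain ⟨U, hx, e, he⟩ := hE.exists_isFrame x.1
  obtain ⟨hli, hspan⟩ := he.linearIndependent_and_span (genericPoint_mem hx)
  let b' : Module.Basis (Fin r) C.K (Rat E) := .mk hli hspan.ge
  have hsp : ⊤ ≤ Submodule.span C.K (Set.range fun i => toRat E x.1 (f i)) := by
    rw [← b'.span_eq]
    refine Submodule.span_le.2 ?_
    rintro _ ⟨i, rfl⟩
    have hb : b' i = germAt E (genericPoint_mem hx) (e i) := Module.Basis.mk_apply _ _ i
    rw [hb, ← toRat_germAt E hx, ← f.sum_repr (germAt E hx (e i)), map_sum]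
    exact sum_mem fun i _ => by
      rw [toRat_smul]
      exact Submodule.smul_mem _ _ (Submodule.subset_span ⟨i, rfl⟩)
  exact ⟨.mk (linearIndependent_of_top_le_span_of_card_eq_finrank hsp
    (Module.finrank_eq_card_basis b').symm) hsp, fun i => Module.Basis.mk_apply _ _ i⟩

/-- A vector bundle is trivialized, at almost all points, by any basis of its rational sections. -/
theorem IsVectorBundle.finite_regularSections_ne (hE : IsVectorBundle E r)
    (b : Module.Basis (Fin r) C.K (Rat E)) :
    {x | regularSections E x ≠ lat (C.places.O x) b}.Finite := by
  obtain ⟨U, hη, e, he⟩ := hE.exists_isFrame (genericPoint C.X)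
  obtain ⟨hli, hsp⟩ := he.linearIndependent_and_span hη
  let b' : Module.Basis (Fin r) C.K (Rat E) := .mk hli hsp.ge
  have hb' : ∀ i, b' i = germAt E hη (e i) := fun i => Module.Basis.mk_apply _ _ i
  refine ((Curve.finite_notMem_opens hη).union (((Set.finite_iUnion fun i =>
    (isLatticeFamily_lat C.places b').finite_notMem (b i))).union (Set.finite_iUnion fun i =>
    (isLatticeFamily_lat C.places b).finite_notMem (b' i)))).subset fun x hx => ?_
  by_contra h
  simp only [Set.mem_union, Set.mem_iUnion, not_or, not_exists] at h
  obtain ⟨hU, h2, h3⟩ := h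
  have hU : x.1 ∈ U := not_not.1 hU
  refine hx ?_
  rw [regularSections_eq_lat (he.linearIndependent_and_span hU).2 b' fun i => by
    rw [hb', toRat_germAt]]
  exact le_antisymm (lat_le (fun a ha v hv => smul_mem_lat ha hv) fun i => not_not.1 (h3 i))
    (lat_le (fun a ha v hv => smul_mem_lat ha hv) fun i => not_not.1 (h2 i))

/-- The global sections are the rational sections which are regular everywhere. -/
theorem IsVectorBundle.exists_linearEquiv_H0 (hE : IsVectorBundle E r) :
    ∃ φ : Γ(E, ⊤) ≃ₗ[ℂ] H0 (regularSections E), ∀ s,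
      (φ s : Rat E) = germ E (genericPoint C.X) s := by
  have hS : E.presheaf.IsSheaf := E.isSheaf
  have hF : ∀ x : C.X,
      Function.Injective (E.presheaf.stalkSpecializes (genericPoint_specializes x)) :=
    fun x => hE.toRat_injective x
  let φ : Γ(E, ⊤) →ₗ[ℂ] Rat E :=
    { toFun := germ E (genericPoint C.X)
      map_add' := map_add (germAt E (U := ⊤) (x := genericPoint C.X) trivial)
      map_smul' := fun c s => germAt_smul E (U := ⊤) (x := genericPoint C.X) trivial _ s }
  have hinj : Function.Injective φ := fun s t h =>
    eq_of_germ_genericPoint_eq hS hF (U := ⊤) trivial h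
  have hrange : LinearMap.range φ = H0 (regularSections E) := by
    ext v
    rw [mem_H0]
    constructor
    · rintro ⟨s, rfl⟩ x
      exact ⟨germ E x.1 s, toRat_germAt E (U := ⊤) trivial s⟩
    · intro hv
      obtain ⟨s, hs⟩ := exists_germ_genericPoint_eq hS hF v fun x => by
        rcases Curve.eq_genericPoint_or_isClosed x with rfl | hx
        · exact ⟨v, congrArg (fun h : E.presheaf.stalk (genericPoint C.X) ⟶ _ => h v)
            (E.presheaf.stalkSpecializes_refl _)⟩
        · exact hv ⟨x, hx⟩
      exact ⟨s, hs⟩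
  refine ⟨(LinearEquiv.ofInjective φ hinj).trans (LinearEquiv.ofEq _ _ hrange), fun s => rfl⟩

theorem isEndFamily_regularEnd (E : C.X.Modules) :
    IsEndFamily (regularSections E) (regularEnd E) := by
  intro x φ
  constructor
  · rintro h _ ⟨e, rfl⟩
    obtain ⟨e', he'⟩ := h e
    exact ⟨e', he'.symm⟩
  · intro h e
    obtain ⟨e', he'⟩ := h _ ⟨e, rfl⟩
    exact ⟨e', he'.symm⟩

/-- Vanishing of a section to order `m` at `x` means that it is divisible by the `m`-th power of a
uniformiser. -/
theorem IsVectorBundle.vanishesToOrder_iff (hE : IsVectorBundle E r) {s : Γ(E, ⊤)} {x : C.Pt}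
    {z : C.K} (hz : C.IsUniformizer x z) (m : ℕ) : VanishesToOrder E s x m ↔
      (z ^ m)⁻¹ • (germ E (genericPoint C.X) s : Rat E) ∈ regularSections E x := by
  have hz0 := pow_ne_zero m (Curve.isPlace_valuationRing hz).ne_zero
  obtain ⟨ϖ, hϖ, rfl⟩ := hz
  have h1 : toRat E x.1 (germ E x.1 s) = germ E (genericPoint C.X) s :=
    toRat_germAt E (U := ⊤) (x := x.1) trivial s
  rw [VanishesToOrder, hϖ, Ideal.span_singleton_pow, Submodule.ideal_span_singleton_smul,
    Submodule.mem_smul_pointwise_iff_exists, mem_regularSections, ← h1]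
  constructor
  · rintro ⟨e, -, he⟩
    refine ⟨e, ?_⟩
    rw [← he, toRat_smul, map_pow, smul_smul, inv_mul_cancel₀ hz0, one_smul]
  · rintro ⟨e, he⟩
    refine ⟨e, trivial, hE.toRat_injective x.1 ?_⟩
    rw [toRat_smul, he, map_pow, smul_smul, mul_inv_cancel₀ hz0, one_smul]

end Germs

end CurveBundle

end

noncomputable section

namespace CurveBundle

/-! ### The span of the locus `N(s)` -/

section Locus

variable {C : Curve} {E : C.X.Modules} {r : ℕ}

theorem derivPsi_eq {x : C.Pt} {z : C.K} (hz : C.IsUniformizer x z) (m : ℕ) (φ : RatEnd E) :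
    derivPsi E x z m φ =
      (m.factorial : ℂ) • classAt (regularEnd E) x ((z ^ (m + 1))⁻¹ • φ) := by
  rw [derivPsi, coeff_simplePole (Curve.isPlace_valuationRing hz).ne_zero]

/-- Global sections are regular rational sections. -/
theorem germ_mem_H0 (s : Γ(E, ⊤)) :
    (germ E (genericPoint C.X) s : Rat E) ∈ H0 (regularSections E) :=
  mem_H0.2 fun x => ⟨germ E x.1 s, toRat_germAt E (U := ⊤) trivial s⟩

/-- The map `H¹(End E) → H¹(E)` given by the evaluation at a global section of `E`. -/
abbrev evalSection (s : Γ(E, ⊤)) : H1End E →ₗ[ℂ] H1 (regularSections E) :=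
  evalH1 (isEndFamily_regularEnd E) (germ_mem_H0 s)

theorem evalSection_derivPsi {s : Γ(E, ⊤)} {x : C.Pt} {z : C.K} (hz : C.IsUniformizer x z) (m : ℕ)
    (φ : RatEnd E) : evalSection s (derivPsi E x z m φ) = (m.factorial : ℂ) •
      classAt (regularSections E) x
        (φ ((z ^ (m + 1))⁻¹ • (germ E (genericPoint C.X) s : Rat E))) := by
  rw [derivPsi_eq hz, map_smul, evalH1_classAt, LinearMap.smul_apply, map_smul φ]

theorem VanishesToOrder.mono {s : Γ(E, ⊤)} {x : C.Pt} {m k : ℕ} (hmk : m ≤ k)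
    (h : VanishesToOrder E s x k) : VanishesToOrder E s x m :=
  Submodule.smul_mono_left (Ideal.pow_le_pow_right hmk) h

/-- A pole of order at most the multiplicity of the zero of `s` is cancelled by evaluation at
`s`. -/
theorem IsVectorBundle.evalSection_derivPsi_eq_zero (hE : IsVectorBundle E r) {s : Γ(E, ⊤)}
    {x : C.Pt} {z : C.K} (hz : C.IsUniformizer x z) {k m : ℕ} (hs : VanishesToOrder E s x k)
    (hmk : m + 1 ≤ k) {φ : RatEnd E} (hφ : φ ∈ regularEnd E x) :
    evalSection s (derivPsi E x z m φ) = 0 := by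
  rw [evalSection_derivPsi hz, classAt_eq_zero, smul_zero]
  exact (isEndFamily_regularEnd E x φ).1 hφ _
    ((hE.vanishesToOrder_iff hz _).1 (hs.mono hmk))

theorem IsVectorBundle.osc_le_ker (hE : IsVectorBundle E r) {s : Γ(E, ⊤)} {x : C.Pt} {z : C.K}
    (hz : C.IsUniformizer x z) {k : ℕ} (hk : 1 ≤ k) (hs : VanishesToOrder E s x k) {φ : RatEnd E}
    (hφ : φ ∈ regularEnd E x) : osc E x z (k - 1) φ ≤ LinearMap.ker (evalSection s) := by
  refine Submodule.span_le.2 ?_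
  rintro _ (⟨m, hm, rfl⟩ | ⟨m, hm, hmk, w, hw, rfl⟩)
  · exact hE.evalSection_derivPsi_eq_zero hz hs (by omega) hφ
  · exact hE.evalSection_derivPsi_eq_zero hz hs (by omega) hw

theorem IsVectorBundle.oscVert_le_ker (hE : IsVectorBundle E r) {s : Γ(E, ⊤)} {x : C.Pt}
    {z : C.K} (hz : C.IsUniformizer x z) {k : ℕ} (hk : 1 ≤ k) (hs : VanishesToOrder E s x k)
    {φ : RatEnd E} (hφ : φ ∈ regularEnd E x) :
    oscVert E x z k φ ≤ LinearMap.ker (evalSection s) := by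
  refine Submodule.span_le.2 ?_
  rintro _ (rfl | ⟨m, hm, hmk, w, hw, rfl⟩)
  · exact hE.evalSection_derivPsi_eq_zero hz hs hk hφ
  · exact hE.evalSection_derivPsi_eq_zero hz hs (by omega) hw

/-- The span of `N(s)` lies in the kernel of the evaluation at `s`. -/
theorem IsVectorBundle.span_locusN_le (hE : IsVectorBundle E r) (s : Γ(E, ⊤)) :
    Projectivization.Subspace.span (locusN E s) ≤
      (LinearMap.ker (evalSection s)).projectivization := by
  rw [Projectivization.Subspace.span_le_subspace_iff]
  rintro _ (⟨x, z, φ, hz, -, hφ, h, rfl⟩ | ⟨x, k, z, φ, hk, hs, hz, hφ, hP | hP⟩)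
  · refine (Submodule.mk_mem_projectivization_iff _ h).2 ?_
    rw [LinearMap.mem_ker, evalSection_derivPsi hz, map_smul, hφ, smul_zero, map_zero, smul_zero]
  · exact Submodule.projectivization.monotone (hE.osc_le_ker hz hk hs.1 hφ.1) hP
  · exact Submodule.projectivization.monotone (hE.oscVert_le_ker hz hk hs.1 hφ.1) hP

theorem le_submodule_span {V : Type} [AddCommGroup V] [Module ℂ V] {S : Set (ℙ ℂ V)} {v : V}
    (h : ∀ hv : v ≠ 0, Projectivization.mk ℂ v hv ∈ S) :
    v ∈ (Projectivization.Subspace.span S).submodule := by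
  by_cases hv : v = 0
  · rw [hv]
    exact zero_mem _
  · exact (Projectivization.Subspace.mem_submodule_iff _ hv).2
      (Projectivization.Subspace.subset_span S (h hv))

/-- Simple poles along endomorphisms which vanish at `s` are points of `ψ(ℙ K(s̄))`; if such an
endomorphism vanishes at `x`, then the class is zero. -/
theorem simplePoleClasses_subset (s : Γ(E, ⊤)) :
    simplePoleClasses C.places (regularEnd E) (germ E (genericPoint C.X) s : Rat E) ⊆
      (Projectivization.Subspace.span (locusN E s)).submodule := by
  rintro _ ⟨x, φ, hφ, hφs, rfl⟩
  have hz := Curve.isUniformizer_places x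
  refine le_submodule_span fun hv => Or.inl ?_
  have he : derivPsi E x (C.places.z x) 0 φ =
      classAt (regularEnd E) x ((C.places.z x)⁻¹ • φ) := by
    rw [derivPsi_eq hz, Nat.factorial_zero, Nat.cast_one, one_smul, zero_add, pow_one]
  refine ⟨x, _, φ, hz, ⟨hφ, fun h => hv (classAt_eq_zero h)⟩, hφs, he ▸ hv, ?_⟩
  simp only [he]

/-- Poles bounded by the zeros of `s` lie in vertical osculating spaces, for instance in those at
the point of `ℙ End(E)` given by the identity. -/
theorem IsVectorBundle.boundedPoleClasses_subset (hE : IsVectorBundle E r) (s : Γ(E, ⊤)) :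
    boundedPoleClasses C.places (regularSections E) (regularEnd E)
        (germ E (genericPoint C.X) s : Rat E) ⊆
      (Projectivization.Subspace.span (locusN E s)).submodule := by
  rintro _ ⟨x, k, m, hm, hmk, hk, hk', w, hw, rfl⟩
  have hz := Curve.isUniformizer_places x
  refine le_submodule_span fun hv => Or.inr ?_
  refine ⟨x, k, _, LinearMap.id, hm.trans hmk, ⟨(hE.vanishesToOrder_iff hz k).2 hk,
    fun h => hk' ((hE.vanishesToOrder_iff hz _).1 h)⟩, hz,
    ⟨(isEndFamily_regularEnd E x _).2 fun v hv => hv, fun h => hk' ?_⟩, Or.inr ?_⟩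
  · have h1 := (isEndFamily_regularEnd E x _).1 h _ hk
    rwa [LinearMap.smul_apply, LinearMap.id_apply, smul_smul, ← mul_inv, ← pow_succ'] at h1
  · refine (Submodule.mk_mem_projectivization_iff _ hv).2 ?_
    have h1 : derivPsi E x (C.places.z x) (m - 1) w ∈ oscVert E x (C.places.z x) k LinearMap.id :=
      Submodule.subset_span (Or.inr ⟨m, hm, hmk, w, hw, rfl⟩)
    rw [derivPsi_eq hz, Nat.sub_add_cancel hm] at h1
    exact (Submodule.smul_mem_iff _ (Nat.cast_ne_zero.2 (Nat.factorial_ne_zero _))).1 h1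

end Locus

end CurveBundle

end

/-! ### Sections and the codimension of the span -/

open CurveBundle

theorem mainTheorem3 (C : CurveBundle.Curve) (r : ℕ) (E : C.X.Modules)
    (hE : CurveBundle.IsVectorBundle E r)
    (hdeg : CurveBundle.HasDegree E r (r * ((C.genus : ℤ) - 1)))
    (s : Γ(E, ⊤)) (hs : s ≠ 0) :
    Module.Finite ℂ Γ(E, ⊤) ∧ Module.Finite ℂ (CurveBundle.H1End E) ∧
    (Module.finrank ℂ Γ(E, ⊤) : ℤ) =
      CurveBundle.projCodim (Projectivization.Subspace.span (CurveBundle.locusN E s)) := by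
  obtain ⟨b, F, hd⟩ := hdeg
  choose f hf using fun x => hE.exists_basis_rat x (F x)
  -- the local frames `F x` present `E` as a family of lattices in `Rat(E)`
  have hL : ∀ x, regularSections E x = lat (C.places.O x) (f x) := fun x =>
    regularSections_eq_lat (F x).span_eq (f x) (hf x)
  have hfin : {x | lat (C.places.O x) (f x) ≠ lat (C.places.O x) b}.Finite := by
    simpa only [hL] using hE.finite_regularSections_ne b
  obtain ⟨h0, -⟩ := Curve.finrank_H0_places C
  have h1 := Curve.finite_H1_places C
  -- the degree of `E` is minus `r χ(O)`, so that the Euler characteristic of `E` vanishes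
  have hχ : ∑ᶠ x, -(C.places.isPlace x).ord (b.det (f x)) =
      -(Fintype.card (Fin r) * chi C.places.functions) := by
    rw [Curve.chi_places, Fintype.card_fin, ← mul_neg, neg_sub, hd]
    refine finsum_congr fun x => ?_
    rw [← funext (hf x), Curve.ord_eq (Curve.isUniformizer_places x) (b.isUnit_det (f x)).ne_zero]
    rfl
  obtain ⟨e, he⟩ := hE.exists_linearEquiv_H0
  have hs0 : (germ E (genericPoint C.X) s : Rat E) ≠ 0 := fun h =>
    hs (e.map_eq_zero_iff.1 (Subtype.ext ((he s).trans h)))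
  have hM := isEndFamily_regularEnd E
  obtain ⟨i0, i1, i2⟩ := finrank_H0_eq_codim_ker hL hM b hfin h0 h1 hχ (germ_mem_H0 s) hs0
  -- a linear subspace of `ℙ W` is the same as a linear subspace of `W`
  have hker : (Projectivization.Subspace.span (locusN E s)).submodule =
      LinearMap.ker (evalSection s) := by
    apply le_antisymm
    · exact (OrderIso.le_symm_apply _).1 (hE.span_locusN_le s)
    · rw [ker_evalH1 hL hM b hfin h0 h1 (germ_mem_H0 s) hs0, Submodule.span_le]
      exact Set.union_subset (simplePoleClasses_subset s) (hE.boundedPoleClasses_subset s)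
  refine ⟨Module.Finite.equiv e.symm, i1, ?_⟩
  rw [e.finrank_eq, i2, projCodim, projDim, projDim, hker]
  ring
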